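/- Let $\chi(s)=\pi^{s-1/2}\,\Gamma\bigl(\tfrac12(1-s)\bigr)/\Gamma\bigl(\tfrac12 s\bigr)$ be the factor of the functional equation $\zeta(s)=\chi(s)\zeta(1-s)$ of the Riemann zeta-function, and let $Z(t)=\zeta(\tfrac12+it)\,\chi(\tfrac12+it)^{-1/2}$ ($t\in\mathbb R$) be Hardy's function, where $\chi(\tfrac12+it)^{-1/2}$ is the continuous branch equal to $1$ at $t=0$; $Z$ is real-valued. Assume the Riemann hypothesis. Then for every integer $k\ge 2$ and every real $\alpha$ with $0<\alpha\le 1$ there are constants $c>0$ and $T_0$, depending only on $k$ and $\alpha$, such that for all $T\ge T_0$ and all $H$ with $T^\alpha\le H\le T$, $$\int_T^{T+H}\bigl(Z'(t)\bigr)^2\,Z(t)^{2k-2}\,dt\;\ge\; c\,H(\log T)^{k^2+2}.$$ -/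

import Mathlib

open Complex
open scoped ComplexConjugate

/-- The factor `χ` of the functional equation `ζ(s) = χ(s) ζ(1 - s)`. -/
noncomputable def chi (s : ℂ) : ℂ :=
  Gamma ((1 - s) / 2) / Gamma (s / 2) * (Real.pi : ℂ) ^ (s - 1 / 2)

/-- The continuous branch of `χ(1/2 + it)^(-1/2)`, `t` real, with value `1` at `t = 0`. It is
`exp (i θ(t))`, where `θ(t) = arg Γ(1/4 + it/2) - (t/2) log π`. -/
noncomputable def chiInvSqrt (t : ℝ) : ℂ :=
  Gamma (1 / 4 + I * t / 2) / (‖Gamma (1 / 4 + I * t / 2)‖ : ℂ) * (Real.pi : ℂ) ^ (-(I * t / 2))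

/-- Hardy's function `Z(t) = ζ(1/2 + it) χ(1/2 + it)^(-1/2)`. The product is real, see
`ofReal_hardyZ`. -/
noncomputable def hardyZ (t : ℝ) : ℝ :=
  (riemannZeta (1 / 2 + I * t) * chiInvSqrt t).re

theorem gamma_quarter_ne_zero (t : ℝ) : Gamma (1 / 4 + I * t / 2) ≠ 0 := by
  apply Gamma_ne_zero_of_re_pos
  norm_num

theorem norm_chiInvSqrt (t : ℝ) : ‖chiInvSqrt t‖ = 1 := by
  have h : ‖Gamma (1 / 4 + I * t / 2)‖ ≠ 0 := norm_ne_zero_iff.mpr (gamma_quarter_ne_zero t)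
  rw [chiInvSqrt, norm_mul, norm_div, norm_real, norm_norm, div_self h,
    norm_cpow_eq_rpow_re_of_pos Real.pi_pos]
  simp

theorem chiInvSqrt_zero : chiInvSqrt 0 = 1 := by
  have h : Gamma (1 / 4 : ℂ) = ((Real.Gamma (1 / 4) : ℝ) : ℂ) := by
    rw [← Gamma_ofReal]; norm_num
  have hp : 0 < Real.Gamma (1 / 4) := Real.Gamma_pos_of_pos (by norm_num)
  have hc : ((Real.Gamma (1 / 4) : ℝ) : ℂ) ≠ 0 := by exact_mod_cast hp.ne'
  unfold chiInvSqrt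
  simp only [ofReal_zero, mul_zero, zero_div, add_zero, neg_zero, cpow_zero, mul_one]
  rw [h, norm_real, Real.norm_of_nonneg hp.le, div_self hc]

theorem continuous_chiInvSqrt : Continuous chiInvSqrt := by
  have hG : Continuous fun t : ℝ => Gamma (1 / 4 + I * t / 2) := by
    rw [continuous_iff_continuousAt]
    intro t
    have h1 : ContinuousAt Gamma (1 / 4 + I * t / 2) := by
      apply (differentiableAt_Gamma _ _).continuousAt
      intro m hm
      have := congrArg re hm
      norm_num at this
      have hm0 : (0 : ℝ) ≤ m := m.cast_nonneg
      linarith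
    exact ContinuousAt.comp (f := fun t : ℝ => (1 / 4 + I * t / 2 : ℂ)) h1
      (by fun_prop : Continuous fun t : ℝ => (1 / 4 + I * t / 2 : ℂ)).continuousAt
  have hpi : (Real.pi : ℂ) ≠ 0 := by exact_mod_cast Real.pi_ne_zero
  unfold chiInvSqrt
  refine (hG.div (continuous_ofReal.comp hG.norm) fun t => ?_).mul
    (Continuous.const_cpow (by fun_prop) (Or.inl hpi))
  simpa using gamma_quarter_ne_zero t

/-- `chiInvSqrt t` is a square root of `1 / χ(1/2 + it)`. -/
theorem chiInvSqrt_sq_mul_chi (t : ℝ) : chiInvSqrt t ^ 2 * chi (1 / 2 + I * t) = 1 := by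
  have hpi : (Real.pi : ℂ) ≠ 0 := by exact_mod_cast Real.pi_ne_zero
  have h1 : ((1 / 2 + I * t) / 2 : ℂ) = 1 / 4 + I * t / 2 := by ring
  have h2 : ((1 - (1 / 2 + I * t)) / 2 : ℂ) = conj (1 / 4 + I * t / 2 : ℂ) := by
    rw [show (1 / 4 + I * t / 2 : ℂ) = ((1 / 4 : ℝ) : ℂ) + ((t / 2 : ℝ) : ℂ) * I by
      push_cast; ring, map_add, map_mul, conj_ofReal, conj_ofReal, conj_I]
    push_cast
    ring
  have h3 : (1 / 2 + I * t - 1 / 2 : ℂ) = I * t / 2 + I * t / 2 := by ring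
  have hg := gamma_quarter_ne_zero t
  have hn : (‖Gamma (1 / 4 + I * t / 2)‖ : ℂ) ≠ 0 := by simpa using hg
  have hc := mul_conj' (Gamma (1 / 4 + I * t / 2))
  have hp : (Real.pi : ℂ) ^ (I * t / 2) ≠ 0 := by simp [cpow_eq_zero_iff, hpi]
  rw [chi, chiInvSqrt, h1, h2, h3, Gamma_conj, cpow_add _ _ hpi, cpow_neg]
  generalize Gamma (1 / 4 + I * t / 2) = g at *
  generalize (Real.pi : ℂ) ^ (I * t / 2) = p at *
  field_simp
  linear_combination hc

/-- The functional equation on the critical line. -/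
theorem zeta_eq_chi_mul (t : ℝ) :
    riemannZeta (1 / 2 + I * t) = chi (1 / 2 + I * t) * riemannZeta (1 - (1 / 2 + I * t)) := by
  have hpi : (Real.pi : ℂ) ≠ 0 := by exact_mod_cast Real.pi_ne_zero
  have hs : (1 / 2 + I * t : ℂ) ≠ 0 := fun h => by simpa using congrArg re h
  have hs' : (1 - (1 / 2 + I * t) : ℂ) ≠ 0 := fun h => by
    have := congrArg re h
    norm_num at this
  have hG : Gammaℝ (1 - (1 / 2 + I * t)) ≠ 0 :=
    Gammaℝ_ne_zero_of_re_pos (by norm_num)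
  have hG' : Gamma ((1 / 2 + I * t) / 2) ≠ 0 :=
    Gamma_ne_zero_of_re_pos (by norm_num)
  have hchi : chi (1 / 2 + I * t) = Gammaℝ (1 - (1 / 2 + I * t)) / Gammaℝ (1 / 2 + I * t) := by
    have hp : (Real.pi : ℂ) ^ (-(1 / 2 + I * t) / 2) ≠ 0 := by
      simp [cpow_eq_zero_iff, hpi]
    have he : (-(1 - (1 / 2 + I * t)) / 2 : ℂ) =
        (1 / 2 + I * t - 1 / 2) + -(1 / 2 + I * t) / 2 := by ring
    rw [chi, Gammaℝ_def, Gammaℝ_def, he, cpow_add _ _ hpi]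
    field_simp
  rw [riemannZeta_def_of_ne_zero hs, riemannZeta_def_of_ne_zero hs',
    completedRiemannZeta_one_sub, hchi, div_mul_div_comm, mul_comm (Gammaℝ (1 / 2 + I * t)),
    mul_div_mul_left _ _ hG]

/-- The product that defines `Z(t)` is real. -/
theorem ofReal_hardyZ (t : ℝ) :
    (hardyZ t : ℂ) = riemannZeta (1 / 2 + I * t) * chiInvSqrt t := by
  rw [hardyZ]
  apply conj_eq_iff_re.mp
  have h1 : (1 - (1 / 2 + I * t) : ℂ) = conj (1 / 2 + I * t : ℂ) := by
    apply Complex.ext <;> norm_num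
  have hz := zeta_eq_chi_mul t
  rw [h1, riemannZeta_conj] at hz
  have hq := chiInvSqrt_sq_mul_chi t
  have hn : chiInvSqrt t * conj (chiInvSqrt t) = 1 := by
    rw [mul_conj', norm_chiInvSqrt]; simp
  rw [map_mul]
  linear_combination (-chiInvSqrt t) * hz
    - conj (riemannZeta (1 / 2 + I * t)) * conj (chiInvSqrt t) * hq
    + conj (riemannZeta (1 / 2 + I * t)) * chiInvSqrt t * chi (1 / 2 + I * t) * hn

/-! Since (Z^k)' = k Z^(k-1) Z', the integrand is (Z^k)'^2 / k^2, so what is needed is a lower bound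
for the mean square of E = (Z^k)'. It comes from testing E against a mollifier-like function and
applying Cauchy–Schwarz.

Let A(s) = ∑_{m ≤ N} d_k(m) m^(s-1), with N a small power of T. On the critical line A is the
complex conjugate of the partial sum of ζ^k. Let W be a Gaussian of width h centred at t₀, and put J
= ∫ E χ^(k/2) A W. Because Z^k χ^(k/2) = ζ^k there, integration by parts turns J, up to boundary
terms, into i ∫ ζ^k (kθ' A - A' - ...) W, where θ' = -χ'/(2χ) is close to λ = log(t₀/2π)/2. This
integrand is holomorphic off the real axis, so the line can be moved to Re s = 2, where ζ^k is the
absolutely convergent series ∑ d_k(n) n^(-s). Against a Gaussian much wider than N only the terms n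
= m survive, and J is i √π h ∑ d_k(m)^2 (kλ - log m)/m up to a small error. As N is a small power of
T, the factor kλ - log m is at least a constant times log T. Hence |J| is at least a constant times
Q log T, where Q = √π h ∑_{m ≤ N} d_k(m)^2/m.

The same diagonal principle gives ∫ |A|^2 W ≤ 2Q, and χ^(k/2) has modulus 1. Cauchy–Schwarz
therefore yields ∫ E^2 W ≫ Q (log T)^2. The lower bound ∑_{m ≤ N} d_k(m)^2/m ≫ (log N)^(k^2)
supplies the remaining powers of the logarithm, and averaging over t₀ replaces the Gaussian windows
by [T, T+H].

The argument is carried by `exists_mul_log_pow_le_sum_piltz_sq` (the divisor sum),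
`norm_integral_dirichlet_sub_diagonal_le` (the diagonal principle),
`norm_twisted_integral_sub_main_le` (the evaluation of J), `window_lower_bound` (Cauchy–Schwarz) and
`mul_le_integral_of_window_le` (averaging). The analytic input is θ'(s) = log(t/2π)/2 + O(1/t),
obtained from the digamma function, and a polynomial bound for ζ. -/

/-! ### The divisor function d_k and the lower bound for ∑ d_k(m)^2/m -/

/-- The `k`-fold divisor function `d_k`, the coefficients of `ζ(s) ^ k`. -/
def piltz (k : ℕ) : ArithmeticFunction ℕ := ArithmeticFunction.zeta ^ k

theorem piltz_succ_apply (k n : ℕ) : piltz (k + 1) n = ∑ d ∈ n.divisors, piltz k d := by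
  rw [piltz, pow_succ, ArithmeticFunction.mul_zeta_apply]
  rfl

theorem piltz_zero_le (n : ℕ) : piltz 0 n ≤ 1 := by
  rw [piltz, pow_zero, ArithmeticFunction.one_apply]
  split_ifs <;> simp

theorem piltz_one_apply (k : ℕ) : piltz k 1 = 1 := by
  induction k with
  | zero => simp [piltz]
  | succ k ih => simp [piltz_succ_apply, ih]

-- By induction on k: every divisor of ab is a product of a divisor of a and a divisor of b, so
-- summing over pairs can only overcount.
open scoped Pointwise in
theorem piltz_mul_le (k a b : ℕ) : piltz k (a * b) ≤ piltz k a * piltz k b := by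
  induction k generalizing a b with
  | zero =>
    simp only [piltz, pow_zero, ArithmeticFunction.one_apply]
    split_ifs with h1 h2 h3 <;> simp_all
  | succ k ih =>
    simp only [piltz_succ_apply, Nat.divisors_mul]
    calc ∑ d ∈ a.divisors * b.divisors, piltz k d
        ≤ ∑ p ∈ a.divisors ×ˢ b.divisors, piltz k (p.1 * p.2) := by
          rw [Finset.mul_def]
          exact Finset.sum_image_le_of_nonneg (fun _ _ => Nat.zero_le _)
      _ ≤ ∑ p ∈ a.divisors ×ˢ b.divisors, piltz k p.1 * piltz k p.2 :=
          Finset.sum_le_sum fun p _ => ih _ _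
      _ = _ := by rw [Finset.sum_mul_sum, Finset.sum_product]

theorem piltz_le_pow (k n : ℕ) (hn : n ≠ 0) : piltz k n ≤ n ^ k := by
  induction k generalizing n with
  | zero => simpa using piltz_zero_le n
  | succ k ih =>
    rw [piltz_succ_apply]
    calc ∑ d ∈ n.divisors, piltz k d ≤ ∑ d ∈ n.divisors, n ^ k := by
          refine Finset.sum_le_sum fun d hd => (ih d (Nat.pos_of_mem_divisors hd).ne').trans ?_
          exact Nat.pow_le_pow_left (Nat.divisor_le hd) k
      _ = n.divisors.card * n ^ k := by simp
      _ ≤ n * n ^ k := Nat.mul_le_mul_right _ (Nat.card_divisors_le_self n)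
      _ = n ^ (k + 1) := by ring

theorem piltz_le_card_divisors_pow (k n : ℕ) (hn : n ≠ 0) : piltz k n ≤ n.divisors.card ^ k := by
  induction k generalizing n with
  | zero => simpa using piltz_zero_le n
  | succ k ih =>
    rw [piltz_succ_apply]
    calc ∑ d ∈ n.divisors, piltz k d ≤ ∑ d ∈ n.divisors, n.divisors.card ^ k := by
          refine Finset.sum_le_sum fun d hd => (ih d (Nat.pos_of_mem_divisors hd).ne').trans ?_
          exact Nat.pow_le_pow_left
            (Finset.card_le_card (Nat.divisors_subset_of_dvd hn (Nat.dvd_of_mem_divisors hd))) k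
      _ = n.divisors.card * n.divisors.card ^ k := by simp
      _ = _ := by ring

theorem sum_divisorsAntidiagonal_le_sum_prod (N : ℕ) (F : ℕ × ℕ → ℝ) (hF : ∀ p, 0 ≤ F p) :
    ∑ n ∈ Finset.Icc 1 N, ∑ p ∈ n.divisorsAntidiagonal, F p ≤
      ∑ p ∈ Finset.Icc 1 N ×ˢ Finset.Icc 1 N, F p := by
  classical
  rw [Finset.sum_sigma']
  rw [← Finset.sum_image (s := (Finset.Icc 1 N).sigma fun n => n.divisorsAntidiagonal)
    (g := fun x => x.2) (f := F)]
  · refine Finset.sum_le_sum_of_subset_of_nonneg ?_ fun p _ _ => hF p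
    intro p hp
    obtain ⟨⟨n, q⟩, hx, rfl⟩ := Finset.mem_image.mp hp
    simp only [Finset.mem_sigma, Finset.mem_Icc, Nat.mem_divisorsAntidiagonal] at hx
    simp only [Finset.mem_product, Finset.mem_Icc]
    obtain ⟨⟨h1, h2⟩, h3, h4⟩ := hx
    have ha : 0 < q.1 := Nat.pos_of_ne_zero fun h => h4 (by rw [← h3, h, zero_mul])
    have hb : 0 < q.2 := Nat.pos_of_ne_zero fun h => h4 (by rw [← h3, h, mul_zero])
    have := Nat.le_mul_of_pos_right q.1 hb
    have := Nat.le_mul_of_pos_left q.2 ha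
    omega
  · rintro ⟨n, p⟩ hn ⟨m, q⟩ hm hpq
    simp only [Finset.coe_sigma, Set.mem_sigma_iff, Finset.mem_coe,
      Nat.mem_divisorsAntidiagonal] at hn hm
    simp only at hpq
    subst hpq
    obtain rfl : n = m := by rw [← hn.2.1, hm.2.1]
    rfl

theorem sum_prod_le_sum_divisorsAntidiagonal (M N : ℕ) (F : ℕ × ℕ → ℝ) (hF : ∀ p, 0 ≤ F p) :
    ∑ p ∈ Finset.Icc 1 M ×ˢ Finset.Icc 1 N, F p ≤
      ∑ n ∈ Finset.Icc 1 (M * N), ∑ p ∈ n.divisorsAntidiagonal, F p := by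
  classical
  rw [← Finset.sum_fiberwise_of_maps_to (s := Finset.Icc 1 M ×ˢ Finset.Icc 1 N)
    (t := Finset.Icc 1 (M * N)) (g := fun p => p.1 * p.2)]
  · refine Finset.sum_le_sum fun n hn => Finset.sum_le_sum_of_subset_of_nonneg ?_ fun p _ _ => hF p
    intro p hp
    simp only [Finset.mem_filter] at hp
    simp only [Finset.mem_Icc] at hn
    exact Nat.mem_divisorsAntidiagonal.mpr ⟨hp.2, by omega⟩
  · intro p hp
    simp only [Finset.mem_product, Finset.mem_Icc] at hp ⊢
    exact ⟨Nat.mul_pos hp.1.1 hp.2.1, Nat.mul_le_mul hp.1.2 hp.2.2⟩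

/-- The number of divisors of n counts its factorisations n = ab, and g(n) ≤ g(a) g(b) for each of
them. The partial sums are thus bounded by (∑ g(n)/n^2)^2. Iterating from g = 1 handles every power
of the divisor function. -/
theorem summable_mul_card_divisors {g : ℕ → ℝ} (h0 : ∀ n, 0 ≤ g n)
    (hm : ∀ a b, g (a * b) ≤ g a * g b) (hs : Summable fun n : ℕ => g n / (n : ℝ) ^ 2) :
    Summable fun n : ℕ => g n * (n.divisors.card : ℝ) / (n : ℝ) ^ 2 := by
  have hn : ∀ n : ℕ, 0 ≤ g n / (n : ℝ) ^ 2 := fun n => div_nonneg (h0 n) (by positivity)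
  refine summable_of_sum_le (c := (∑' n : ℕ, g n / (n : ℝ) ^ 2) ^ 2)
    (fun n => div_nonneg (mul_nonneg (h0 n) (by positivity)) (by positivity)) fun u => ?_
  obtain ⟨N, hN⟩ := u.exists_nat_subset_range
  have hterm : ∀ n ∈ Finset.Icc 1 N, g n * (n.divisors.card : ℝ) / (n : ℝ) ^ 2 ≤
      ∑ p ∈ n.divisorsAntidiagonal, g p.1 / (p.1 : ℝ) ^ 2 * (g p.2 / (p.2 : ℝ) ^ 2) := by
    intro n _
    have : g n * (n.divisors.card : ℝ) / (n : ℝ) ^ 2 =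
        ∑ p ∈ n.divisorsAntidiagonal, g n / (n : ℝ) ^ 2 := by
      rw [Finset.sum_const, ← Nat.map_div_right_divisors, Finset.card_map, nsmul_eq_mul]
      ring
    rw [this]
    refine Finset.sum_le_sum fun p hp => ?_
    rw [Nat.mem_divisorsAntidiagonal] at hp
    rw [← hp.1, div_mul_div_comm, Nat.cast_mul, mul_pow]
    gcongr
    exact hm _ _
  calc ∑ n ∈ u, g n * (n.divisors.card : ℝ) / (n : ℝ) ^ 2
      ≤ ∑ n ∈ insert 0 (Finset.Icc 1 N), g n * (n.divisors.card : ℝ) / (n : ℝ) ^ 2 := by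
        refine Finset.sum_le_sum_of_subset_of_nonneg (fun n hn' => ?_)
          fun n _ _ => div_nonneg (mul_nonneg (h0 n) (by positivity)) (by positivity)
        have := Finset.mem_range.mp (hN hn')
        simp only [Finset.mem_insert, Finset.mem_Icc]
        omega
    _ = ∑ n ∈ Finset.Icc 1 N, g n * (n.divisors.card : ℝ) / (n : ℝ) ^ 2 := by
        rw [Finset.sum_insert (by simp)]
        simp
    _ ≤ _ := Finset.sum_le_sum hterm
    _ ≤ _ := sum_divisorsAntidiagonal_le_sum_prod N
        (fun p => g p.1 / (p.1 : ℝ) ^ 2 * (g p.2 / (p.2 : ℝ) ^ 2))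
        fun p => mul_nonneg (hn _) (hn _)
    _ = (∑ n ∈ Finset.Icc 1 N, g n / (n : ℝ) ^ 2) ^ 2 := by
        rw [sq, Finset.sum_mul_sum, Finset.sum_product]
    _ ≤ _ := by
        gcongr
        · exact Finset.sum_nonneg fun n _ => hn n
        · exact hs.sum_le_tsum _ fun n _ => hn n

theorem summable_card_divisors_pow_div_sq (j : ℕ) :
    Summable fun n : ℕ => (n.divisors.card : ℝ) ^ j / (n : ℝ) ^ 2 := by
  induction j with
  | zero => simp
  | succ j ih =>
    simp only [pow_succ (_ : ℝ) j]
    refine summable_mul_card_divisors (fun n => by positivity) (fun a b => ?_) ih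
    rw [← mul_pow]
    gcongr
    rw [Nat.divisors_mul]
    exact_mod_cast Finset.card_mul_le

theorem summable_piltz_sq_div_sq (k : ℕ) :
    Summable fun n : ℕ => (piltz k n : ℝ) ^ 2 / (n : ℝ) ^ 2 := by
  refine (summable_card_divisors_pow_div_sq (k * 2)).of_nonneg_of_le (fun n => by positivity)
    fun n => ?_
  rcases eq_or_ne n 0 with rfl | hn
  · simp
  rw [pow_mul]
  gcongr
  exact_mod_cast piltz_le_card_divisors_pow k n hn

/-- Expanding the power, each n ≤ X^k occurs with weight 1/n once for every ordered factorisation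
into k factors at most X, hence at most d_k(n) times. -/
theorem harmonic_pow_le_sum_piltz (X k : ℕ) :
    (∑ a ∈ Finset.Icc 1 X, (1 : ℝ) / a) ^ k ≤ ∑ n ∈ Finset.Icc 1 (X ^ k), (piltz k n : ℝ) / n := by
  induction k with
  | zero => simp [piltz_one_apply]
  | succ k ih =>
    calc (∑ a ∈ Finset.Icc 1 X, (1 : ℝ) / a) ^ (k + 1)
        = (∑ a ∈ Finset.Icc 1 X, (1 : ℝ) / a) ^ k * ∑ a ∈ Finset.Icc 1 X, (1 : ℝ) / a := pow_succ _ _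
      _ ≤ (∑ n ∈ Finset.Icc 1 (X ^ k), (piltz k n : ℝ) / n) * ∑ a ∈ Finset.Icc 1 X, (1 : ℝ) / a := by
          gcongr
      _ = ∑ p ∈ Finset.Icc 1 (X ^ k) ×ˢ Finset.Icc 1 X, (piltz k p.1 : ℝ) / p.1 * (1 / p.2) := by
          rw [Finset.sum_mul_sum, Finset.sum_product]
      _ ≤ _ := sum_prod_le_sum_divisorsAntidiagonal (X ^ k) X
          (fun p => (piltz k p.1 : ℝ) / p.1 * (1 / p.2)) fun p => by positivity
      _ = _ := by
          rw [← pow_succ]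
          refine Finset.sum_congr rfl fun n hn => ?_
          rw [Nat.sum_divisorsAntidiagonal
            (f := fun a b => (piltz k a : ℝ) / a * (1 / b)), piltz_succ_apply, Nat.cast_sum,
            Finset.sum_div]
          refine Finset.sum_congr rfl fun d hd => ?_
          have hd0 : (d : ℝ) ≠ 0 := by exact_mod_cast (Nat.pos_of_mem_divisors hd).ne'
          have hn0 : (n : ℝ) ≠ 0 := by
            have := (Finset.mem_Icc.mp hn).1
            positivity
          rw [Nat.cast_div (Nat.dvd_of_mem_divisors hd) hd0]
          field_simp

/-- For squarefree m with ω prime factors, d_j(m) = j^ω for every j. -/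
theorem piltz_sq_of_squarefree (k : ℕ) {m : ℕ} (hm : Squarefree m) :
    piltz k m ^ 2 = piltz (k ^ 2) m := by
  have hmul : ∀ j, (piltz j).IsMultiplicative := by
    intro j
    induction j with
    | zero => simp [piltz, ArithmeticFunction.isMultiplicative_one]
    | succ j ih =>
      rw [piltz, pow_succ]
      exact ArithmeticFunction.IsMultiplicative.mul ih ArithmeticFunction.isMultiplicative_zeta
  have hp : ∀ j p, p.Prime → piltz j p = j := by
    intro j p hp
    induction j with
    | zero => simp [piltz, hp.ne_one]
    | succ j ih =>
      rw [piltz_succ_apply, Nat.Prime.sum_divisors hp, ih, piltz_one_apply]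
  have key : ∀ j, piltz j m = ∏ p ∈ m.primeFactors, j := by
    intro j
    rw [← Nat.prod_primeFactors_of_squarefree hm, (hmul j).map_prod_of_prime _
      fun p hp => Nat.prime_of_mem_primeFactors hp, Nat.prod_primeFactors_of_squarefree hm]
    exact Finset.prod_congr rfl fun p h => hp j p (Nat.prime_of_mem_primeFactors h)
  rw [key, key, Finset.prod_pow]

/-- Write n = m r^2 with m squarefree. Submultiplicativity gives d_k(n)/n ≤ (d_k(m)/m)
(d_k(r)^2/r^2), and the sum over r converges, so restricting to squarefree m costs only a constant.
-/
theorem sum_piltz_le_squarefree (k N : ℕ) :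
    ∑ n ∈ Finset.Icc 1 N, (piltz k n : ℝ) / n ≤
      (∑ m ∈ (Finset.Icc 1 N).filter Squarefree, (piltz k m : ℝ) / m) *
        ∑' r : ℕ, (piltz k r : ℝ) ^ 2 / (r : ℝ) ^ 2 := by
  classical
  choose! m r hmr using fun n : ℕ => fun (_ : n ≠ 0) => Nat.sq_mul_squarefree n
  set F : ℕ × ℕ → ℝ := fun p => (piltz k p.1 : ℝ) / p.1 * ((piltz k p.2 : ℝ) ^ 2 / (p.2 : ℝ) ^ 2)
  calc ∑ n ∈ Finset.Icc 1 N, (piltz k n : ℝ) / n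
      ≤ ∑ n ∈ Finset.Icc 1 N, F (m n, r n) := by
        refine Finset.sum_le_sum fun n hn => ?_
        obtain ⟨h1, -⟩ := hmr n (by have := (Finset.mem_Icc.mp hn).1; omega)
        have h2 : piltz k n ≤ piltz k (m n) * piltz k (r n) ^ 2 := by
          conv_lhs => rw [← h1]
          rw [sq, sq]
          calc piltz k (r n * r n * m n) ≤ piltz k (r n * r n) * piltz k (m n) := piltz_mul_le _ _ _
            _ ≤ piltz k (r n) * piltz k (r n) * piltz k (m n) :=
              Nat.mul_le_mul_right _ (piltz_mul_le _ _ _)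
            _ = _ := by ring
        have h3 : (n : ℝ) = m n * (r n : ℝ) ^ 2 := by
          conv_lhs => rw [← h1]
          push_cast; ring
        simp only [F]
        rw [div_mul_div_comm, ← h3]
        gcongr
        exact_mod_cast h2
    -- The pair (m, r) determines n, so distinct n give distinct terms of the product sum.
    _ = ∑ p ∈ (Finset.Icc 1 N).image fun n => (m n, r n), F p := by
        rw [Finset.sum_image]
        intro a ha b hb hab
        have ha' := (hmr a (by have := (Finset.mem_Icc.mp ha).1; omega)).1
        have hb' := (hmr b (by have := (Finset.mem_Icc.mp hb).1; omega)).1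
        simp only [Prod.mk.injEq] at hab
        rw [← ha', ← hb', hab.1, hab.2]
    _ ≤ ∑ p ∈ ((Finset.Icc 1 N).filter Squarefree) ×ˢ Finset.Icc 1 N, F p := by
        refine Finset.sum_le_sum_of_subset_of_nonneg ?_ fun p _ _ => by positivity
        intro p hp
        obtain ⟨n, hn, rfl⟩ := Finset.mem_image.mp hp
        have hn' := Finset.mem_Icc.mp hn
        obtain ⟨h1, h2⟩ := hmr n (by omega)
        have hm0 : 0 < m n := Nat.pos_of_ne_zero fun h => by simp [h] at h1; omega
        have hr0 : 0 < r n := Nat.pos_of_ne_zero fun h => by simp [h] at h1; omega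
        have h3 : m n ≤ n := by
          conv_rhs => rw [← h1]
          exact Nat.le_mul_of_pos_left _ (by positivity)
        have h4 : r n ≤ n := by
          conv_rhs => rw [← h1, sq, mul_assoc]
          exact Nat.le_mul_of_pos_right _ (by positivity)
        simp only [Finset.mem_product, Finset.mem_filter, Finset.mem_Icc]
        exact ⟨⟨by omega, h2⟩, by omega⟩
    _ = (∑ m ∈ (Finset.Icc 1 N).filter Squarefree, (piltz k m : ℝ) / m) *
        ∑ r ∈ Finset.Icc 1 N, (piltz k r : ℝ) ^ 2 / (r : ℝ) ^ 2 := by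
        rw [Finset.sum_mul_sum, Finset.sum_product]
    _ ≤ _ := by
        gcongr
        exact (summable_piltz_sq_div_sq k).sum_le_tsum _ fun n _ => by positivity

/-- On squarefree integers d_k^2 is d_K with K = k^2. The sum of d_K(n)/n over n ≤ N is at least the
K-th power of a harmonic sum, and passing to its squarefree part loses at most the constant R. -/
theorem exists_mul_log_pow_le_sum_piltz_sq (k : ℕ) (hk : k ≠ 0) :
    ∃ c : ℝ, 0 < c ∧ ∀ N : ℕ, 1 ≤ N →
      c * Real.log N ^ (k ^ 2) ≤ ∑ m ∈ Finset.Icc 1 N, (piltz k m : ℝ) ^ 2 / m := by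
  set K := k ^ 2 with hK
  have hK0 : K ≠ 0 := by positivity
  have hK1 : (0 : ℝ) < K := by positivity
  set R := ∑' r : ℕ, (piltz K r : ℝ) ^ 2 / (r : ℝ) ^ 2 with hR
  have hR1 : 0 < R := by
    refine (summable_piltz_sq_div_sq K).tsum_pos (fun n => by positivity) 1 ?_
    simp [piltz_one_apply]
  refine ⟨1 / (R * K ^ K), by positivity, fun N hN => ?_⟩
  -- The K-fold products of integers up to X stay below N, while log(X+1) is still at least (log
  -- N)/K. This is the source of the factor K^K in the constant.
  set X := ⌊(N : ℝ) ^ (1 / (K : ℝ))⌋₊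
  have hN0 : (0 : ℝ) < N := by positivity
  have hX1 : X ^ K ≤ N := by
    have : ((X : ℝ)) ^ K ≤ N := by
      calc (X : ℝ) ^ K ≤ ((N : ℝ) ^ (1 / (K : ℝ))) ^ K := by
            gcongr
            exact Nat.floor_le (by positivity)
        _ = N := by
            rw [one_div]
            exact Real.rpow_inv_natCast_pow hN0.le hK0
    exact_mod_cast this
  have hX2 : Real.log N / K ≤ ∑ a ∈ Finset.Icc 1 X, (1 : ℝ) / a := by
    calc Real.log N / K = Real.log ((N : ℝ) ^ (1 / (K : ℝ))) := by
          rw [Real.log_rpow hN0]; ring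
      _ ≤ Real.log ((X + 1 : ℕ) : ℝ) := by
          apply Real.log_le_log (by positivity)
          push_cast
          exact (Nat.lt_floor_add_one _).le
      _ ≤ harmonic X := log_add_one_le_harmonic X
      _ = _ := by
          rw [harmonic_eq_sum_Icc]
          push_cast
          simp
  have hlog : 0 ≤ Real.log N := Real.log_nonneg (by exact_mod_cast hN)
  have h1 : (Real.log N / K) ^ K ≤
      (∑ m ∈ Finset.Icc 1 N, (piltz k m : ℝ) ^ 2 / m) * R := by
    calc (Real.log N / K) ^ K ≤ (∑ a ∈ Finset.Icc 1 X, (1 : ℝ) / a) ^ K := by gcongr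
      _ ≤ _ := harmonic_pow_le_sum_piltz X K
      _ ≤ ∑ n ∈ Finset.Icc 1 N, (piltz K n : ℝ) / n :=
          Finset.sum_le_sum_of_subset_of_nonneg (Finset.Icc_subset_Icc le_rfl hX1)
            fun n _ _ => by positivity
      _ ≤ _ := sum_piltz_le_squarefree K N
      _ ≤ _ := by
          gcongr
          calc ∑ m ∈ (Finset.Icc 1 N).filter Squarefree, (piltz K m : ℝ) / m
              = ∑ m ∈ (Finset.Icc 1 N).filter Squarefree, (piltz k m : ℝ) ^ 2 / m := by
                refine Finset.sum_congr rfl fun m hm => ?_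
                rw [hK, ← piltz_sq_of_squarefree k (Finset.mem_filter.mp hm).2]
                push_cast; rfl
            _ ≤ _ := Finset.sum_le_sum_of_subset_of_nonneg (Finset.filter_subset _ _)
                fun n _ _ => by positivity
  rw [div_pow] at h1
  calc 1 / (R * K ^ K) * Real.log N ^ K = Real.log N ^ K / K ^ K / R := by
        field_simp
    _ ≤ _ := by rw [div_le_iff₀ hR1]; exact h1

/-! ### The digamma function in the right half-plane -/

open Filter Topology Metric in
/-- Derivatives of a bounded, pointwise convergent sequence of holomorphic functions converge. -/
theorem tendsto_deriv_of_bounded_of_tendsto {f : ℕ → ℂ → ℂ} {g : ℂ → ℂ} {c : ℂ} {R M : ℝ}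
    (hR : 0 < R) (hf : ∀ᶠ n in atTop, DifferentiableOn ℂ (f n) (closedBall c R))
    (hg : DifferentiableOn ℂ g (closedBall c R))
    (hb : ∀ᶠ n in atTop, ∀ z ∈ sphere c R, ‖f n z‖ ≤ M)
    (hl : ∀ z ∈ sphere c R, Tendsto (fun n => f n z) atTop (𝓝 (g z))) :
    Tendsto (fun n => deriv (f n) c) atTop (𝓝 (deriv g c)) := by
  -- Cauchy's formula writes the derivative as an integral over the circle, to which dominated
  -- convergence applies.
  have key : ∀ φ : ℂ → ℂ, DifferentiableOn ℂ φ (closedBall c R) →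
      deriv φ c = (2 * Real.pi * I)⁻¹ • ∮ z in C(c, R), (1 / (z - c) ^ 2) • φ z := by
    intro φ hφ
    rw [DifferentiableOn.deriv_eq_smul_circleIntegral hR hφ, smul_smul, inv_mul_cancel₀, one_smul]
    simp [Real.pi_ne_zero]
  rw [key g hg]
  have hcongr : (fun n => (2 * Real.pi * I : ℂ)⁻¹ • ∮ z in C(c, R), (1 / (z - c) ^ 2) • f n z)
      =ᶠ[atTop] fun n => deriv (f n) c := by
    filter_upwards [hf] with n hn using (key _ hn).symm
  refine Tendsto.congr' hcongr (Tendsto.const_smul ?_ _)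
  unfold circleIntegral
  have hcont : ∀ φ : ℂ → ℂ, DifferentiableOn ℂ φ (closedBall c R) →
      Continuous fun θ : ℝ => φ (circleMap c R θ) := fun φ hφ =>
    hφ.continuousOn.comp_continuous (continuous_circleMap c R)
      fun θ => circleMap_mem_closedBall c hR.le θ
  refine intervalIntegral.tendsto_integral_filter_of_dominated_convergence
    (fun _ => R * (1 / R ^ 2 * M)) ?_ ?_ (by simp) ?_
  · filter_upwards [hf] with n hn
    refine Continuous.aestronglyMeasurable ?_
    have hne : ∀ θ : ℝ, (circleMap c R θ - c) ^ 2 ≠ 0 := fun θ => by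
      simp [circleMap, hR.ne']
    have h1 := hcont _ hn
    have h2 : Continuous fun θ : ℝ => deriv (circleMap c R) θ := by
      simp only [deriv_circleMap]; fun_prop
    exact h2.smul ((continuous_const.div (by fun_prop) hne).smul h1)
  · filter_upwards [hb] with n hn
    refine MeasureTheory.ae_of_all _ fun θ _ => ?_
    have h1 := hn _ (circleMap_mem_sphere c hR.le θ)
    simp only [norm_smul, norm_div, norm_pow, norm_one, deriv_circleMap, norm_mul, norm_I, mul_one,
      circleMap_sub_center, norm_circleMap_zero, abs_of_pos hR]
    gcongr
  · refine MeasureTheory.ae_of_all _ fun θ _ => ?_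
    exact ((hl _ (circleMap_mem_sphere c hR.le θ)).const_smul _).const_smul _

/-- In Euler's integral over [0, n] the factor (1 - x/n)^n is at most e^(-x). The bound is uniform
in n, which is what convergence of the derivatives requires. -/
theorem norm_gammaSeq_le {s : ℂ} (hs : 0 < s.re) {n : ℕ} (hn : n ≠ 0) :
    ‖GammaSeq s n‖ ≤ Real.Gamma s.re := by
  rw [GammaSeq_eq_approx_Gamma_integral hs hn, Real.Gamma_eq_integral hs,
    intervalIntegral.integral_of_le (by positivity)]
  calc _ ≤ ∫ x in Set.Ioc (0 : ℝ) n, Real.exp (-x) * x ^ (s.re - 1) := by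
        refine MeasureTheory.norm_integral_le_of_norm_le
          ((Real.GammaIntegral_convergent hs).mono_set Set.Ioc_subset_Ioi_self) ?_
        refine (MeasureTheory.ae_restrict_iff' measurableSet_Ioc).mpr
          (MeasureTheory.ae_of_all _ fun x hx => ?_)
        have h0 : 0 ≤ 1 - x / n := sub_nonneg.mpr (div_le_one_of_le₀ hx.2 (by positivity))
        rw [norm_mul, Complex.norm_of_nonneg (pow_nonneg h0 _), norm_cpow_eq_rpow_re_of_pos hx.1, sub_re,
          one_re]
        have := Real.rpow_nonneg hx.1.le (s.re - 1)
        gcongr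
        exact Real.one_sub_div_pow_le_exp_neg hx.2
    _ ≤ _ := by
        refine MeasureTheory.setIntegral_mono_set (Real.GammaIntegral_convergent hs) ?_
          Set.Ioc_subset_Ioi_self.eventuallyLE
        refine (MeasureTheory.ae_restrict_iff' measurableSet_Ioi).mpr
          (MeasureTheory.ae_of_all _ fun x hx => ?_)
        exact mul_nonneg (Real.exp_pos _).le (Real.rpow_nonneg (le_of_lt hx) _)

theorem add_natCast_ne_zero_of_re_pos {s : ℂ} (hs : 0 < s.re) (j : ℕ) : s + j ≠ 0 := fun h => by
  have := congrArg re h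
  simp only [add_re, natCast_re, zero_re] at this
  have hj : (0 : ℝ) ≤ j := j.cast_nonneg
  linarith

theorem differentiableAt_gammaSeq {s : ℂ} (hs : 0 < s.re) {n : ℕ} (hn : n ≠ 0) :
    DifferentiableAt ℂ (fun z => GammaSeq z n) s := by
  unfold GammaSeq
  have hn' : (n : ℂ) ≠ 0 := by exact_mod_cast hn
  refine DifferentiableAt.fun_div ((DifferentiableAt.const_cpow differentiableAt_id
    (Or.inl hn')).mul_const _) ?_ (Finset.prod_ne_zero_iff.mpr
      fun j _ => add_natCast_ne_zero_of_re_pos hs j)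
  fun_prop

theorem logDeriv_gammaSeq {s : ℂ} (hs : 0 < s.re) {n : ℕ} (hn : n ≠ 0) :
    logDeriv (fun z => GammaSeq z n) s =
      log n - ∑ j ∈ Finset.range (n + 1), 1 / (s + j) := by
  have hn' : (n : ℂ) ≠ 0 := by exact_mod_cast hn
  have hj := add_natCast_ne_zero_of_re_pos hs
  unfold GammaSeq
  have hd : DifferentiableAt ℂ (fun z : ℂ => (n : ℂ) ^ z) s :=
    DifferentiableAt.const_cpow differentiableAt_id (Or.inl hn')
  rw [logDeriv_div (f := fun z : ℂ => (n : ℂ) ^ z * n.factorial)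
      (g := fun z : ℂ => ∏ j ∈ Finset.range (n + 1), (z + j)) _ (mul_ne_zero (by simp [cpow_eq_zero_iff, hn']) (by
      exact_mod_cast n.factorial_ne_zero)) (Finset.prod_ne_zero_iff.mpr fun j _ => hj j)
      (hd.mul_const _) (by fun_prop), logDeriv_mul_const _ _ (by
      exact_mod_cast n.factorial_ne_zero), logDeriv_prod (fun j _ => hj j)
      (fun j _ => by fun_prop)]
  congr 1
  · have h : HasDerivAt (fun z : ℂ => (n : ℂ) ^ z) ((n : ℂ) ^ s * log n * 1) s :=
      (hasDerivAt_id s).const_cpow (Or.inl hn')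
    rw [logDeriv_apply, h.deriv, mul_one, mul_div_cancel_left₀]
    simp [cpow_eq_zero_iff, hn']
  · refine Finset.sum_congr rfl fun j _ => ?_
    rw [logDeriv_apply]
    simp

theorem differentiableAt_gamma_of_re_pos {s : ℂ} (hs : 0 < s.re) : DifferentiableAt ℂ Gamma s :=
  differentiableAt_Gamma _ fun m h =>
    add_natCast_ne_zero_of_re_pos hs m (by rw [h]; ring)

-- The left side is the logarithmic derivative of Euler's product `GammaSeq`. That product converges
-- pointwise to Γ and is bounded near s uniformly in n, so its derivatives converge as well.
open Filter Topology Metric in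
theorem tendsto_log_sub_sum_digamma {s : ℂ} (hs : 0 < s.re) :
    Tendsto (fun n : ℕ => log n - ∑ j ∈ Finset.range (n + 1), 1 / (s + j)) atTop
      (𝓝 (digamma s)) := by
  have hre : ∀ z ∈ closedBall s (s.re / 2), z.re ∈ Set.Icc (s.re / 2) (3 * s.re / 2) := by
    intro z hz
    have h1 : |(z - s).re| ≤ s.re / 2 :=
      (abs_re_le_norm _).trans (by simpa [dist_eq_norm] using hz)
    rw [sub_re, abs_le] at h1
    constructor <;> linarith
  obtain ⟨M, hM⟩ := (isCompact_Icc (a := s.re / 2) (b := 3 * s.re / 2)).exists_bound_of_continuousOn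
    (f := Real.Gamma) fun x hx => (Real.differentiableAt_Gamma fun m h => by
      have := hx.1
      have hm : (0 : ℝ) ≤ m := m.cast_nonneg
      linarith).continuousAt.continuousWithinAt
  have hderiv : Tendsto (fun n : ℕ => deriv (fun z => GammaSeq z n) s) atTop (𝓝 (deriv Gamma s)) := by
    refine tendsto_deriv_of_bounded_of_tendsto (R := s.re / 2) (M := M) (by linarith) ?_ ?_ ?_ ?_
    · filter_upwards [eventually_ne_atTop 0] with n hn z hz
      exact (differentiableAt_gammaSeq (by linarith [(hre z hz).1]) hn).differentiableWithinAt
    · intro z hz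
      exact (differentiableAt_gamma_of_re_pos (by linarith [(hre z hz).1])).differentiableWithinAt
    · filter_upwards [eventually_ne_atTop 0] with n hn z hz
      have hz' := hre z (sphere_subset_closedBall hz)
      exact (norm_gammaSeq_le (by linarith [hz'.1]) hn).trans
        ((le_abs_self _).trans (hM _ hz'))
    · intro z _
      exact GammaSeq_tendsto_Gamma z
  have := hderiv.div (GammaSeq_tendsto_Gamma s) (Gamma_ne_zero_of_re_pos hs)
  refine Tendsto.congr' ?_ this
  filter_upwards [eventually_ne_atTop 0] with n hn
  rw [← logDeriv_gammaSeq hs hn]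
  rfl

theorem norm_log_sub_log_le {a b : ℂ} {r : ℝ} (hr : 0 < r)
    (h : ∀ x ∈ segment ℝ a b, x ∈ slitPlane ∧ r ≤ ‖x‖) : ‖log b - log a‖ ≤ r⁻¹ * ‖b - a‖ := by
  refine (convex_segment a b).norm_image_sub_le_of_norm_hasDerivWithin_le (f' := fun x => x⁻¹)
    (fun x hx => (hasDerivAt_log (h x hx).1).hasDerivWithinAt) (fun x hx => ?_)
    (left_mem_segment ℝ a b) (right_mem_segment ℝ a b)
  rw [norm_inv]
  exact inv_anti₀ hr (h x hx).2

/-- Mean value inequality for x ↦ log(w + x) - x/w on [0, 1], whose derivative is -x/((w + x) w),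
together with |w + x| ≥ |w|. -/
theorem norm_log_add_one_sub_log_sub_inv_le {w : ℂ} (hw : 0 < w.re) :
    ‖log (w + 1) - log w - 1 / w‖ ≤ 1 / ‖w‖ ^ 2 := by
  have hw0 : w ≠ 0 := fun h => by simp [h] at hw
  have hnw : 0 < ‖w‖ := norm_pos_iff.mpr hw0
  have hle : ∀ x : ℝ, 0 ≤ x → ‖w‖ ≤ ‖w + x‖ := fun x hx => by
    rw [← sq_le_sq₀ (norm_nonneg _) (norm_nonneg _), ← normSq_eq_norm_sq, ← normSq_eq_norm_sq,
      normSq_apply, normSq_apply]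
    simp
    nlinarith
  have hpos : ∀ x : ℝ, 0 ≤ x → w + x ∈ slitPlane := fun x hx => Or.inl (by simp; linarith)
  have hd : ∀ x ∈ Set.Icc (0 : ℝ) 1, HasDerivWithinAt (fun x : ℝ => log (w + x) - x / w)
      (1 / (w + x) - 1 / w) (Set.Icc 0 1) x := by
    intro x hx
    have h1 : HasDerivAt (fun x : ℝ => w + (x : ℂ)) 1 x :=
      (ofRealCLM.hasDerivAt (x := x)).const_add w
    have h2 := (h1.clog_real (hpos x hx.1)).sub ((ofRealCLM.hasDerivAt (x := x)).div_const w)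
    exact h2.hasDerivWithinAt
  have hb := (convex_Icc (0 : ℝ) 1).norm_image_sub_le_of_norm_hasDerivWithin_le
    (C := 1 / ‖w‖ ^ 2) hd (fun x hx => ?_) (Set.left_mem_Icc.mpr zero_le_one)
    (Set.right_mem_Icc.mpr zero_le_one)
  · simpa [sub_right_comm] using hb
  · have hx0 : w + x ≠ 0 := slitPlane_ne_zero (hpos x hx.1)
    have : 1 / (w + x) - 1 / w = -x / ((w + x) * w) := by field_simp; ring
    rw [this, norm_div, norm_mul, norm_neg, norm_real, Real.norm_of_nonneg hx.1, sq]
    have := hle x hx.1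
    gcongr
    exact hx.2

open Filter Topology in
/-- `ψ(z) = log z + O(1 / |Im z|)` in the right half-plane. -/
theorem norm_digamma_sub_log_le {z : ℂ} (hz : 0 < z.re) (hy : 2 ≤ |z.im|) :
    ‖digamma z - log z‖ ≤ 4 / |z.im| := by
  set y := |z.im| with hy_def
  have hre : ∀ j : ℕ, 0 < (z + j).re := fun j => by
    have hj : (0 : ℝ) ≤ j := j.cast_nonneg
    simp; linarith
  -- From |z + j|^2 ≥ (y + j)^2/2 ≥ (y - 1 + j)(y + j)/2 the terms are dominated by a telescoping
  -- series with sum 2/(y - 1), which is at most 4/y for y ≥ 2.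
  have hterm : ∀ j : ℕ, 1 / ‖z + j‖ ^ 2 ≤ 2 * (1 / (y - 1 + j) - 1 / (y - 1 + (j + 1 : ℕ))) := by
    intro j
    have hj : (0 : ℝ) ≤ j := j.cast_nonneg
    have h1 : ((y + j) ^ 2) / 2 ≤ ‖z + j‖ ^ 2 := by
      rw [← normSq_eq_norm_sq, normSq_apply]
      simp only [add_re, natCast_re, add_im, natCast_im, add_zero]
      have : z.im * z.im = y ^ 2 := by rw [hy_def, sq_abs]; ring
      nlinarith [sq_nonneg (y - j)]
    have hy1 : 0 < y - 1 + j := by linarith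
    have h2 : 1 / (y - 1 + j) - 1 / (y - 1 + (j + 1 : ℕ)) = 1 / ((y - 1 + j) * (y + j)) := by
      have : 0 < y + j := by linarith
      push_cast
      rw [show y - 1 + (j + 1) = y + j by ring]
      field_simp
      ring
    rw [h2]
    calc 1 / ‖z + j‖ ^ 2 ≤ 1 / ((y + j) ^ 2 / 2) := by
          apply one_div_le_one_div_of_le _ h1
          have : 0 < y + j := by linarith
          positivity
      _ = 2 * (1 / ((y + j) ^ 2)) := by
          have : 0 < y + j := by linarith
          field_simp
      _ ≤ _ := by
          have : 0 < y + j := by linarith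
          gcongr
          nlinarith
  have hfin : ∀ n : ℕ, ‖log (z + (n + 1 : ℕ)) - log z - ∑ j ∈ Finset.range (n + 1), 1 / (z + j)‖ ≤
      4 / y := by
    intro n
    have htel : log (z + (n + 1 : ℕ)) - log z =
        ∑ j ∈ Finset.range (n + 1), (log (z + (j + 1 : ℕ)) - log (z + j)) := by
      rw [Finset.sum_range_sub (fun j : ℕ => log (z + j))]
      simp
    rw [htel, ← Finset.sum_sub_distrib]
    calc _ ≤ ∑ j ∈ Finset.range (n + 1), 1 / ‖z + j‖ ^ 2 := by
          refine norm_sum_le_of_le _ fun j _ => ?_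
          have := norm_log_add_one_sub_log_sub_inv_le (hre j)
          rwa [add_assoc, ← Nat.cast_add_one] at this
      _ ≤ ∑ j ∈ Finset.range (n + 1), 2 * (1 / (y - 1 + j) - 1 / (y - 1 + (j + 1 : ℕ))) :=
          Finset.sum_le_sum fun j _ => hterm j
      _ = 2 * (1 / (y - 1) - 1 / (y - 1 + (n + 1 : ℕ))) := by
          rw [← Finset.mul_sum, Finset.sum_range_sub' (fun j : ℕ => 1 / (y - 1 + j))]
          simp
      _ ≤ 2 * (1 / (y - 1)) := by
          have : 0 ≤ 1 / (y - 1 + (n + 1 : ℕ)) := by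
            have : (0 : ℝ) ≤ (n + 1 : ℕ) := Nat.cast_nonneg _
            apply one_div_nonneg.mpr; linarith
          linarith
      _ ≤ 4 / y := by
          rw [mul_one_div, div_le_div_iff₀ (by linarith) (by linarith)]
          linarith
  have hlim0 : Tendsto (fun n : ℕ => log (z + (n + 1 : ℕ)) - log n) atTop (𝓝 0) := by
    have h1 : Tendsto (fun n : ℕ => ‖z + 1‖ / n) atTop (𝓝 0) :=
      tendsto_const_div_atTop_nhds_zero_nat _
    refine squeeze_zero_norm' ?_ h1
    filter_upwards [eventually_gt_atTop 0] with n hn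
    have hn' : (0 : ℝ) < n := by exact_mod_cast hn
    have := norm_log_sub_log_le (a := (n : ℂ)) (b := z + (n + 1 : ℕ)) hn' fun x hx => ?_
    · refine this.trans (le_of_eq ?_)
      rw [show z + ((n + 1 : ℕ) : ℂ) - n = z + 1 by push_cast; ring]
      ring
    · have hxre : (n : ℝ) ≤ x.re := by
        have hc : Convex ℝ {w : ℂ | (n : ℝ) ≤ w.re} := convex_halfSpace_re_ge _
        refine hc.segment_subset ?_ ?_ hx
        · simp
        · simp; linarith
      exact ⟨Or.inl (by linarith), hxre.trans (re_le_norm x)⟩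
  have hlim : Tendsto (fun n : ℕ => ‖log (z + (n + 1 : ℕ)) - log z -
      ∑ j ∈ Finset.range (n + 1), 1 / (z + j)‖) atTop (𝓝 ‖digamma z - log z‖) := by
    refine Tendsto.norm ?_
    have := ((tendsto_log_sub_sum_digamma hz).add hlim0).sub_const (log z)
    rw [add_zero] at this
    refine this.congr fun n => ?_
    ring
  exact le_of_tendsto' hlim hfin

/-! ### The derivatives of θ and of χ^(-1/2) -/

/-- The analytic continuation `-χ'/(2χ)` of the derivative of the Riemann–Siegel theta function,
`θ'(t) = thetaDeriv (1/2 + it)`. -/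
noncomputable def thetaDeriv (s : ℂ) : ℂ :=
  (digamma (s / 2) + digamma ((1 - s) / 2)) / 4 - log Real.pi / 2

/-- Off the real axis Γ has neither zeros nor poles. This keeps `thetaDeriv` holomorphic beyond Re s
= 1, where (1 - s)/2 leaves the right half-plane and the contour still has to go. -/
theorem differentiableAt_digamma_of_im_ne_zero {z : ℂ} (hz : z.im ≠ 0) :
    DifferentiableAt ℂ digamma z := by
  have hne : ∀ w : ℂ, w.im ≠ 0 → ∀ m : ℕ, w ≠ -m := fun w hw m h => hw (by rw [h]; simp)
  have hopen : IsOpen {w : ℂ | w.im ≠ 0} := isOpen_ne_fun continuous_im continuous_const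
  have hG : DifferentiableOn ℂ Gamma {w : ℂ | w.im ≠ 0} := fun w hw =>
    (differentiableAt_Gamma w (hne w hw)).differentiableWithinAt
  have h1 : DifferentiableAt ℂ (deriv Gamma) z :=
    (hG.deriv hopen).differentiableAt (hopen.mem_nhds hz)
  exact h1.div (differentiableAt_Gamma z (hne z hz)) (Gamma_ne_zero (hne z hz))

theorem differentiableAt_thetaDeriv {s : ℂ} (hs : s.im ≠ 0) : DifferentiableAt ℂ thetaDeriv s := by
  unfold thetaDeriv
  have h1 : DifferentiableAt ℂ (fun s : ℂ => digamma (s / 2)) s := by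
    refine DifferentiableAt.comp (f := fun s : ℂ => s / 2) s
      (differentiableAt_digamma_of_im_ne_zero ?_) (by fun_prop)
    simpa using hs
  have h2 : DifferentiableAt ℂ (fun s : ℂ => digamma ((1 - s) / 2)) s := by
    refine DifferentiableAt.comp (f := fun s : ℂ => (1 - s) / 2) s
      (differentiableAt_digamma_of_im_ne_zero ?_) (by fun_prop)
    simpa using hs
  fun_prop

theorem differentiableAt_digamma_of_re_pos {z : ℂ} (hz : 0 < z.re) :
    DifferentiableAt ℂ digamma z := by
  have hopen : IsOpen {w : ℂ | 0 < w.re} := isOpen_lt continuous_const continuous_re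
  have hG : DifferentiableOn ℂ Gamma {w : ℂ | 0 < w.re} := fun w hw =>
    (differentiableAt_gamma_of_re_pos hw).differentiableWithinAt
  have h1 : DifferentiableAt ℂ (deriv Gamma) z :=
    (hG.deriv hopen).differentiableAt (hopen.mem_nhds hz)
  exact h1.div (differentiableAt_gamma_of_re_pos hz) (Gamma_ne_zero_of_re_pos hz)

theorem differentiableAt_thetaDeriv_of_re {s : ℂ} (h0 : 0 < s.re) (h1 : s.re < 1) :
    DifferentiableAt ℂ thetaDeriv s := by
  unfold thetaDeriv
  have d1 : DifferentiableAt ℂ (fun s : ℂ => digamma (s / 2)) s :=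
    DifferentiableAt.comp (f := fun s : ℂ => s / 2) s
      (differentiableAt_digamma_of_re_pos (by simp; linarith)) (by fun_prop)
  have d2 : DifferentiableAt ℂ (fun s : ℂ => digamma ((1 - s) / 2)) s :=
    DifferentiableAt.comp (f := fun s : ℂ => (1 - s) / 2) s
      (differentiableAt_digamma_of_re_pos (by simp; linarith)) (by fun_prop)
  fun_prop

theorem norm_log_sub_log_le_of_im_eq {a b : ℂ} (h : a.im = b.im) (h0 : b.im ≠ 0) :
    ‖log b - log a‖ ≤ |b.im|⁻¹ * ‖b - a‖ := by
  refine norm_log_sub_log_le (abs_pos.mpr h0) fun x hx => ?_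
  have him : x.im = b.im := by
    have hc : Convex ℝ {w : ℂ | w.im = b.im} := convex_hyperplane imCLM.isLinear _
    exact hc.segment_subset h rfl hx
  refine ⟨Or.inr (by rwa [him]), ?_⟩
  rw [← him]
  exact abs_im_le_norm x

/-- Each digamma value is replaced by a logarithm, and each logarithm by its value on the imaginary
axis at the same height. The arguments of it/2 and -it/2 cancel, leaving 2 log(t/2). The errors
total 23/t before the division by 4. -/
theorem norm_thetaDeriv_sub_le {s : ℂ} (h1 : 1 / 2 ≤ s.re) (h2 : s.re ≤ 2) (ht : 4 ≤ s.im) :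
    ‖thetaDeriv s - (Real.log (s.im / (2 * Real.pi)) / 2 : ℝ)‖ ≤ 6 / s.im := by
  set t := s.im with ht_def
  set σ := s.re with hσ_def
  have htpos : 0 < t := by linarith
  have hne : (1 - s) / 2 ≠ 0 := fun h => by
    have := congrArg im h
    simp at this
    linarith
  -- For Re s ≥ 1 the point (1 - s)/2 is not in the right half-plane. The recurrence moves it to (3
  -- - s)/2, whose real part is at least 1/2.
  have hrec : digamma ((1 - s) / 2) = digamma ((3 - s) / 2) - ((1 - s) / 2)⁻¹ := by
    have := digamma_apply_add_one ((1 - s) / 2) fun m h => by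
      have := congrArg im h
      simp at this
      linarith
    rw [show (1 - s) / 2 + 1 = (3 - s) / 2 by ring] at this
    rw [this]; ring
  have e1 : ‖digamma (s / 2) - log (s / 2)‖ ≤ 8 / t := by
    have := norm_digamma_sub_log_le (z := s / 2) (by simp; linarith) (by
      simp [abs_div, ← ht_def, abs_of_pos htpos]; linarith)
    refine this.trans (le_of_eq ?_)
    simp [abs_div, ← ht_def, abs_of_pos htpos]
    field_simp
    norm_num
  have e2 : ‖digamma ((3 - s) / 2) - log ((3 - s) / 2)‖ ≤ 8 / t := by
    have := norm_digamma_sub_log_le (z := (3 - s) / 2) (by simp; linarith) (by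
      simp [abs_div, ← ht_def, abs_of_pos htpos]; linarith)
    refine this.trans (le_of_eq ?_)
    simp [abs_div, ← ht_def, abs_of_pos htpos]
    field_simp
    norm_num
  have e3 : ‖((1 - s) / 2)⁻¹‖ ≤ 2 / t := by
    rw [norm_inv, inv_le_comm₀ (norm_pos_iff.mpr hne) (by positivity), inv_div]
    have := abs_im_le_norm ((1 - s) / 2)
    simpa [abs_div, ← ht_def, abs_of_pos htpos] using this
  have e4 : ‖log (s / 2) - log ((t / 2 : ℝ) * I)‖ ≤ 2 / t := by
    refine (norm_log_sub_log_le_of_im_eq (by simp [← ht_def]) (by simp; linarith)).trans ?_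
    have : s / 2 - (t / 2 : ℝ) * I = ((σ / 2 : ℝ) : ℂ) := by
      apply Complex.ext <;> simp [ht_def, hσ_def]
    rw [this, norm_real, Real.norm_of_nonneg (by linarith)]
    simp only [div_ofNat_im, ← ht_def, abs_of_pos (by positivity : 0 < t / 2), inv_div]
    calc 2 / t * (σ / 2) ≤ 2 / t * 1 := by gcongr; linarith
      _ = _ := mul_one _
  have e5 : ‖log ((3 - s) / 2) - log ((t / 2 : ℝ) * (-I))‖ ≤ 3 / t := by
    refine (norm_log_sub_log_le_of_im_eq (by simp [← ht_def]; ring) (by simp; linarith)).trans ?_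
    have : (3 - s) / 2 - (t / 2 : ℝ) * (-I) = (((3 - σ) / 2 : ℝ) : ℂ) := by
      apply Complex.ext <;> simp [ht_def, hσ_def]; ring
    rw [this, norm_real, Real.norm_of_nonneg (by linarith)]
    have him : |((3 - s) / 2).im| = t / 2 := by
      simp [abs_div, ← ht_def, abs_of_pos htpos]
    rw [him, inv_div]
    calc 2 / t * ((3 - σ) / 2) ≤ 2 / t * (3 / 2) := by gcongr; linarith
      _ = _ := by ring
  have e6 : log ((t / 2 : ℝ) * I) + log ((t / 2 : ℝ) * (-I)) = (2 * Real.log (t / 2) : ℝ) := by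
    rw [log_ofReal_mul (by positivity) I_ne_zero,
      log_ofReal_mul (by positivity) (neg_ne_zero.mpr I_ne_zero), log_I, log_neg_I]
    push_cast; ring
  have e7 : Real.log (t / (2 * Real.pi)) = Real.log (t / 2) - Real.log Real.pi := by
    rw [← Real.log_div (by positivity) Real.pi_ne_zero, div_div]
  have hmain : thetaDeriv s - (Real.log (t / (2 * Real.pi)) / 2 : ℝ) =
      ((digamma (s / 2) - log (s / 2)) + (digamma ((3 - s) / 2) - log ((3 - s) / 2))
        - ((1 - s) / 2)⁻¹ + (log (s / 2) - log ((t / 2 : ℝ) * I))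
        + (log ((3 - s) / 2) - log ((t / 2 : ℝ) * (-I)))) / 4 := by
    have e6' : log ((t / 2 : ℝ) * (-I)) = (2 * Real.log (t / 2) : ℝ) - log ((t / 2 : ℝ) * I) := by
      rw [← e6]; ring
    rw [thetaDeriv, hrec, e7, e6', ofReal_div, ofReal_sub, ofReal_log Real.pi_pos.le]
    push_cast
    ring
  rw [hmain, norm_div, RCLike.norm_ofNat]
  have := norm_add_le ((digamma (s / 2) - log (s / 2)) +
    (digamma ((3 - s) / 2) - log ((3 - s) / 2)) - ((1 - s) / 2)⁻¹
    + (log (s / 2) - log ((t / 2 : ℝ) * I))) (log ((3 - s) / 2) - log ((t / 2 : ℝ) * (-I)))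
  have := norm_add_le ((digamma (s / 2) - log (s / 2)) +
    (digamma ((3 - s) / 2) - log ((3 - s) / 2)) - ((1 - s) / 2)⁻¹)
    (log (s / 2) - log ((t / 2 : ℝ) * I))
  have := norm_sub_le ((digamma (s / 2) - log (s / 2)) +
    (digamma ((3 - s) / 2) - log ((3 - s) / 2))) ((1 - s) / 2)⁻¹
  have := norm_add_le (digamma (s / 2) - log (s / 2))
    (digamma ((3 - s) / 2) - log ((3 - s) / 2))
  rw [div_le_iff₀ (by norm_num)]
  have hsum : 8 / t + 8 / t + 2 / t + 2 / t + 3 / t ≤ 6 / t * 4 := by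
    rw [← add_div, ← add_div, ← add_div, ← add_div, div_mul_eq_mul_div]
    gcongr
    norm_num
  linarith

theorem hasDerivAt_gamma_digamma {s : ℂ} (hs : 0 < s.re) :
    HasDerivAt Gamma (digamma s * Gamma s) s := by
  refine (differentiableAt_gamma_of_re_pos hs).hasDerivAt.congr_deriv ?_
  rw [digamma_def, logDeriv_apply, div_mul_cancel₀ _ (Gamma_ne_zero_of_re_pos hs)]

theorem hasDerivAt_chi {s : ℂ} (h0 : 0 < s.re) (h1 : s.re < 1) :
    HasDerivAt chi (-2 * thetaDeriv s * chi s) s := by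
  have hpi : (Real.pi : ℂ) ≠ 0 := by exact_mod_cast Real.pi_ne_zero
  have ha : 0 < ((1 - s) / 2).re := by simp; linarith
  have hb : 0 < (s / 2).re := by simp; linarith
  have d1 : HasDerivAt (fun s : ℂ => Gamma ((1 - s) / 2))
      (digamma ((1 - s) / 2) * Gamma ((1 - s) / 2) * (-1 / 2)) s :=
    (hasDerivAt_gamma_digamma ha).comp s (((hasDerivAt_id s).const_sub 1).div_const 2)
  have d2 : HasDerivAt (fun s : ℂ => Gamma (s / 2))
      (digamma (s / 2) * Gamma (s / 2) * (1 / 2)) s :=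
    (hasDerivAt_gamma_digamma hb).comp s ((hasDerivAt_id s).div_const 2)
  have d3 : HasDerivAt (fun s : ℂ => (Real.pi : ℂ) ^ (s - 1 / 2))
      ((Real.pi : ℂ) ^ (s - 1 / 2) * log Real.pi * 1) s :=
    ((hasDerivAt_id s).sub_const (1 / 2)).const_cpow (Or.inl hpi)
  have hG := Gamma_ne_zero_of_re_pos hb
  refine ((d1.div d2 hG).mul d3).congr_deriv ?_
  simp only [chi, thetaDeriv, Pi.div_apply]
  field_simp
  ring

/-- The value is read off by differentiating the identity `chiInvSqrt_sq_mul_chi`. The explicit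
formula, which involves |Γ|, is used only to know that a derivative exists. -/
theorem hasDerivAt_chiInvSqrt (t : ℝ) :
    HasDerivAt chiInvSqrt (I * thetaDeriv (1 / 2 + I * t) * chiInvSqrt t) t := by
  have hpi : (Real.pi : ℂ) ≠ 0 := by exact_mod_cast Real.pi_ne_zero
  have hg := gamma_quarter_ne_zero t
  have hl : HasDerivAt (fun t : ℝ => (I * t : ℂ)) I t := by
    simpa using (ofRealCLM.hasDerivAt (x := t)).const_mul I
  have hG : DifferentiableAt ℝ (fun t : ℝ => Gamma (1 / 4 + I * t / 2)) t := by
    have h1 := (hasDerivAt_gamma_digamma (s := 1 / 4 + I * t / 2) (by simp)).comp_of_eq t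
      (h₂ := Gamma) (h := fun t : ℝ => 1 / 4 + I * t / 2) ((hl.div_const 2).const_add (1 / 4)) rfl
    exact h1.differentiableAt
  have hd : DifferentiableAt ℝ chiInvSqrt t := by
    have h1 : DifferentiableAt ℝ (fun t : ℝ => (‖Gamma (1 / 4 + I * t / 2)‖ : ℂ)) t :=
      ofRealCLM.differentiableAt.comp t (hG.norm ℝ hg)
    have h2 : DifferentiableAt ℝ (fun t : ℝ => (Real.pi : ℂ) ^ (-(I * t / 2))) t :=
      ((hasStrictDerivAt_const_cpow (Or.inl hpi)).hasDerivAt.comp_of_eq t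
        (h := fun t : ℝ => -(I * t / 2)) (hl.div_const 2).fun_neg rfl).differentiableAt
    exact (hG.div h1 (by simpa using hg)).mul h2
  have hchi : HasDerivAt (fun t : ℝ => chi (1 / 2 + I * t))
      (-2 * thetaDeriv (1 / 2 + I * t) * chi (1 / 2 + I * t) * I) t :=
    (hasDerivAt_chi (s := 1 / 2 + I * t) (by simp) (by norm_num)).comp_of_eq t
      (h₂ := chi) (h := fun t : ℝ => 1 / 2 + I * t) (hl.const_add (1 / 2)) rfl
  have hprod := (hd.hasDerivAt.pow 2).mul hchi
  have hone : (fun t : ℝ => chiInvSqrt t ^ 2 * chi (1 / 2 + I * t)) = fun _ => 1 :=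
    funext chiInvSqrt_sq_mul_chi
  have heq := hprod.unique (by
    show HasDerivAt (fun t : ℝ => chiInvSqrt t ^ 2 * chi (1 / 2 + I * t)) 0 t
    rw [hone]; exact hasDerivAt_const t 1)
  have hq := chiInvSqrt_sq_mul_chi t
  refine hd.hasDerivAt.congr_deriv ?_
  have hc : chiInvSqrt t ≠ 0 := fun h => by simp [h] at hq
  have hu : chi (1 / 2 + I * t) ≠ 0 := fun h => by rw [h] at hq; simp at hq
  simp only [Pi.pow_apply, Nat.cast_ofNat, Nat.add_one_sub_one, pow_one] at heq
  have : (2 * chiInvSqrt t * chi (1 / 2 + I * t)) *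
      (deriv chiInvSqrt t - I * thetaDeriv (1 / 2 + I * t) * chiInvSqrt t) = 0 := by
    linear_combination heq
  rcases mul_eq_zero.mp this with h | h
  · exact absurd h (mul_ne_zero (mul_ne_zero two_ne_zero hc) hu)
  · exact sub_eq_zero.mp h

/-! ### A polynomial bound for ζ -/

/-- The difference `(n+1)^(-s) - ∫ x in (n+1)..(n+2), x^(-s)`. -/
noncomputable def zetaTerm (n : ℕ) (s : ℂ) : ℂ :=
  ((n + 1 : ℝ) : ℂ) ^ (-s) -
    (((n + 2 : ℝ) : ℂ) ^ (1 - s) - ((n + 1 : ℝ) : ℂ) ^ (1 - s)) / (1 - s)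

theorem norm_cpow_neg_sub_le {a x : ℝ} {s : ℂ} (ha : 0 < a) (hs : 0 < s.re)
    (hax : a ≤ x) (hxa : x ≤ a + 1) :
    ‖(a : ℂ) ^ (-s) - (x : ℂ) ^ (-s)‖ ≤ ‖s‖ * a ^ (-s.re - 1) := by
  have hs0 : -s ≠ 0 := neg_ne_zero.mpr fun h => by simp [h] at hs
  have hb := (convex_Icc a x).norm_image_sub_le_of_norm_hasDerivWithin_le
    (f := fun y : ℝ => (y : ℂ) ^ (-s)) (f' := fun y : ℝ => -s * (y : ℂ) ^ (-s - 1))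
    (C := ‖s‖ * a ^ (-s.re - 1))
    (fun y hy => (hasDerivAt_ofReal_cpow_const (by linarith [hy.1]) hs0).hasDerivWithinAt)
    (fun y hy => ?_) (Set.right_mem_Icc.mpr hax) (Set.left_mem_Icc.mpr hax)
  · refine hb.trans ?_
    have : ‖a - x‖ ≤ 1 := by
      rw [Real.norm_eq_abs, abs_le]; constructor <;> linarith
    have h0 : 0 ≤ ‖s‖ * a ^ (-s.re - 1) := by positivity
    nlinarith
  · have hy0 : 0 < y := by linarith [hy.1]
    rw [norm_mul, norm_neg, norm_cpow_eq_rpow_re_of_pos hy0]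
    gcongr ?_ * ?_
    simp only [sub_re, neg_re, one_re]
    exact Real.rpow_le_rpow_of_nonpos ha hy.1 (by linarith)

/-- With a = n + 1, the term is the increment over [a, a+1] of y a^(-s) - y^(1-s)/(1-s), whose
derivative a^(-s) - y^(-s) is small. The gain of one power of a makes the series converge for Re s >
0. -/
theorem norm_zetaTerm_le (n : ℕ) {s : ℂ} (hs : 0 < s.re) (hs1 : s ≠ 1) :
    ‖zetaTerm n s‖ ≤ ‖s‖ * (n + 1 : ℝ) ^ (-s.re - 1) := by
  set a : ℝ := n + 1 with ha_def
  have ha : 0 < a := by positivity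
  have h1s : 1 - s ≠ 0 := sub_ne_zero.mpr hs1.symm
  have hle : a ≤ a + 1 := by linarith
  have hb := (convex_Icc a (a + 1)).norm_image_sub_le_of_norm_hasDerivWithin_le
    (f := fun y : ℝ => (y : ℂ) * (a : ℂ) ^ (-s) - (y : ℂ) ^ (1 - s) / (1 - s))
    (f' := fun y : ℝ => (a : ℂ) ^ (-s) - (y : ℂ) ^ (-s))
    (C := ‖s‖ * a ^ (-s.re - 1)) (fun y hy => ?_)
    (fun y hy => norm_cpow_neg_sub_le ha hs hy.1 hy.2)
    (Set.left_mem_Icc.mpr hle) (Set.right_mem_Icc.mpr hle)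
  · have h2 : ‖a + 1 - a‖ = 1 := by simp
    rw [h2, mul_one] at hb
    have h3 : zetaTerm n s = ((a + 1 : ℝ) : ℂ) * (a : ℂ) ^ (-s) -
        ((a + 1 : ℝ) : ℂ) ^ (1 - s) / (1 - s) -
        ((a : ℂ) * (a : ℂ) ^ (-s) - (a : ℂ) ^ (1 - s) / (1 - s)) := by
      unfold zetaTerm
      rw [show (n + 2 : ℝ) = a + 1 by rw [ha_def]; ring, ← ha_def]
      push_cast
      ring
    rw [h3]
    exact hb
  · have hy0 : y ≠ 0 := by linarith [hy.1]
    have h3 := (hasDerivAt_ofReal_cpow_const hy0 h1s).div_const (1 - s)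
    rw [mul_div_cancel_left₀ _ h1s, show 1 - s - 1 = -s by ring] at h3
    have h4 := (ofRealCLM.hasDerivAt (x := y)).mul_const ((a : ℂ) ^ (-s))
    refine ((h4.sub h3).congr_deriv ?_).hasDerivWithinAt
    simp

theorem summable_add_one_rpow {r : ℝ} (hr : r < -1) : Summable fun n : ℕ => (n + 1 : ℝ) ^ r := by
  have := (Real.summable_nat_rpow (p := r)).mpr hr
  simpa using (summable_nat_add_iff 1).mpr this

theorem differentiableAt_zetaTerm (n : ℕ) {s : ℂ} (hs1 : s ≠ 1) :
    DifferentiableAt ℂ (zetaTerm n) s := by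
  have h1s : 1 - s ≠ 0 := sub_ne_zero.mpr hs1.symm
  have h1 : ((n + 1 : ℝ) : ℂ) ≠ 0 := by exact_mod_cast (by positivity : (n + 1 : ℝ) ≠ 0)
  have h2 : ((n + 2 : ℝ) : ℂ) ≠ 0 := by exact_mod_cast (by positivity : (n + 2 : ℝ) ≠ 0)
  unfold zetaTerm
  refine DifferentiableAt.fun_sub ?_ (DifferentiableAt.fun_div (DifferentiableAt.fun_sub ?_ ?_) ?_ h1s)
  · exact DifferentiableAt.const_cpow (by fun_prop) (Or.inl h1)
  · exact DifferentiableAt.const_cpow (by fun_prop) (Or.inl h2)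
  · exact DifferentiableAt.const_cpow (by fun_prop) (Or.inl h1)
  · fun_prop

open Filter Topology in
theorem tsum_zetaTerm_of_one_lt_re {s : ℂ} (hs : 1 < s.re) :
    ∑' n, zetaTerm n s = riemannZeta s - 1 / (s - 1) := by
  have hs1 : s ≠ 1 := fun h => by simp [h] at hs
  have h1s : 1 - s ≠ 0 := sub_ne_zero.mpr hs1.symm
  have hs1' : s - 1 ≠ 0 := sub_ne_zero.mpr hs1
  have hsum : Summable fun n => zetaTerm n s :=
    Summable.of_norm_bounded ((summable_add_one_rpow (by linarith)).mul_left ‖s‖)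
      fun n => norm_zetaTerm_le n (by linarith) hs1
  have hz : HasSum (fun n : ℕ => ((n + 1 : ℝ) : ℂ) ^ (-s)) (riemannZeta s) := by
    have h := ((summable_nat_add_iff 1).mpr
      ((Complex.summable_one_div_nat_cpow (p := s)).mpr hs)).hasSum
    have h0 : ∑' b : ℕ, 1 / ((b + 1 : ℕ) : ℂ) ^ s = riemannZeta s := by
      rw [zeta_eq_tsum_one_div_nat_add_one_cpow hs]
      simp
    rw [h0] at h
    refine h.congr_fun fun n => ?_
    rw [cpow_neg, one_div]
    push_cast
    rfl
  have hpart : ∀ N : ℕ, ∑ n ∈ Finset.range N, zetaTerm n s =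
      ∑ n ∈ Finset.range N, ((n + 1 : ℝ) : ℂ) ^ (-s) -
        (((N + 1 : ℝ) : ℂ) ^ (1 - s) - 1) / (1 - s) := by
    intro N
    simp only [zetaTerm]
    rw [Finset.sum_sub_distrib, ← Finset.sum_div]
    congr 2
    have := Finset.sum_range_sub (fun n : ℕ => ((n + 1 : ℝ) : ℂ) ^ (1 - s)) N
    simp only [Nat.cast_zero, zero_add, ofReal_one, one_cpow] at this
    rw [← this]
    refine Finset.sum_congr rfl fun n _ => ?_
    push_cast
    ring_nf
  have hlim0 : Tendsto (fun N : ℕ => ((N + 1 : ℝ) : ℂ) ^ (1 - s)) atTop (𝓝 0) := by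
    rw [tendsto_zero_iff_norm_tendsto_zero]
    have h1 : Tendsto (fun N : ℕ => (N + 1 : ℝ)) atTop atTop :=
      tendsto_atTop_add_const_right _ _ tendsto_natCast_atTop_atTop
    have h2 := (tendsto_rpow_neg_atTop (by linarith : 0 < s.re - 1)).comp h1
    refine h2.congr fun N => ?_
    rw [norm_cpow_eq_rpow_re_of_pos (by positivity)]
    simp
  refine tendsto_nhds_unique (hsum.hasSum.tendsto_sum_nat.congr hpart) ?_
  have h := hz.tendsto_sum_nat.sub ((hlim0.sub_const 1).div_const (1 - s))
  convert h using 2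
  rw [← neg_sub s 1, zero_sub, neg_div_neg_eq]

open Filter Topology in
/-- A polynomial bound for `ζ` in the half-plane `Re s ≥ 1/2`. -/
theorem exists_norm_riemannZeta_le :
    ∃ C : ℝ, 0 < C ∧ ∀ s : ℂ, 1 / 2 ≤ s.re → 1 ≤ s.im → ‖riemannZeta s‖ ≤ C * ‖s‖ := by
  set A := ∑' n : ℕ, (n + 1 : ℝ) ^ (-(1 / 2 : ℝ) - 1)
  have hA : 0 ≤ A := tsum_nonneg fun n => by positivity
  refine ⟨A + 1, by linarith, fun s hs ht => ?_⟩
  set R := ‖s‖ + 3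
  -- A convex open set that avoids the pole and contains both s and 2 + i. It is bounded, so the
  -- series converges uniformly on it, and the identity theorem carries the formula from Re s > 1 to
  -- s.
  set U : Set ℂ := {z | 1 / 4 < z.re} ∩ {z | 0 < z.im} ∩ {z | ‖z‖ < R} with hU
  have hUo : IsOpen U := ((isOpen_lt continuous_const continuous_re).inter
    (isOpen_lt continuous_const continuous_im)).inter (isOpen_lt continuous_norm continuous_const)
  have hUc : Convex ℝ U := ((convex_halfSpace_re_gt _).inter (convex_halfSpace_im_gt _)).inter
    (by simpa [Metric.ball, dist_eq_norm] using convex_ball (0 : ℂ) R)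
  have hne : ∀ z ∈ U, z ≠ 1 := fun z hz h => by
    have := hz.1.2
    simp [h] at this
  have hd1 : DifferentiableOn ℂ (fun z => ∑' n, zetaTerm n z) U := by
    refine differentiableOn_tsum_of_summable_norm
      (u := fun n : ℕ => R * (n + 1 : ℝ) ^ (-(1 / 4 : ℝ) - 1))
      ((summable_add_one_rpow (by norm_num)).mul_left R)
      (fun n z hz => (differentiableAt_zetaTerm n (hne z hz)).differentiableWithinAt) hUo ?_
    intro n z hz
    have h1 : 1 / 4 < z.re := hz.1.1
    refine (norm_zetaTerm_le n (by linarith) (hne z hz)).trans ?_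
    have hR : ‖z‖ ≤ R := le_of_lt hz.2
    gcongr
    linarith
  have hd2 : DifferentiableOn ℂ (fun z => riemannZeta z - 1 / (z - 1)) U := by
    intro z hz
    refine (DifferentiableAt.fun_sub (differentiableAt_riemannZeta (hne z hz)) ?_).differentiableWithinAt
    exact DifferentiableAt.fun_div (by fun_prop) (by fun_prop) (sub_ne_zero.mpr (hne z hz))
  have hz0 : (2 + I : ℂ) ∈ U := by
    refine ⟨⟨by simp; norm_num, by simp⟩, ?_⟩
    have := norm_add_le (2 : ℂ) I
    have h0 := norm_pos_iff.mpr (show s ≠ 0 from fun h => by simp [h] at hs; linarith)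
    simp only [RCLike.norm_ofNat, norm_I] at this
    show ‖(2 + I : ℂ)‖ < ‖s‖ + 3
    linarith
  have heq : Set.EqOn (fun z => ∑' n, zetaTerm n z) (fun z => riemannZeta z - 1 / (z - 1)) U := by
    refine (hd1.analyticOnNhd hUo).eqOn_of_preconnected_of_eventuallyEq (hd2.analyticOnNhd hUo)
      hUc.isPreconnected hz0 ?_
    have : {z : ℂ | 1 < z.re} ∈ 𝓝 (2 + I : ℂ) :=
      (isOpen_lt continuous_const continuous_re).mem_nhds (by simp)
    filter_upwards [this] with z hz using tsum_zetaTerm_of_one_lt_re hz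
  have hsU : s ∈ U := ⟨⟨by show 1 / 4 < s.re; linarith, by show 0 < s.im; linarith⟩, by
    show ‖s‖ < ‖s‖ + 3; linarith⟩
  have hs1 := hne s hsU
  have hbound : ∀ n, ‖zetaTerm n s‖ ≤ ‖s‖ * (n + 1 : ℝ) ^ (-(1 / 2 : ℝ) - 1) := fun n => by
    refine (norm_zetaTerm_le n (by linarith) hs1).trans ?_
    gcongr
    linarith
  have h3 : ‖∑' n, zetaTerm n s‖ ≤ ‖s‖ * A := by
    rw [← tsum_mul_left]
    exact tsum_of_norm_bounded ((summable_add_one_rpow (by norm_num)).mul_left ‖s‖).hasSum hbound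
  have h4 : riemannZeta s = ∑' n, zetaTerm n s + 1 / (s - 1) := by
    have := heq hsU
    simp only at this
    rw [this]; ring
  have h5 : ‖1 / (s - 1)‖ ≤ 1 := by
    rw [norm_div, norm_one, div_le_one (norm_pos_iff.mpr (sub_ne_zero.mpr hs1))]
    have := abs_im_le_norm (s - 1)
    simp only [sub_im, one_im, sub_zero] at this
    exact ht.trans ((le_abs_self _).trans this)
  have h6 : 1 ≤ ‖s‖ := ht.trans ((le_abs_self _).trans (abs_im_le_norm s))
  rw [h4]
  refine (norm_add_le _ _).trans ?_
  nlinarith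

/-! ### The Dirichlet series of ζ^k -/

theorem LSeries_piltz (k : ℕ) {s : ℂ} (hs : 1 < s.re) :
    LSeriesSummable (fun n => ((piltz k : ArithmeticFunction ℂ) n)) s ∧
      LSeries (fun n => ((piltz k : ArithmeticFunction ℂ) n)) s = riemannZeta s ^ k := by
  induction k with
  | zero =>
    have h : (fun n => ((piltz 0 : ArithmeticFunction ℕ) : ArithmeticFunction ℂ) n) =
        LSeries.delta := by
      funext n
      simp [piltz, ArithmeticFunction.one_apply, LSeries.delta]
    rw [h, LSeries_delta]
    refine ⟨?_, by simp⟩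
    refine (hasSum_single (α := ℂ) 1 fun n hn => ?_).summable
    rw [LSeries.term_delta, if_neg hn]
  | succ k ih =>
    have h : ((piltz (k + 1) : ArithmeticFunction ℕ) : ArithmeticFunction ℂ) =
        (piltz k : ArithmeticFunction ℂ) * (ArithmeticFunction.zeta : ArithmeticFunction ℂ) := by
      rw [piltz, pow_succ, ArithmeticFunction.natCoe_mul]; rfl
    have hz : LSeriesSummable (fun n => (ArithmeticFunction.zeta : ArithmeticFunction ℂ) n) s := by
      simpa only [ArithmeticFunction.natCoe_apply] using
        ArithmeticFunction.LSeriesSummable_zeta_iff.mpr hs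
    have hz' : LSeries (fun n => (ArithmeticFunction.zeta : ArithmeticFunction ℂ) n) s =
        riemannZeta s := by
      simpa only [ArithmeticFunction.natCoe_apply] using
        ArithmeticFunction.LSeries_zeta_eq_riemannZeta hs
    rw [h]
    refine ⟨ArithmeticFunction.LSeriesSummable_mul ih.1 hz, ?_⟩
    rw [ArithmeticFunction.LSeries_mul' ih.1 hz, ih.2, hz', pow_succ]

theorem hasSum_piltz (k : ℕ) {s : ℂ} (hs : 1 < s.re) :
    HasSum (fun n : ℕ => (piltz k n : ℂ) * (n : ℂ) ^ (-s)) (riemannZeta s ^ k) := by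
  obtain ⟨h1, h2⟩ := LSeries_piltz k hs
  have h := h1.hasSum
  rw [show ∑' n, LSeries.term _ s n = riemannZeta s ^ k from h2] at h
  refine h.congr_fun fun n => ?_
  rcases eq_or_ne n 0 with rfl | hn
  · simp
  · rw [LSeries.term_of_ne_zero hn, cpow_neg, div_eq_mul_inv]
    simp

/-! ### Gaussian mean values of Dirichlet series -/

/-- The Gaussian weight `exp (((s - s₀) / h) ^ 2)` centred at `s₀ = 1/2 + i t₀`. -/
noncomputable def gaussW (h t₀ : ℝ) (s : ℂ) : ℂ := cexp (((s - (1 / 2 + I * t₀)) / h) ^ 2)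

theorem norm_gaussW (h t₀ σ t : ℝ) :
    ‖gaussW h t₀ (σ + I * t)‖ = Real.exp (((σ - 1 / 2) ^ 2 - (t - t₀) ^ 2) / h ^ 2) := by
  rw [gaussW, norm_exp]
  congr 1
  have : ((σ + I * t - (1 / 2 + I * t₀)) / h : ℂ) ^ 2 =
      ((((σ - 1 / 2) ^ 2 - (t - t₀) ^ 2) / h ^ 2 : ℝ) : ℂ) +
        ((2 * (σ - 1 / 2) * (t - t₀) / h ^ 2 : ℝ) : ℂ) * I := by
    push_cast
    rw [div_pow]
    linear_combination (t - t₀ : ℂ) ^ 2 / h ^ 2 * I_sq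
  rw [this]
  simp [-ofReal_div, -ofReal_mul, -ofReal_sub, -ofReal_pow]

theorem gaussW_half (h t₀ t : ℝ) :
    gaussW h t₀ (1 / 2 + I * t) = (Real.exp (-((t - t₀) / h) ^ 2) : ℝ) := by
  rw [gaussW, ofReal_exp]
  congr 1
  push_cast
  rw [div_pow, div_pow]
  linear_combination (t - t₀ : ℂ) ^ 2 / h ^ 2 * I_sq

theorem continuous_gaussW_line (h t₀ σ : ℝ) : Continuous fun t : ℝ => gaussW h t₀ (σ + I * t) := by
  unfold gaussW
  fun_prop

theorem integrable_exp_neg_sq {h : ℝ} (hh : 0 < h) (t₀ : ℝ) :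
    MeasureTheory.Integrable fun t : ℝ => Real.exp (-((t - t₀) / h) ^ 2) := by
  have h1 := (integrable_exp_neg_mul_sq (b := 1 / h ^ 2) (by positivity)).comp_sub_right t₀
  refine h1.congr (MeasureTheory.ae_of_all _ fun t => ?_)
  simp only
  congr 1
  field_simp

theorem integral_exp_neg_sq {h : ℝ} (hh : 0 < h) (t₀ : ℝ) :
    ∫ t : ℝ, Real.exp (-((t - t₀) / h) ^ 2) = √Real.pi * h := by
  have h1 := integral_gaussian (1 / h ^ 2)
  rw [← MeasureTheory.integral_sub_right_eq_self _ t₀] at h1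
  rw [show √Real.pi * h = √(Real.pi / (1 / h ^ 2)) by
    rw [div_div_eq_mul_div, div_one, Real.sqrt_mul Real.pi_pos.le, Real.sqrt_sq hh.le], ← h1]
  congr 1
  funext t
  congr 1
  field_simp

theorem norm_gaussW_eq (h t₀ σ t : ℝ) : ‖gaussW h t₀ (σ + I * t)‖ =
    Real.exp ((σ - 1 / 2) ^ 2 / h ^ 2) * Real.exp (-((t - t₀) / h) ^ 2) := by
  rw [norm_gaussW, ← Real.exp_add]
  congr 1
  ring

theorem integrable_gaussW {h : ℝ} (hh : 0 < h) (t₀ σ : ℝ) :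
    MeasureTheory.Integrable fun t : ℝ => gaussW h t₀ (σ + I * t) := by
  refine ((integrable_exp_neg_sq hh t₀).const_mul (Real.exp ((σ - 1 / 2) ^ 2 / h ^ 2))).mono'
    (continuous_gaussW_line h t₀ σ).aestronglyMeasurable
    (MeasureTheory.ae_of_all _ fun t => (norm_gaussW_eq h t₀ σ t).le)

/-- Completing the square. The value is independent of σ, as a contour shift predicts, so a product
expanded on any line σ has the same diagonal and the same damping. -/
theorem integral_exp_mul_gaussW {h : ℝ} (hh : 0 < h) (t₀ σ l : ℝ) :
    ∫ t : ℝ, cexp ((σ + I * t - (1 / 2 + I * t₀)) * l) * gaussW h t₀ (σ + I * t) =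
      (√Real.pi * h * Real.exp (-(h * l) ^ 2 / 4) : ℝ) := by
  have hh0 : (h : ℂ) ≠ 0 := by exact_mod_cast hh.ne'
  have hpi : ((Real.pi : ℂ) / -(-(1 / h ^ 2 : ℝ) : ℂ)) ^ (1 / 2 : ℂ) = (√Real.pi * h : ℝ) := by
    rw [neg_neg, ← ofReal_div, show (1 / 2 : ℂ) = ((1 / 2 : ℝ) : ℂ) by push_cast; rfl,
      ← ofReal_cpow (by positivity), ← Real.sqrt_eq_rpow, div_div_eq_mul_div, div_one,
      Real.sqrt_mul Real.pi_pos.le, Real.sqrt_sq hh.le]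
  have h1 := integral_cexp_quadratic (b := (-(1 / h ^ 2 : ℝ) : ℂ)) (by
      rw [neg_re, ofReal_re]
      have : 0 < 1 / h ^ 2 := by positivity
      linarith) (I * l + 2 * I * (σ - 1 / 2) / h ^ 2)
      ((σ - 1 / 2) * l + (σ - 1 / 2) ^ 2 / h ^ 2)
  rw [hpi, ← MeasureTheory.integral_sub_right_eq_self _ t₀] at h1
  have h2 : ∀ t : ℝ, cexp ((σ + I * t - (1 / 2 + I * t₀)) * l) * gaussW h t₀ (σ + I * t) =
      cexp (-(1 / h ^ 2 : ℝ) * ((t - t₀ : ℝ) : ℂ) ^ 2 +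
        (I * l + 2 * I * (σ - 1 / 2) / h ^ 2) * ((t - t₀ : ℝ) : ℂ) +
        ((σ - 1 / 2) * l + (σ - 1 / 2) ^ 2 / h ^ 2)) := by
    intro t
    rw [gaussW, ← Complex.exp_add]
    congr 1
    push_cast
    field_simp
    linear_combination 4 * (t - t₀ : ℂ) ^ 2 * I_sq
  have h3 : cexp ((σ - 1 / 2) * l + (σ - 1 / 2) ^ 2 / h ^ 2 -
      (I * l + 2 * I * (σ - 1 / 2) / h ^ 2) ^ 2 / (4 * (-(1 / h ^ 2 : ℝ) : ℂ))) =
      (Real.exp (-(h * l) ^ 2 / 4) : ℝ) := by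
    rw [ofReal_exp]
    congr 1
    push_cast
    field_simp
    linear_combination (4 * (h ^ 2 * l + 2 * σ - 1) ^ 2 : ℂ) * I_sq
  simp only [h2]
  rw [h1, h3, ofReal_mul _ (Real.exp _)]

theorem natCast_cpow_eq_exp {n : ℕ} (hn : n ≠ 0) (z : ℂ) : (n : ℂ) ^ z = cexp (Real.log n * z) := by
  rw [cpow_def_of_ne_zero (by exact_mod_cast hn), natCast_log]

theorem integral_cpow_mul_gaussW {h : ℝ} (hh : 0 < h) (t₀ σ : ℝ) {n m : ℕ} (hn : n ≠ 0)
    (hm : m ≠ 0) :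
    ∫ t : ℝ, (n : ℂ) ^ (-(σ + I * t : ℂ)) * (m : ℂ) ^ (σ + I * t - 1 : ℂ) *
        gaussW h t₀ (σ + I * t) =
      (n : ℂ) ^ (-(1 / 2 + I * t₀ : ℂ)) * (m : ℂ) ^ (1 / 2 + I * t₀ - 1 : ℂ) *
        (√Real.pi * h * Real.exp (-(h * (Real.log m - Real.log n)) ^ 2 / 4) : ℝ) := by
  rw [← integral_exp_mul_gaussW hh t₀ σ, ← MeasureTheory.integral_const_mul]
  congr 1
  funext t
  rw [natCast_cpow_eq_exp hn, natCast_cpow_eq_exp hm, natCast_cpow_eq_exp hn,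
    natCast_cpow_eq_exp hm, ← Complex.exp_add, ← mul_assoc, ← Complex.exp_add, ← Complex.exp_add]
  congr 2
  push_cast
  ring

/-- Only m is bounded by N. For n > m the gap is at least log((m+1)/m) ≥ 1/(m+1), and m + 1 ≤ 2N,
which accounts for the factor 2. -/
theorem inv_two_mul_le_abs_log_sub_log {n m N : ℕ} (hn : n ≠ 0) (hm : m ≠ 0) (hmN : m ≤ N)
    (hnm : n ≠ m) : 1 / (2 * N : ℝ) ≤ |Real.log m - Real.log n| := by
  have hlt : ∀ a b : ℕ, a ≠ 0 → a < b → 1 / (b : ℝ) ≤ Real.log b - Real.log a := by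
    intro a b ha hab
    have ha' : (0 : ℝ) < a := by positivity
    have hb' : (0 : ℝ) < b := by exact_mod_cast (Nat.zero_lt_of_lt hab)
    rw [← Real.log_div hb'.ne' ha'.ne']
    have h1 := Real.one_sub_inv_le_log_of_pos (div_pos hb' ha')
    refine le_trans ?_ h1
    rw [inv_div, one_div, ← sub_nonneg]
    have : (a : ℝ) + 1 ≤ b := by exact_mod_cast hab
    have : 1 - a / b - (b : ℝ)⁻¹ = (b - (a + 1)) / b := by field_simp; ring
    rw [this]
    exact div_nonneg (by linarith) hb'.le
  have hm1 : 1 ≤ m := Nat.one_le_iff_ne_zero.mpr hm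
  have hN : (1 : ℝ) ≤ N := by exact_mod_cast hm1.trans hmN
  have hm' : (0 : ℝ) < m := by positivity
  have hmN' : (m : ℝ) ≤ N := by exact_mod_cast hmN
  rcases lt_or_gt_of_ne hnm with h | h
  · refine le_trans ?_ ((hlt n m hn h).trans (le_abs_self _))
    apply one_div_le_one_div_of_le hm'
    linarith
  · rw [abs_sub_comm]
    have h1 := hlt m (m + 1) hm (Nat.lt_succ_self m)
    have h2 : Real.log (m + 1 : ℕ) ≤ Real.log n := by
      apply Real.log_le_log (by positivity)
      exact_mod_cast h
    refine le_trans ?_ (le_trans (sub_le_sub_right h2 _) (le_abs_self _))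
    refine le_trans ?_ h1
    apply one_div_le_one_div_of_le (by positivity)
    push_cast
    have : (1 : ℝ) ≤ m := by exact_mod_cast hm1
    linarith

/-- The Gaussian factor of an off-diagonal term. -/
theorem exp_neg_sq_log_le {h : ℝ} {n m N : ℕ} (hn : n ≠ 0) (hm : m ≠ 0) (hmN : m ≤ N)
    (hnm : n ≠ m) (hh : 32 * N ≤ h ^ 2) :
    Real.exp (-(h * (Real.log m - Real.log n)) ^ 2 / 4) ≤
      Real.exp (-(h ^ 2 / (32 * N ^ 2))) * ((m : ℝ) ^ 2 / (n : ℝ) ^ 2) := by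
  set l := Real.log m - Real.log n with hl_def
  have hl := inv_two_mul_le_abs_log_sub_log hn hm hmN hnm
  rw [← hl_def] at hl
  have hm' : (0 : ℝ) < m := by positivity
  have hn' : (0 : ℝ) < n := by positivity
  have hN : (0 : ℝ) < N := by
    have : 0 < N := (Nat.pos_of_ne_zero hm).trans_le hmN
    exact_mod_cast this
  have hml : (m : ℝ) ^ 2 / (n : ℝ) ^ 2 = Real.exp (2 * l) := by
    rw [hl_def, ← Real.log_div hm'.ne' hn'.ne', ← div_pow,
      show (2 : ℝ) * Real.log (m / n) = Real.log (m / n) * (2 : ℕ) by push_cast; ring,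
      Real.exp_mul, Real.exp_log (by positivity), Real.rpow_natCast]
  rw [hml, ← Real.exp_add]
  apply Real.exp_le_exp.mpr
  have h1 : l ^ 2 = |l| ^ 2 := (sq_abs l).symm
  have h2 : -|l| ≤ l := neg_abs_le l
  have h3 : 1 ≤ 2 * N * |l| := by
    rw [div_le_iff₀ (by positivity)] at hl
    linarith
  -- The exponent h^2 l^2/4 is split in two. By |l| ≥ 1/(2N) one half is at least h^2/(32 N^2), the
  -- uniform saving. The other half is at least 2|l|, which pays for e^(-2l) = n^2/m^2 and so makes
  -- the sum over n converge.
  have h4 : h ^ 2 / (32 * N ^ 2) ≤ h ^ 2 * |l| ^ 2 / 8 := by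
    rw [div_le_iff₀ (by positivity)]
    have : 1 ≤ (2 * N * |l|) ^ 2 := one_le_pow₀ h3
    nlinarith [sq_nonneg h]
  have h5 : 2 * |l| ≤ h ^ 2 * |l| ^ 2 / 8 := by
    have h6 : 16 * |l| ≤ 32 * N * |l| * |l| := by nlinarith [abs_nonneg l]
    have h7 : 32 * N * |l| * |l| ≤ h ^ 2 * |l| * |l| := by gcongr
    nlinarith
  have : (h * l) ^ 2 = h ^ 2 * |l| ^ 2 := by rw [mul_pow, h1]
  rw [neg_div, this]
  linarith

/-- The Dirichlet polynomial `∑_{m ≤ N} b(m) m^(s-1)`. -/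
noncomputable def dirPoly (N : ℕ) (b : ℕ → ℝ) (s : ℂ) : ℂ :=
  ∑ m ∈ Finset.Icc 1 N, (b m : ℂ) * (m : ℂ) ^ (s - 1)

theorem continuous_dirPoly_line (N : ℕ) (b : ℕ → ℝ) (σ : ℝ) :
    Continuous fun t : ℝ => dirPoly N b (σ + I * t) := by
  unfold dirPoly
  refine continuous_finsetSum _ fun m hm => ?_
  have hm0 : (m : ℂ) ≠ 0 := by
    have := (Finset.mem_Icc.mp hm).1
    exact_mod_cast (by omega : m ≠ 0)
  exact continuous_const.mul (Continuous.const_cpow (by fun_prop) (Or.inl hm0))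

theorem norm_dirPoly_le (N : ℕ) (b : ℕ → ℝ) {s : ℂ} (hs : s.re ≤ 2) :
    ‖dirPoly N b s‖ ≤ ∑ m ∈ Finset.Icc 1 N, |b m| * m := by
  refine norm_sum_le_of_le _ fun m hm => ?_
  have hm1 : 1 ≤ m := (Finset.mem_Icc.mp hm).1
  have hm1' : (1 : ℝ) ≤ m := by exact_mod_cast hm1
  rw [norm_mul, norm_real, Real.norm_eq_abs, norm_natCast_cpow_of_pos hm1]
  gcongr
  calc (m : ℝ) ^ (s - 1).re ≤ (m : ℝ) ^ (1 : ℝ) := by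
        apply Real.rpow_le_rpow_of_exponent_le hm1'
        simp; linarith
    _ = m := Real.rpow_one _

/-- Gaussian mean value of a Dirichlet series times a Dirichlet polynomial: only the diagonal
contributes. -/
theorem norm_integral_dirichlet_sub_diagonal_le {h : ℝ} (hh : 0 < h) (t₀ σ : ℝ) {N : ℕ}
    (hhN : 32 * N ≤ h ^ 2) {a : ℕ → ℝ} (ha : ∀ n, 0 ≤ a n) (ha0 : a 0 = 0) (b : ℕ → ℝ)
    (hσ : Summable fun n : ℕ => a n * (n : ℝ) ^ (-σ)) (h2 : Summable fun n : ℕ => a n / (n : ℝ) ^ 2)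
    {D : ℂ → ℂ}
    (hD : ∀ t : ℝ, HasSum (fun n : ℕ => (a n : ℂ) * (n : ℂ) ^ (-(σ + I * t : ℂ))) (D (σ + I * t))) :
    ‖(∫ t : ℝ, D (σ + I * t) * dirPoly N b (σ + I * t) * gaussW h t₀ (σ + I * t)) -
        (√Real.pi * h * ∑ m ∈ Finset.Icc 1 N, a m * b m / m : ℝ)‖ ≤
      √Real.pi * h * (Real.exp (-(h ^ 2 / (32 * N ^ 2))) *
        ((∑' n : ℕ, a n / (n : ℝ) ^ 2) * ∑ m ∈ Finset.Icc 1 N, |b m| * (m : ℝ) ^ 2)) := by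
  classical
  set G : ℕ → ℕ → ℂ := fun n m => (n : ℂ) ^ (-(1 / 2 + I * t₀ : ℂ)) *
    (m : ℂ) ^ (1 / 2 + I * t₀ - 1 : ℂ) *
    (√Real.pi * h * Real.exp (-(h * (Real.log m - Real.log n)) ^ 2 / 4) : ℝ) with hG
  set F : ℕ → ℝ → ℂ := fun n t => (a n : ℂ) * (n : ℂ) ^ (-(σ + I * t : ℂ)) *
    (dirPoly N b (σ + I * t) * gaussW h t₀ (σ + I * t)) with hF
  set Bσ := ∑ m ∈ Finset.Icc 1 N, |b m| * (m : ℝ) ^ (σ - 1)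
  have hPb : ∀ t : ℝ, ‖dirPoly N b (σ + I * t)‖ ≤ Bσ := fun t => by
    refine norm_sum_le_of_le _ fun m hm => ?_
    rw [norm_mul, norm_real, Real.norm_eq_abs, norm_natCast_cpow_of_pos (Finset.mem_Icc.mp hm).1]
    simp
  have hPW : MeasureTheory.Integrable
      fun t : ℝ => dirPoly N b (σ + I * t) * gaussW h t₀ (σ + I * t) :=
    (integrable_gaussW hh t₀ σ).bdd_mul (continuous_dirPoly_line N b σ).aestronglyMeasurable
      (MeasureTheory.ae_of_all _ hPb)
  have hnn : ∀ (n : ℕ) (t : ℝ), n ≠ 0 → ‖(n : ℂ) ^ (-(σ + I * t : ℂ))‖ = (n : ℝ) ^ (-σ) := by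
    intro n t hn
    rw [norm_natCast_cpow_of_pos (Nat.pos_of_ne_zero hn)]
    simp
  have hFnorm : ∀ n t, ‖F n t‖ = a n * (n : ℝ) ^ (-σ) *
      ‖dirPoly N b (σ + I * t) * gaussW h t₀ (σ + I * t)‖ := by
    intro n t
    rcases eq_or_ne n 0 with rfl | hn
    · simp [hF, ha0]
    · simp only [hF]
      rw [norm_mul, norm_mul, norm_real, Real.norm_of_nonneg (ha n), hnn n t hn]
  have hFint : ∀ n, MeasureTheory.Integrable (F n) := by
    intro n
    rcases eq_or_ne n 0 with rfl | hn
    · simp [hF, ha0]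
    · refine hPW.bdd_mul (c := a n * (n : ℝ) ^ (-σ)) ?_ (MeasureTheory.ae_of_all _ fun t => ?_)
      · have hn0 : (n : ℂ) ≠ 0 := by exact_mod_cast hn
        exact (continuous_const.mul
          (Continuous.const_cpow (by fun_prop) (Or.inl hn0))).aestronglyMeasurable
      · rw [norm_mul, norm_real, Real.norm_of_nonneg (ha n), hnn n t hn]
  have hFsum : Summable fun n => ∫ t, ‖F n t‖ := by
    simp only [hFnorm, MeasureTheory.integral_const_mul]
    exact hσ.mul_right _
  -- Absolute convergence on the line σ allows termwise integration.
  have hsum := MeasureTheory.hasSum_integral_of_summable_integral_norm hFint hFsum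
  have hFt : ∀ t : ℝ, ∑' n, F n t =
      D (σ + I * t) * dirPoly N b (σ + I * t) * gaussW h t₀ (σ + I * t) := by
    intro t
    rw [((hD t).mul_right _).tsum_eq, mul_assoc]
  simp only [hFt] at hsum
  have hIn : ∀ n, ∫ t, F n t = ∑ m ∈ Finset.Icc 1 N, (a n * b m : ℂ) * G n m := by
    intro n
    rcases eq_or_ne n 0 with rfl | hn
    · simp [hF, ha0]
    have h1 : F n = fun t : ℝ => ∑ m ∈ Finset.Icc 1 N, (a n * b m : ℂ) *
        ((n : ℂ) ^ (-(σ + I * t : ℂ)) * (m : ℂ) ^ (σ + I * t - 1 : ℂ) *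
          gaussW h t₀ (σ + I * t)) := by
      funext t
      simp only [hF, dirPoly, Finset.sum_mul, Finset.mul_sum]
      exact Finset.sum_congr rfl fun m _ => by ring
    rw [h1, MeasureTheory.integral_finsetSum]
    · refine Finset.sum_congr rfl fun m hm => ?_
      have hm0 : m ≠ 0 := by have := (Finset.mem_Icc.mp hm).1; omega
      rw [MeasureTheory.integral_const_mul, integral_cpow_mul_gaussW hh t₀ σ hn hm0]
    · intro m hm
      have hm0 : m ≠ 0 := by have := (Finset.mem_Icc.mp hm).1; omega
      have hm0' : (m : ℂ) ≠ 0 := by exact_mod_cast hm0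
      have hn0' : (n : ℂ) ≠ 0 := by exact_mod_cast hn
      refine ((integrable_gaussW hh t₀ σ).bdd_mul (c := (n : ℝ) ^ (-σ) * (m : ℝ) ^ (σ - 1))
        ?_ (MeasureTheory.ae_of_all _ fun t => ?_)).const_mul _
      · exact ((Continuous.const_cpow (by fun_prop) (Or.inl hn0')).mul
          (Continuous.const_cpow (by fun_prop) (Or.inl hm0'))).aestronglyMeasurable
      · rw [norm_mul, hnn n t hn, norm_natCast_cpow_of_pos (Nat.pos_of_ne_zero hm0)]
        simp
  have hdiag : ∀ m : ℕ, m ≠ 0 → G m m = (√Real.pi * h / m : ℝ) := by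
    intro m hm
    have hm' : (m : ℂ) ≠ 0 := by exact_mod_cast hm
    simp only [hG, sub_self, mul_zero]
    rw [← cpow_add _ _ hm', show (-(1 / 2 + I * t₀ : ℂ) + (1 / 2 + I * t₀ - 1)) = -1 by ring,
      cpow_neg_one]
    push_cast
    simp
    ring
  have hoff : ∀ n m : ℕ, n ≠ 0 → m ∈ Finset.Icc 1 N → n ≠ m → ‖G n m‖ ≤
      √Real.pi * h * (Real.exp (-(h ^ 2 / (32 * N ^ 2))) * ((m : ℝ) ^ 2 / (n : ℝ) ^ 2)) := by
    intro n m hn hm hnm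
    have hm1 := Finset.mem_Icc.mp hm
    have hm0 : m ≠ 0 := by omega
    have hn1 : (1 : ℝ) ≤ n := by exact_mod_cast Nat.one_le_iff_ne_zero.mpr hn
    have hm1' : (1 : ℝ) ≤ m := by exact_mod_cast hm1.1
    simp only [hG]
    rw [norm_mul, norm_mul, norm_natCast_cpow_of_pos (Nat.pos_of_ne_zero hn),
      norm_natCast_cpow_of_pos (Nat.pos_of_ne_zero hm0), norm_real,
      Real.norm_of_nonneg (by positivity)]
    have e1 : (n : ℝ) ^ (-(1 / 2 + I * t₀ : ℂ)).re ≤ 1 :=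
      Real.rpow_le_one_of_one_le_of_nonpos hn1 (by simp)
    have e2 : (m : ℝ) ^ (1 / 2 + I * t₀ - 1 : ℂ).re ≤ 1 :=
      Real.rpow_le_one_of_one_le_of_nonpos hm1' (by simp; norm_num)
    have e3 := exp_neg_sq_log_le hn hm0 hm1.2 hnm hhN
    have e4 : (n : ℝ) ^ (-(1 / 2 + I * t₀ : ℂ)).re * (m : ℝ) ^ (1 / 2 + I * t₀ - 1 : ℂ).re ≤ 1 :=
      mul_le_one₀ e1 (by positivity) e2
    calc _ ≤ 1 * (√Real.pi * h * (Real.exp (-(h ^ 2 / (32 * N ^ 2))) *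
          ((m : ℝ) ^ 2 / (n : ℝ) ^ 2))) := by gcongr
      _ = _ := one_mul _
  -- The diagonal is written as a series over all n, vanishing outside [1, N], so that it can be
  -- subtracted term by term.
  have hfinsum : HasSum (fun n => if n ∈ Finset.Icc 1 N then (a n * b n : ℂ) * G n n else 0)
      ((√Real.pi * h * ∑ m ∈ Finset.Icc 1 N, a m * b m / m : ℝ) : ℂ) := by
    have h1 : ((√Real.pi * h * ∑ m ∈ Finset.Icc 1 N, a m * b m / m : ℝ) : ℂ) =
        ∑ n ∈ Finset.Icc 1 N, if n ∈ Finset.Icc 1 N then (a n * b n : ℂ) * G n n else 0 := by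
      rw [Finset.mul_sum, ofReal_sum]
      refine Finset.sum_congr rfl fun m hm => ?_
      rw [if_pos hm, hdiag m (by have := (Finset.mem_Icc.mp hm).1; omega)]
      push_cast
      ring
    rw [h1]
    exact hasSum_sum_of_ne_finset_zero fun n hn => if_neg hn
  have hdiff := hsum.sub hfinsum
  rw [← hdiff.tsum_eq]
  set E := √Real.pi * h * Real.exp (-(h ^ 2 / (32 * N ^ 2))) with hE
  set B2 := ∑ m ∈ Finset.Icc 1 N, |b m| * (m : ℝ) ^ 2 with hB2
  have hbd : ∀ n, ‖(∫ t, F n t) - (if n ∈ Finset.Icc 1 N then (a n * b n : ℂ) * G n n else 0)‖ ≤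
      E * B2 * (a n / (n : ℝ) ^ 2) := by
    intro n
    rcases eq_or_ne n 0 with rfl | hn
    · simp [hF, ha0]
    have h3 : (∫ t, F n t) - (if n ∈ Finset.Icc 1 N then (a n * b n : ℂ) * G n n else 0) =
        ∑ m ∈ Finset.Icc 1 N, if n = m then 0 else (a n * b m : ℂ) * G n m := by
      rw [hIn, ← Finset.sum_ite_eq (Finset.Icc 1 N) n (fun m => (a n * b m : ℂ) * G n m),
        ← Finset.sum_sub_distrib]
      refine Finset.sum_congr rfl fun m _ => ?_
      split_ifs <;> simp
    rw [h3, hB2, Finset.mul_sum, Finset.sum_mul]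
    refine norm_sum_le_of_le _ fun m hm => ?_
    split_ifs with hnm
    · rw [norm_zero]
      have := ha n
      positivity
    · rw [norm_mul, norm_mul, norm_real, norm_real, Real.norm_of_nonneg (ha n), Real.norm_eq_abs]
      have := ha n
      calc a n * |b m| * ‖G n m‖ ≤ a n * |b m| * (√Real.pi * h *
            (Real.exp (-(h ^ 2 / (32 * N ^ 2))) * ((m : ℝ) ^ 2 / (n : ℝ) ^ 2))) :=
            mul_le_mul_of_nonneg_left (hoff n m hn hm hnm) (by positivity)
        _ = _ := by rw [hE]; ring
  calc _ ≤ ∑' n, E * B2 * (a n / (n : ℝ) ^ 2) :=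
        tsum_of_norm_bounded (h2.mul_left _).hasSum hbd
    _ = _ := by rw [tsum_mul_left, hE]; ring

/-! ### The twisted integral: integration by parts and the shift to Re s = 2 -/

theorem half_add_I_mul_ne_one (t : ℝ) : (1 / 2 + I * t : ℂ) ≠ 1 := fun h => by
  have := congrArg re h
  norm_num at this

theorem hasDerivAt_half_add_I_mul (t : ℝ) : HasDerivAt (fun t : ℝ => (1 / 2 + I * t : ℂ)) I t := by
  simpa using ((ofRealCLM.hasDerivAt (x := t)).const_mul I).const_add (1 / 2)

theorem hasDerivAt_hardyZ_formula (t : ℝ) : HasDerivAt hardyZ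
    (deriv riemannZeta (1 / 2 + I * t) * I * chiInvSqrt t +
      riemannZeta (1 / 2 + I * t) * (I * thetaDeriv (1 / 2 + I * t) * chiInvSqrt t)).re t := by
  have h1 : HasDerivAt (fun t : ℝ => riemannZeta (1 / 2 + I * t))
      (deriv riemannZeta (1 / 2 + I * t) * I) t :=
    (differentiableAt_riemannZeta (half_add_I_mul_ne_one t)).hasDerivAt.comp_of_eq t
      (h₂ := riemannZeta) (h := fun t : ℝ => (1 / 2 + I * t : ℂ)) (hasDerivAt_half_add_I_mul t) rfl
  exact reCLM.hasFDerivAt.comp_hasDerivAt t (h1.fun_mul (hasDerivAt_chiInvSqrt t))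

theorem differentiable_hardyZ : Differentiable ℝ hardyZ := fun t =>
  (hasDerivAt_hardyZ_formula t).differentiableAt

theorem continuous_deriv_hardyZ : Continuous (deriv hardyZ) := by
  have h0 : deriv hardyZ = fun t : ℝ => (deriv riemannZeta (1 / 2 + I * t) * I * chiInvSqrt t +
      riemannZeta (1 / 2 + I * t) * (I * thetaDeriv (1 / 2 + I * t) * chiInvSqrt t)).re :=
    funext fun t => (hasDerivAt_hardyZ_formula t).deriv
  rw [h0]
  rw [continuous_iff_continuousAt]
  intro t
  have hl : ContinuousAt (fun t : ℝ => (1 / 2 + I * t : ℂ)) t :=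
    (hasDerivAt_half_add_I_mul t).continuousAt
  have hz : DifferentiableOn ℂ riemannZeta {1}ᶜ := fun s hs =>
    (differentiableAt_riemannZeta hs).differentiableWithinAt
  have hmem : ({1}ᶜ : Set ℂ) ∈ nhds (1 / 2 + I * t : ℂ) :=
    isOpen_compl_singleton.mem_nhds (half_add_I_mul_ne_one t)
  have c1 : ContinuousAt (fun t : ℝ => deriv riemannZeta (1 / 2 + I * t)) t :=
    ContinuousAt.comp_of_eq (y := (1 / 2 + I * t : ℂ))
      ((hz.deriv isOpen_compl_singleton).differentiableAt hmem).continuousAt hl rfl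
  have c2 : ContinuousAt (fun t : ℝ => riemannZeta (1 / 2 + I * t)) t :=
    ContinuousAt.comp_of_eq (y := (1 / 2 + I * t : ℂ))
      (differentiableAt_riemannZeta (half_add_I_mul_ne_one t)).continuousAt hl rfl
  have c3 : ContinuousAt (fun t : ℝ => thetaDeriv (1 / 2 + I * t)) t :=
    ContinuousAt.comp_of_eq (y := (1 / 2 + I * t : ℂ))
      (differentiableAt_thetaDeriv_of_re (by simp) (by norm_num)).continuousAt hl rfl
  have c4 : ContinuousAt chiInvSqrt t := continuous_chiInvSqrt.continuousAt
  exact continuous_re.continuousAt.comp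
    (((c1.mul continuousAt_const).mul c4).add (c2.mul ((continuousAt_const.mul c3).mul c4)))

theorem hasDerivAt_dirPoly (N : ℕ) (b : ℕ → ℝ) (s : ℂ) :
    HasDerivAt (dirPoly N b) (dirPoly N (fun m => b m * Real.log m) s) s := by
  unfold dirPoly
  refine HasDerivAt.fun_sum fun m hm => ?_
  have hm0 : (m : ℂ) ≠ 0 := by
    have := (Finset.mem_Icc.mp hm).1
    exact_mod_cast (by omega : m ≠ 0)
  have h1 : HasDerivAt (fun s : ℂ => (m : ℂ) ^ (s - 1)) ((m : ℂ) ^ (s - 1) * log m * 1) s :=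
    ((hasDerivAt_id s).sub_const 1).const_cpow (Or.inl hm0)
  refine (h1.const_mul _).congr_deriv ?_
  rw [ofReal_mul, natCast_log]
  ring

theorem hasDerivAt_gaussW (h t₀ : ℝ) (s : ℂ) :
    HasDerivAt (gaussW h t₀) (2 * (s - (1 / 2 + I * t₀)) / h ^ 2 * gaussW h t₀ s) s := by
  unfold gaussW
  have h1 : HasDerivAt (fun s : ℂ => ((s - (1 / 2 + I * t₀)) / h) ^ 2)
      (((2 : ℕ) : ℂ) * ((s - (1 / 2 + I * t₀)) / h) ^ (2 - 1) * (1 / h)) s :=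
    (((hasDerivAt_id s).sub_const (1 / 2 + I * t₀)).div_const (h : ℂ)).fun_pow 2
  refine h1.cexp.congr_deriv ?_
  norm_num
  ring

/-- The kernel whose integral over the critical line is, up to boundary terms, the twisted integral
of the derivative of `Z(t) ^ k`. -/
noncomputable def twistKernel (k N : ℕ) (h t₀ : ℝ) (b : ℕ → ℝ) (s : ℂ) : ℂ :=
  riemannZeta s ^ k * (k * thetaDeriv s * dirPoly N b s - dirPoly N (fun m => b m * Real.log m) s -
    dirPoly N b s * (2 * (s - (1 / 2 + I * t₀)) / h ^ 2)) * gaussW h t₀ s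

theorem differentiableAt_twistKernel (k N : ℕ) (h t₀ : ℝ) (b : ℕ → ℝ) {s : ℂ} (hs : s.im ≠ 0) :
    DifferentiableAt ℂ (twistKernel k N h t₀ b) s := by
  have h1 : s ≠ 1 := fun h => by simp [h] at hs
  have d1 := differentiableAt_riemannZeta h1
  have d2 := differentiableAt_thetaDeriv hs
  have d3 := (hasDerivAt_dirPoly N b s).differentiableAt
  have d4 := (hasDerivAt_dirPoly N (fun m => b m * Real.log m) s).differentiableAt
  have d5 := (hasDerivAt_gaussW h t₀ s).differentiableAt
  unfold twistKernel
  fun_prop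

/-- The weight `χ(1/2+it)^(k/2)` times a Dirichlet polynomial times a Gaussian. -/
noncomputable def twistWeight (k N : ℕ) (h t₀ : ℝ) (b : ℕ → ℝ) (t : ℝ) : ℂ :=
  (chiInvSqrt t)⁻¹ ^ k * (dirPoly N b (1 / 2 + I * t) * gaussW h t₀ (1 / 2 + I * t))

theorem chiInvSqrt_ne_zero (t : ℝ) : chiInvSqrt t ≠ 0 := fun h => by
  have := norm_chiInvSqrt t
  simp [h] at this

theorem continuous_twistWeight (k N : ℕ) (h t₀ : ℝ) (b : ℕ → ℝ) :
    Continuous (twistWeight k N h t₀ b) := by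
  unfold twistWeight
  have h1 := continuous_dirPoly_line N b (1 / 2)
  have h2 := continuous_gaussW_line h t₀ (1 / 2)
  push_cast at h1 h2
  exact ((continuous_chiInvSqrt.inv₀ chiInvSqrt_ne_zero).pow k).mul (h1.mul h2)

theorem ofReal_hardyZ_pow_mul_twistWeight (k N : ℕ) (h t₀ : ℝ) (b : ℕ → ℝ) (t : ℝ) :
    ((hardyZ t ^ k : ℝ) : ℂ) * twistWeight k N h t₀ b t =
      riemannZeta (1 / 2 + I * t) ^ k *
        (dirPoly N b (1 / 2 + I * t) * gaussW h t₀ (1 / 2 + I * t)) := by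
  have hc := chiInvSqrt_ne_zero t
  rw [twistWeight, ofReal_pow, ofReal_hardyZ, mul_pow, inv_pow]
  field_simp

/-- Arranged so that multiplication by Z^k = ζ^k χ^(-k/2) gives exactly -i times `twistKernel`, in
which no branch of a root of χ is left. -/
theorem hasDerivAt_twistWeight (k N : ℕ) (h t₀ : ℝ) (b : ℕ → ℝ) (t : ℝ) :
    HasDerivAt (twistWeight k N h t₀ b)
      (-(I * (chiInvSqrt t)⁻¹ ^ k * (k * thetaDeriv (1 / 2 + I * t) * dirPoly N b (1 / 2 + I * t) -
        dirPoly N (fun m => b m * Real.log m) (1 / 2 + I * t) - dirPoly N b (1 / 2 + I * t) *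
          (2 * (1 / 2 + I * t - (1 / 2 + I * t₀)) / h ^ 2)) * gaussW h t₀ (1 / 2 + I * t))) t := by
  have hc := chiInvSqrt_ne_zero t
  have h1 : HasDerivAt (fun t : ℝ => dirPoly N b (1 / 2 + I * t))
      (dirPoly N (fun m => b m * Real.log m) (1 / 2 + I * t) * I) t :=
    (hasDerivAt_dirPoly N b _).comp_of_eq t (h₂ := dirPoly N b)
      (h := fun t : ℝ => (1 / 2 + I * t : ℂ)) (hasDerivAt_half_add_I_mul t) rfl
  have h2 : HasDerivAt (fun t : ℝ => gaussW h t₀ (1 / 2 + I * t))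
      (2 * (1 / 2 + I * t - (1 / 2 + I * t₀)) / h ^ 2 * gaussW h t₀ (1 / 2 + I * t) * I) t :=
    (hasDerivAt_gaussW h t₀ _).comp_of_eq t (h₂ := gaussW h t₀)
      (h := fun t : ℝ => (1 / 2 + I * t : ℂ)) (hasDerivAt_half_add_I_mul t) rfl
  have h3 : HasDerivAt (fun t : ℝ => (chiInvSqrt t)⁻¹ ^ k)
      (-(k * I * thetaDeriv (1 / 2 + I * t) * (chiInvSqrt t)⁻¹ ^ k)) t := by
    refine (((hasDerivAt_chiInvSqrt t).fun_inv hc).fun_pow k).congr_deriv ?_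
    rcases k with _ | k
    · simp
    · rw [Nat.add_sub_cancel, pow_succ (chiInvSqrt t)⁻¹ k]
      generalize (chiInvSqrt t)⁻¹ ^ k = X
      field_simp
  refine (h3.fun_mul (h1.fun_mul h2)).congr_deriv ?_
  ring

/-- Integration by parts for the twisted integral of the derivative of `Z(t) ^ k`. -/
theorem integral_deriv_hardyZ_pow_mul_twistWeight (k N : ℕ) (h t₀ : ℝ) (b : ℕ → ℝ) {u v : ℝ}
    (hu : 0 < u) (huv : u ≤ v) :
    ∫ t in u..v, ((k * hardyZ t ^ (k - 1) * deriv hardyZ t : ℝ) : ℂ) * twistWeight k N h t₀ b t =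
      riemannZeta (1 / 2 + I * v) ^ k *
        (dirPoly N b (1 / 2 + I * v) * gaussW h t₀ (1 / 2 + I * v)) -
      riemannZeta (1 / 2 + I * u) ^ k *
        (dirPoly N b (1 / 2 + I * u) * gaussW h t₀ (1 / 2 + I * u)) +
      I * ∫ t in u..v, twistKernel k N h t₀ b (1 / 2 + I * t) := by
  set w := twistWeight k N h t₀ b
  have hZc : Continuous hardyZ := differentiable_hardyZ.continuous
  have hsub : Set.uIcc u v ⊆ Set.Ioi 0 := by
    rw [Set.uIcc_of_le huv]
    exact fun t ht => hu.trans_le ht.1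
  have hker : ContinuousOn (fun t : ℝ => twistKernel k N h t₀ b (1 / 2 + I * t)) (Set.uIcc u v) := by
    intro t ht
    have ht0 : t ≠ 0 := (Set.mem_Ioi.mp (hsub ht)).ne'
    exact (ContinuousAt.comp_of_eq (y := (1 / 2 + I * t : ℂ))
      (differentiableAt_twistKernel k N h t₀ b (by simpa using ht0)).continuousAt
      (hasDerivAt_half_add_I_mul t).continuousAt rfl).continuousWithinAt
  have hE : ∀ t, HasDerivAt (fun t : ℝ => ((hardyZ t ^ k : ℝ) : ℂ))
      ((k * hardyZ t ^ (k - 1) * deriv hardyZ t : ℝ) : ℂ) t := fun t =>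
    ((differentiable_hardyZ t).hasDerivAt.fun_pow k).ofReal_comp
  have hprod : ∀ t, HasDerivAt (fun t : ℝ => ((hardyZ t ^ k : ℝ) : ℂ) * w t)
      (((k * hardyZ t ^ (k - 1) * deriv hardyZ t : ℝ) : ℂ) * w t -
        I * twistKernel k N h t₀ b (1 / 2 + I * t)) t := by
    intro t
    refine ((hE t).fun_mul (hasDerivAt_twistWeight k N h t₀ b t)).congr_deriv ?_
    have hc := chiInvSqrt_ne_zero t
    have : ((hardyZ t ^ k : ℝ) : ℂ) * (chiInvSqrt t)⁻¹ ^ k = riemannZeta (1 / 2 + I * t) ^ k := by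
      rw [ofReal_pow, ofReal_hardyZ, mul_pow, inv_pow]
      field_simp
    rw [twistKernel, ← this]
    ring
  have hi1 : IntervalIntegrable (fun t : ℝ =>
      ((k * hardyZ t ^ (k - 1) * deriv hardyZ t : ℝ) : ℂ) * w t) MeasureTheory.volume u v := by
    refine ContinuousOn.intervalIntegrable ?_
    refine ContinuousOn.mul ?_ (continuous_twistWeight k N h t₀ b).continuousOn
    refine continuous_ofReal.comp_continuousOn ?_
    exact ((continuous_const.mul (hZc.pow _)).mul continuous_deriv_hardyZ).continuousOn
  have hi2 : IntervalIntegrable (fun t : ℝ => I * twistKernel k N h t₀ b (1 / 2 + I * t))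
      MeasureTheory.volume u v := (continuousOn_const.mul hker).intervalIntegrable
  have hftc := intervalIntegral.integral_eq_sub_of_hasDerivAt (fun t _ => hprod t) (hi1.sub hi2)
  rw [intervalIntegral.integral_sub hi1 hi2, intervalIntegral.integral_const_mul] at hftc
  simp only [w, ofReal_hardyZ_pow_mul_twistWeight] at hftc
  linear_combination hftc

/-- Moving the line of integration from `Re s = 1/2` to `Re s = 2`. -/
theorem norm_integral_twistKernel_sub_le (k N : ℕ) (h t₀ : ℝ) (b : ℕ → ℝ) {u v M : ℝ}
    (hu : 0 < u) (huv : u ≤ v)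
    (hMu : ∀ x ∈ Set.Icc (1 / 2 : ℝ) 2, ‖twistKernel k N h t₀ b (x + I * u)‖ ≤ M)
    (hMv : ∀ x ∈ Set.Icc (1 / 2 : ℝ) 2, ‖twistKernel k N h t₀ b (x + I * v)‖ ≤ M) :
    ‖(∫ t in u..v, twistKernel k N h t₀ b (1 / 2 + I * t)) -
      ∫ t in u..v, twistKernel k N h t₀ b (2 + I * t)‖ ≤ 3 * M := by
  set Φ := twistKernel k N h t₀ b
  have hrect := Complex.integral_boundary_rect_eq_zero_of_differentiableOn Φ
    (⟨1 / 2, u⟩ : ℂ) (⟨2, v⟩ : ℂ) (fun s hs => by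
      have h1 : s.im ∈ Set.uIcc u v := hs.2
      rw [Set.uIcc_of_le huv] at h1
      exact (differentiableAt_twistKernel k N h t₀ b
        (by linarith [h1.1] : 0 < s.im).ne').differentiableWithinAt)
  simp only [smul_eq_mul] at hrect
  have e1 : (∫ t in u..v, Φ (((2 : ℝ) : ℂ) + t * I)) = ∫ t in u..v, Φ (2 + I * t) := by
    simp only [ofReal_ofNat, mul_comm I]
  have e2 : (∫ t in u..v, Φ (((1 / 2 : ℝ) : ℂ) + t * I)) = ∫ t in u..v, Φ (1 / 2 + I * t) := by
    push_cast
    simp only [mul_comm I]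
  have e3 : ∀ y : ℝ, (∫ x in (1 / 2 : ℝ)..2, Φ (x + y * I)) =
      ∫ x in (1 / 2 : ℝ)..2, Φ (x + I * y) := fun y => by simp only [mul_comm I]
  rw [e1, e2, e3, e3] at hrect
  -- The two horizontal sides have length 3/2 each, hence the total 3M.
  have hb : ∀ y : ℝ, (∀ x ∈ Set.Icc (1 / 2 : ℝ) 2, ‖Φ (x + I * y)‖ ≤ M) →
      ‖∫ x in (1 / 2 : ℝ)..2, Φ (x + I * y)‖ ≤ M * (3 / 2) := by
    intro y hy
    have := intervalIntegral.norm_integral_le_of_norm_le_const (a := (1 / 2 : ℝ)) (b := 2)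
      (f := fun x : ℝ => Φ (x + I * y)) (C := M) fun x hx => hy x (by
        rw [Set.uIoc_of_le (by norm_num)] at hx
        exact ⟨hx.1.le, hx.2⟩)
    rw [show |(2 : ℝ) - 1 / 2| = 3 / 2 by norm_num] at this
    exact this
  have h1 : (∫ t in u..v, Φ (1 / 2 + I * t)) - ∫ t in u..v, Φ (2 + I * t) =
      -I * ((∫ x in (1 / 2 : ℝ)..2, Φ (x + I * u)) - ∫ x in (1 / 2 : ℝ)..2, Φ (x + I * v)) := by
    linear_combination I * hrect +
      ((∫ t in u..v, Φ (1 / 2 + I * t)) - ∫ t in u..v, Φ (2 + I * t)) * I_sq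
  rw [h1, norm_mul, norm_neg, norm_I, one_mul]
  refine (norm_sub_le _ _).trans ?_
  linarith [hb u hMu, hb v hMv]

/-! ### Error terms and the evaluation of the twisted integral -/

/-- A crude bound that dominates every coefficient sum of the Dirichlet polynomials below. It
suffices because N will be a very small power of T. -/
theorem sum_piltz_mul_one_add_log_le (k N : ℕ) :
    ∑ m ∈ Finset.Icc 1 N, (piltz k m : ℝ) * (1 + Real.log m) * (m : ℝ) ^ 2 ≤ (N : ℝ) ^ (k + 4) := by
  calc _ ≤ ∑ m ∈ Finset.Icc 1 N, (N : ℝ) ^ (k + 3) := by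
        refine Finset.sum_le_sum fun m hm => ?_
        obtain ⟨hm1, hmN⟩ := Finset.mem_Icc.mp hm
        have hm0 : (0 : ℝ) < m := by exact_mod_cast hm1
        have h1 : (piltz k m : ℝ) ≤ (m : ℝ) ^ k := by
          exact_mod_cast piltz_le_pow k m (by omega)
        have h2 : 1 + Real.log m ≤ m := by linarith [Real.log_le_sub_one_of_pos hm0]
        have h3 : 0 ≤ Real.log m := Real.log_nonneg (by exact_mod_cast hm1)
        calc (piltz k m : ℝ) * (1 + Real.log m) * (m : ℝ) ^ 2
            ≤ (m : ℝ) ^ k * m * (m : ℝ) ^ 2 := by gcongr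
          _ = (m : ℝ) ^ (k + 3) := by ring
          _ ≤ (N : ℝ) ^ (k + 3) := by gcongr
    _ = _ := by
        rw [Finset.sum_const, Nat.card_Icc, nsmul_eq_mul, Nat.add_sub_cancel]
        ring

theorem summable_piltz_rpow_neg_two (k : ℕ) :
    Summable fun n : ℕ => (piltz k n : ℝ) * (n : ℝ) ^ (-2 : ℝ) := by
  have h := (hasSum_piltz k (s := 2) (by norm_num)).summable.norm
  refine h.congr fun n => ?_
  rcases eq_or_ne n 0 with rfl | hn
  · simp
  rw [norm_mul, norm_natCast, norm_natCast_cpow_of_pos (Nat.pos_of_ne_zero hn)]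
  simp

theorem summable_piltz_div_sq (k : ℕ) : Summable fun n : ℕ => (piltz k n : ℝ) / (n : ℝ) ^ 2 := by
  refine (summable_piltz_rpow_neg_two k).congr fun n => ?_
  rw [Real.rpow_neg n.cast_nonneg, div_eq_mul_inv, Real.rpow_ofNat]

theorem norm_riemannZeta_two_add_pow_le (k : ℕ) (t : ℝ) :
    ‖riemannZeta (2 + I * t) ^ k‖ ≤ ∑' n : ℕ, (piltz k n : ℝ) / (n : ℝ) ^ 2 := by
  rw [← (hasSum_piltz k (s := 2 + I * t) (by simp)).tsum_eq]
  refine tsum_of_norm_bounded (summable_piltz_div_sq k).hasSum fun n => ?_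
  rcases eq_or_ne n 0 with rfl | hn
  · simp
  rw [norm_mul, norm_natCast, norm_natCast_cpow_of_pos (Nat.pos_of_ne_zero hn), div_eq_mul_inv]
  simp only [neg_re, add_re, re_ofNat, mul_re, I_re, ofReal_re, zero_mul, I_im, ofReal_im, mul_zero,
    sub_self, add_zero]
  rw [Real.rpow_neg n.cast_nonneg, Real.rpow_ofNat]

theorem norm_thetaDeriv_le_log {T : ℝ} (hT : 8 ≤ T) (hL : 2 ≤ Real.log T) {s : ℂ}
    (h1 : 1 / 2 ≤ s.re) (h2 : s.re ≤ 2) (h3 : T ≤ s.im) (h4 : s.im ≤ 2 * T) :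
    ‖thetaDeriv s‖ ≤ Real.log T := by
  have hb := norm_thetaDeriv_sub_le h1 h2 (by linarith)
  have hpi := Real.pi_gt_three
  have hpi4 := Real.pi_lt_d2
  have hs : 0 < s.im := by linarith
  have h5 : 0 ≤ Real.log (s.im / (2 * Real.pi)) := by
    apply Real.log_nonneg
    rw [le_div_iff₀ (by positivity)]
    linarith
  have h6 : Real.log (s.im / (2 * Real.pi)) ≤ Real.log T := by
    apply Real.log_le_log (by positivity)
    rw [div_le_iff₀ (by positivity)]
    nlinarith
  have h7 : 6 / s.im ≤ 1 := by
    rw [div_le_one hs]; linarith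
  have h8 : ‖((Real.log (s.im / (2 * Real.pi)) / 2 : ℝ) : ℂ)‖ ≤ Real.log T / 2 := by
    rw [norm_real, Real.norm_of_nonneg (by linarith)]
    linarith
  have := norm_le_norm_add_norm_sub' (thetaDeriv s) ((Real.log (s.im / (2 * Real.pi)) / 2 : ℝ) : ℂ)
  linarith

theorem abs_log_sub_log_le_div {T x y : ℝ} (hT : 0 < T) (hx : T ≤ x) (hy : T ≤ y) :
    |Real.log x - Real.log y| ≤ |x - y| / T := by
  have key : ∀ a b : ℝ, T ≤ a → T ≤ b → Real.log a - Real.log b ≤ |a - b| / T := by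
    intro a b ha hb
    have ha0 : 0 < a := by linarith
    have hb0 : 0 < b := by linarith
    rw [← Real.log_div ha0.ne' hb0.ne']
    calc Real.log (a / b) ≤ a / b - 1 := Real.log_le_sub_one_of_pos (by positivity)
      _ = (a - b) / b := by field_simp
      _ ≤ |a - b| / b := by gcongr; exact le_abs_self _
      _ ≤ |a - b| / T := by gcongr
  rw [abs_le]
  constructor
  · have := key y x hy hx
    rw [abs_sub_comm] at this
    linarith
  · exact key x y hx hy

/-- A function dominated by a Gaussian has small integral outside a window of `L` widths. -/
theorem norm_integral_sub_intervalIntegral_le {f : ℝ → ℂ} {h L K t₀ : ℝ} (hh : 0 < h) (hL : 0 ≤ L)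
    (hf : MeasureTheory.Integrable f)
    (hb : ∀ t, ‖f t‖ ≤ K * Real.exp (-((t - t₀) / h) ^ 2)) :
    ‖(∫ t, f t) - ∫ t in (t₀ - h * L)..(t₀ + h * L), f t‖ ≤
      K * Real.exp (-L ^ 2 / 2) * (√Real.pi * (√2 * h)) := by
  have hK : 0 ≤ K := by
    have := (norm_nonneg _).trans (hb t₀)
    simpa using this
  have hR : 0 ≤ h * L := by positivity
  rw [intervalIntegral.integral_of_le (by linarith),
    ← MeasureTheory.integral_add_compl measurableSet_Ioc hf, add_sub_cancel_left,
    ← integral_exp_neg_sq (by positivity : 0 < √2 * h) t₀, ← MeasureTheory.integral_const_mul]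
  have hint : MeasureTheory.Integrable fun t : ℝ =>
      K * Real.exp (-L ^ 2 / 2) * Real.exp (-((t - t₀) / (√2 * h)) ^ 2) :=
    (integrable_exp_neg_sq (by positivity) t₀).const_mul _
  refine (MeasureTheory.norm_integral_le_of_norm_le hint.integrableOn ?_).trans
    (MeasureTheory.setIntegral_le_integral hint
      (MeasureTheory.ae_of_all _ fun t => by positivity))
  refine (MeasureTheory.ae_restrict_iff' measurableSet_Ioc.compl).mpr
    (MeasureTheory.ae_of_all _ fun t ht => ?_)
  refine (hb t).trans ?_
  rw [mul_assoc, ← Real.exp_add]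
  -- Outside the window half of the exponent supplies exp(-L^2/2). The other half is kept as an
  -- integrable Gaussian of width √2 h.
  have hx : L ^ 2 ≤ ((t - t₀) / h) ^ 2 := by
    rw [div_pow, le_div_iff₀ (by positivity), ← mul_pow, sq_le_sq, mul_comm, abs_of_nonneg hR]
    by_contra! hlt
    rw [abs_lt] at hlt
    exact ht ⟨by linarith, by linarith⟩
  have h2 : ((t - t₀) / (√2 * h)) ^ 2 = ((t - t₀) / h) ^ 2 / 2 := by
    rw [div_pow, mul_pow, Real.sq_sqrt (by norm_num), div_pow]
    field_simp
  gcongr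
  rw [h2]
  linarith

section Window

variable (k N : ℕ) {C h t₀ T : ℝ}

/-- At the ends of the window the Gaussian is of size exp(-(log T)^2), smaller than every power of
T, so polynomial bounds for the other factors are enough. The factor e^3 covers (x - 1/2)^2/h^2 ≤
9/4. -/
theorem norm_twistKernel_le_of_abs_sub_eq
    (hC : ∀ s : ℂ, 1 / 2 ≤ s.re → 1 ≤ s.im → ‖riemannZeta s‖ ≤ C * ‖s‖) (hC0 : 0 < C)
    (hh : 1 ≤ h) (hT : 8 ≤ T) (hL : 2 ≤ Real.log T)
    (h1 : T ≤ t₀ - h * Real.log T) (h2 : t₀ + h * Real.log T ≤ 2 * T) {x t : ℝ}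
    (hx : x ∈ Set.Icc (1 / 2 : ℝ) 2) (ht : |t - t₀| = h * Real.log T) :
    ‖twistKernel k N h t₀ (fun m => (piltz k m : ℝ)) (x + I * t)‖ ≤
      (4 * C * T) ^ k * ((N : ℝ) ^ (k + 4) * (k * Real.log T + 1 + 4 * T)) *
        (Real.exp 3 * Real.exp (-Real.log T ^ 2)) := by
  set L := Real.log T with hL_def
  set P := (N : ℝ) ^ (k + 4) with hP_def
  have hR : 0 ≤ h * L := by positivity
  have htl : T ≤ t := by have := neg_abs_le (t - t₀); linarith
  have htu : t ≤ 2 * T := by have := le_abs_self (t - t₀); linarith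
  have hP := sum_piltz_mul_one_add_log_le k N
  rw [← hP_def] at hP
  have hlog : ∀ m ∈ Finset.Icc 1 N, 0 ≤ Real.log m ∧ (1 : ℝ) ≤ m := fun m hm => by
    have h1 : (1 : ℝ) ≤ m := by exact_mod_cast (Finset.mem_Icc.mp hm).1
    exact ⟨Real.log_nonneg h1, h1⟩
  have hA : ‖dirPoly N (fun m => (piltz k m : ℝ)) (x + I * t)‖ ≤ P := by
    refine (norm_dirPoly_le N _ (by simpa using hx.2)).trans (le_trans ?_ hP)
    refine Finset.sum_le_sum fun m hm => ?_
    obtain ⟨hm1, hm2⟩ := hlog m hm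
    rw [abs_of_nonneg (by positivity), mul_assoc]
    gcongr
    nlinarith
  have hB : ‖dirPoly N (fun m => (piltz k m : ℝ) * Real.log m) (x + I * t)‖ ≤ P := by
    refine (norm_dirPoly_le N _ (by simpa using hx.2)).trans (le_trans ?_ hP)
    refine Finset.sum_le_sum fun m hm => ?_
    obtain ⟨hm1, hm2⟩ := hlog m hm
    rw [abs_of_nonneg (by positivity), mul_assoc, mul_assoc]
    gcongr
    · linarith
    · nlinarith
  have hζ : ‖riemannZeta (x + I * t)‖ ≤ 4 * C * T := by
    refine (hC _ (by simpa using hx.1) (by simp; linarith)).trans ?_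
    have hn : ‖(x + I * t : ℂ)‖ ≤ 4 * T := by
      refine (norm_add_le _ _).trans ?_
      rw [norm_mul, norm_I, norm_real, norm_real, Real.norm_of_nonneg (by linarith [hx.1]),
        Real.norm_of_nonneg (by linarith)]
      linarith [hx.2]
    calc C * ‖(x + I * t : ℂ)‖ ≤ C * (4 * T) := by gcongr
      _ = _ := by ring
  have hϑ : ‖thetaDeriv (x + I * t)‖ ≤ L :=
    norm_thetaDeriv_le_log hT hL (by simpa using hx.1) (by simpa using hx.2) (by simpa using htl)
      (by simpa using htu)
  have hs : ‖2 * ((x + I * t : ℂ) - (1 / 2 + I * t₀)) / h ^ 2‖ ≤ 4 * T := by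
    have h3 : (x + I * t : ℂ) - (1 / 2 + I * t₀) = ((x - 1 / 2 : ℝ) : ℂ) + I * ((t - t₀ : ℝ) : ℂ) := by
      push_cast; ring
    have h4 : ‖(x + I * t : ℂ) - (1 / 2 + I * t₀)‖ ≤ 3 / 2 + h * L := by
      rw [h3]
      refine (norm_add_le _ _).trans ?_
      rw [norm_mul, norm_I, norm_real, norm_real, Real.norm_of_nonneg (by linarith [hx.1]),
        Real.norm_eq_abs, ht]
      linarith [hx.2]
    rw [norm_div, norm_mul, norm_pow, norm_real, Real.norm_of_nonneg (by linarith),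
      RCLike.norm_ofNat]
    calc _ ≤ 2 * ‖(x + I * t : ℂ) - (1 / 2 + I * t₀)‖ :=
          div_le_self (by positivity) (one_le_pow₀ hh)
      _ ≤ 4 * T := by linarith
  have hW : ‖gaussW h t₀ (x + I * t)‖ ≤ Real.exp 3 * Real.exp (-L ^ 2) := by
    rw [norm_gaussW_eq, div_pow, ← sq_abs (t - t₀), ht]
    have h5 : (h * L) ^ 2 / h ^ 2 = L ^ 2 := by field_simp
    rw [h5]
    gcongr
    have h6 : 1 ≤ h ^ 2 := one_le_pow₀ hh
    rw [div_le_iff₀ (by positivity)]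
    nlinarith [hx.1, hx.2]
  rw [twistKernel, norm_mul, norm_mul, norm_pow]
  have hP0 : 0 ≤ P := by positivity
  gcongr
  refine (norm_sub_le _ _).trans ((add_le_add_left (norm_sub_le _ _) _).trans ?_)
  rw [norm_mul, norm_mul, norm_mul (dirPoly _ _ _), norm_natCast]
  have e1 : (k : ℝ) * ‖thetaDeriv (x + I * t)‖ *
      ‖dirPoly N (fun m => (piltz k m : ℝ)) (x + I * t)‖ ≤ k * L * P := by gcongr
  have e2 : ‖dirPoly N (fun m => (piltz k m : ℝ)) (x + I * t)‖ *
      ‖2 * ((x + I * t : ℂ) - (1 / 2 + I * t₀)) / h ^ 2‖ ≤ P * (4 * T) := by gcongr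
  linarith

/-- On the line `Re s = 2` the kernel is close to a Dirichlet series times a Dirichlet polynomial. -/
theorem norm_twistKernel_two_sub_le (hh : 1 ≤ h) (hT : 8 ≤ T) (hL : 2 ≤ Real.log T)
    (h1 : T ≤ t₀ - h * Real.log T) {t : ℝ} (ht : |t - t₀| ≤ h * Real.log T) :
    ‖twistKernel k N h t₀ (fun m => (piltz k m : ℝ)) (2 + I * t) -
      riemannZeta (2 + I * t) ^ k * dirPoly N (fun m => k * (Real.log (t₀ / (2 * Real.pi)) / 2) *
        (piltz k m : ℝ) - (piltz k m : ℝ) * Real.log m) (2 + I * t) * gaussW h t₀ (2 + I * t)‖ ≤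
      (∑' n : ℕ, (piltz k n : ℝ) / (n : ℝ) ^ 2) * ((N : ℝ) ^ (k + 4) *
        (k * ((6 + h * Real.log T) / T) + 2 * (2 + h * Real.log T) / h ^ 2)) * Real.exp 3 := by
  set L := Real.log T with hL_def
  set P := (N : ℝ) ^ (k + 4) with hP_def
  set lam := Real.log (t₀ / (2 * Real.pi)) / 2 with hlam
  have hR : 0 ≤ h * L := by positivity
  have htl : T ≤ t := by have := neg_abs_le (t - t₀); linarith
  have hP := sum_piltz_mul_one_add_log_le k N
  rw [← hP_def] at hP
  have hA : ‖dirPoly N (fun m => (piltz k m : ℝ)) (2 + I * t)‖ ≤ P := by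
    refine (norm_dirPoly_le N _ (by simp)).trans (le_trans ?_ hP)
    refine Finset.sum_le_sum fun m hm => ?_
    have hm1 : (1 : ℝ) ≤ m := by exact_mod_cast (Finset.mem_Icc.mp hm).1
    have := Real.log_nonneg hm1
    rw [abs_of_nonneg (by positivity), mul_assoc]
    gcongr
    nlinarith
  have hlin : dirPoly N (fun m => k * lam * (piltz k m : ℝ) - (piltz k m : ℝ) * Real.log m)
      (2 + I * t) = k * lam * dirPoly N (fun m => (piltz k m : ℝ)) (2 + I * t) -
        dirPoly N (fun m => (piltz k m : ℝ) * Real.log m) (2 + I * t) := by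
    simp only [dirPoly, Finset.mul_sum, ← Finset.sum_sub_distrib]
    refine Finset.sum_congr rfl fun m _ => ?_
    push_cast
    ring
  -- θ' is frozen at the centre t₀: 6/T is the error of its asymptotic formula, and hL/T bounds the
  -- variation of the logarithm over the window.
  have hϑ : ‖thetaDeriv (2 + I * t) - lam‖ ≤ (6 + h * L) / T := by
    have hb := norm_thetaDeriv_sub_le (s := 2 + I * t) (by simp; norm_num) (by simp)
      (by simp; linarith)
    have him : (2 + I * t : ℂ).im = t := by simp
    rw [him] at hb
    have h2 : Real.log (t / (2 * Real.pi)) / 2 - lam = (Real.log t - Real.log t₀) / 2 := by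
      rw [hlam, Real.log_div (by linarith) (by positivity), Real.log_div (by linarith) (by positivity)]
      ring
    have h3 : ‖((Real.log (t / (2 * Real.pi)) / 2 : ℝ) : ℂ) - lam‖ ≤ h * L / T := by
      rw [← ofReal_sub, norm_real, Real.norm_eq_abs, h2, abs_div, abs_two]
      have h4 := abs_log_sub_log_le_div (by linarith) htl (by linarith : T ≤ t₀)
      have h5 : |t - t₀| / T ≤ h * L / T := by gcongr
      have := abs_nonneg (Real.log t - Real.log t₀)
      linarith
    have h6 : 6 / t ≤ 6 / T := by gcongr
    have := norm_sub_le_norm_sub_add_norm_sub (thetaDeriv (2 + I * t))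
      ((Real.log (t / (2 * Real.pi)) / 2 : ℝ) : ℂ) (lam : ℂ)
    rw [add_div]
    linarith
  have hs : ‖2 * ((2 + I * t : ℂ) - (1 / 2 + I * t₀)) / h ^ 2‖ ≤ 2 * (2 + h * L) / h ^ 2 := by
    have h3 : (2 + I * t : ℂ) - (1 / 2 + I * t₀) = ((3 / 2 : ℝ) : ℂ) + I * ((t - t₀ : ℝ) : ℂ) := by
      push_cast; ring
    rw [norm_div, norm_mul, norm_pow, norm_real, Real.norm_of_nonneg (by linarith),
      RCLike.norm_ofNat, h3]
    gcongr
    refine (norm_add_le _ _).trans ?_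
    rw [norm_mul, norm_I, norm_real, norm_real, Real.norm_of_nonneg (by norm_num),
      Real.norm_eq_abs]
    linarith
  have hW : ‖gaussW h t₀ (2 + I * t)‖ ≤ Real.exp 3 := by
    have := norm_gaussW_eq h t₀ 2 t
    push_cast at this
    rw [this]
    have h6 : 1 ≤ h ^ 2 := one_le_pow₀ hh
    calc _ ≤ Real.exp 3 * 1 := by
          gcongr
          · rw [div_le_iff₀ (by positivity)]
            nlinarith
          · rw [Real.exp_le_one_iff, neg_nonpos]
            positivity
      _ = _ := mul_one _
  have hζ := norm_riemannZeta_two_add_pow_le k t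
  have hdiff : twistKernel k N h t₀ (fun m => (piltz k m : ℝ)) (2 + I * t) -
      riemannZeta (2 + I * t) ^ k * dirPoly N (fun m => k * lam *
        (piltz k m : ℝ) - (piltz k m : ℝ) * Real.log m) (2 + I * t) * gaussW h t₀ (2 + I * t) =
      riemannZeta (2 + I * t) ^ k * (dirPoly N (fun m => (piltz k m : ℝ)) (2 + I * t) *
        (k * (thetaDeriv (2 + I * t) - lam) - 2 * ((2 + I * t : ℂ) - (1 / 2 + I * t₀)) / h ^ 2)) *
          gaussW h t₀ (2 + I * t) := by
    rw [hlin, twistKernel]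
    ring
  rw [hdiff, norm_mul, norm_mul, norm_mul (dirPoly _ _ _)]
  have hP0 : 0 ≤ P := by positivity
  have hA2 : 0 ≤ ∑' n : ℕ, (piltz k n : ℝ) / (n : ℝ) ^ 2 := tsum_nonneg fun n => by positivity
  gcongr
  refine (norm_sub_le _ _).trans ?_
  rw [norm_mul, norm_natCast]
  gcongr

end Window

theorem sum_abs_piltz_combination_le (k N : ℕ) {lam L : ℝ} (h0 : 0 ≤ lam) (hL : lam ≤ L) :
    ∑ m ∈ Finset.Icc 1 N, |k * lam * (piltz k m : ℝ) - (piltz k m : ℝ) * Real.log m| * (m : ℝ) ^ 2 ≤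
      (k * L + 1) * (N : ℝ) ^ (k + 4) := by
  have hL0 : 0 ≤ L := h0.trans hL
  refine le_trans ?_ (mul_le_mul_of_nonneg_left (sum_piltz_mul_one_add_log_le k N) (by positivity))
  rw [Finset.mul_sum]
  refine Finset.sum_le_sum fun m hm => ?_
  have hm1 : (1 : ℝ) ≤ m := by exact_mod_cast (Finset.mem_Icc.mp hm).1
  have hlog := Real.log_nonneg hm1
  rw [← mul_assoc]
  gcongr
  refine (abs_sub _ _).trans ?_
  rw [abs_of_nonneg (by positivity), abs_of_nonneg (by positivity)]
  have h1 : k * lam ≤ k * L := by gcongr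
  have h2 : 0 ≤ (k : ℝ) * L := by positivity
  have h3 : (0 : ℝ) ≤ piltz k m := by positivity
  have : k * lam + Real.log m ≤ (k * L + 1) * (1 + Real.log m) := by nlinarith
  nlinarith

theorem sum_mul_le_sum_mul_sq (N : ℕ) (b : ℕ → ℝ) :
    ∑ m ∈ Finset.Icc 1 N, |b m| * (m : ℝ) ≤ ∑ m ∈ Finset.Icc 1 N, |b m| * (m : ℝ) ^ 2 := by
  refine Finset.sum_le_sum fun m hm => ?_
  have hm1 : (1 : ℝ) ≤ m := by exact_mod_cast (Finset.mem_Icc.mp hm).1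
  gcongr
  nlinarith

theorem sum_abs_piltz_mul_sq_le (k N : ℕ) :
    ∑ m ∈ Finset.Icc 1 N, |(piltz k m : ℝ)| * (m : ℝ) ^ 2 ≤ (N : ℝ) ^ (k + 4) := by
  refine le_trans (Finset.sum_le_sum fun m hm => ?_) (sum_piltz_mul_one_add_log_le k N)
  have hm1 : (1 : ℝ) ≤ m := by exact_mod_cast (Finset.mem_Icc.mp hm).1
  have hlog := Real.log_nonneg hm1
  rw [abs_of_nonneg (by positivity)]
  gcongr
  nlinarith [(piltz k m).cast_nonneg (α := ℝ)]

theorem norm_zeta_pow_mul_dirPoly_gaussW_le (k N : ℕ) {C h t₀ T : ℝ}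
    (hC : ∀ s : ℂ, 1 / 2 ≤ s.re → 1 ≤ s.im → ‖riemannZeta s‖ ≤ C * ‖s‖) (hC0 : 0 < C)
    (hh : 1 ≤ h) (hT : 8 ≤ T) (h1 : T ≤ t₀ - h * Real.log T) (h2 : t₀ + h * Real.log T ≤ 2 * T)
    {t : ℝ} (ht : |t - t₀| = h * Real.log T) :
    ‖riemannZeta (1 / 2 + I * t) ^ k * (dirPoly N (fun m => (piltz k m : ℝ)) (1 / 2 + I * t) *
      gaussW h t₀ (1 / 2 + I * t))‖ ≤
        (4 * C * T) ^ k * (N : ℝ) ^ (k + 4) * Real.exp (-Real.log T ^ 2) := by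
  have htl : T ≤ t := by have := neg_abs_le (t - t₀); linarith
  have htu : t ≤ 2 * T := by have := le_abs_self (t - t₀); linarith
  have hζ : ‖riemannZeta (1 / 2 + I * t)‖ ≤ 4 * C * T := by
    refine (hC _ (by simp) (by simp; linarith)).trans ?_
    have hn : ‖(1 / 2 + I * t : ℂ)‖ ≤ 4 * T := by
      refine (norm_add_le _ _).trans ?_
      rw [norm_mul, norm_I, norm_real, Real.norm_of_nonneg (by linarith)]
      norm_num
      linarith
    calc C * ‖(1 / 2 + I * t : ℂ)‖ ≤ C * (4 * T) := by gcongr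
      _ = _ := by ring
  have hA : ‖dirPoly N (fun m => (piltz k m : ℝ)) (1 / 2 + I * t)‖ ≤ (N : ℝ) ^ (k + 4) :=
    (norm_dirPoly_le N _ (by norm_num)).trans
      ((sum_mul_le_sum_mul_sq N _).trans (sum_abs_piltz_mul_sq_le k N))
  rw [norm_mul, norm_mul, norm_pow, gaussW_half, norm_real, Real.norm_of_nonneg (by positivity),
    ← mul_assoc, div_pow, ← sq_abs (t - t₀), ht, mul_pow, mul_div_cancel_left₀ _ (by positivity)]
  gcongr

/-- The error in the evaluation of the twisted integral of the derivative of `Z(t) ^ k`. -/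
noncomputable def twistError (k N : ℕ) (C h T : ℝ) : ℝ :=
  2 * ((4 * C * T) ^ k * (N : ℝ) ^ (k + 4) * Real.exp (-Real.log T ^ 2)) +
  3 * ((4 * C * T) ^ k * ((N : ℝ) ^ (k + 4) * (k * Real.log T + 1 + 4 * T)) *
        (Real.exp 3 * Real.exp (-Real.log T ^ 2))) +
  (∑' n : ℕ, (piltz k n : ℝ) / (n : ℝ) ^ 2) * ((N : ℝ) ^ (k + 4) *
        (k * ((6 + h * Real.log T) / T) + 2 * (2 + h * Real.log T) / h ^ 2)) * Real.exp 3 *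
        (2 * (h * Real.log T)) +
  (∑' n : ℕ, (piltz k n : ℝ) / (n : ℝ) ^ 2) * ((k * Real.log T + 1) * (N : ℝ) ^ (k + 4)) *
        Real.exp 3 * Real.exp (-Real.log T ^ 2 / 2) * (√Real.pi * (√2 * h)) +
  √Real.pi * h * (Real.exp (-(h ^ 2 / (32 * N ^ 2))) *
        ((∑' n : ℕ, (piltz k n : ℝ) / (n : ℝ) ^ 2) * ((k * Real.log T + 1) * (N : ℝ) ^ (k + 4))))

/-- The five summands of `twistError` are, in order: the boundary terms of the integration by parts;
the horizontal sides of the contour; freezing θ' and discarding the derivative of the Gaussian on Re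
s = 2; extending the integral to the whole line; the off-diagonal terms. -/
theorem norm_twisted_integral_sub_main_le (k N : ℕ) {C h t₀ T : ℝ}
    (hC : ∀ s : ℂ, 1 / 2 ≤ s.re → 1 ≤ s.im → ‖riemannZeta s‖ ≤ C * ‖s‖) (hC0 : 0 < C)
    (hh : 1 ≤ h) (hT : 8 ≤ T) (hL : 2 ≤ Real.log T)
    (h1 : T ≤ t₀ - h * Real.log T) (h2 : t₀ + h * Real.log T ≤ 2 * T) (hN : 32 * N ≤ h ^ 2) :
    ‖(∫ t in (t₀ - h * Real.log T)..(t₀ + h * Real.log T),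
        ((k * hardyZ t ^ (k - 1) * deriv hardyZ t : ℝ) : ℂ) *
          twistWeight k N h t₀ (fun m => (piltz k m : ℝ)) t) -
      I * (√Real.pi * h * ∑ m ∈ Finset.Icc 1 N, (piltz k m : ℝ) *
        (k * (Real.log (t₀ / (2 * Real.pi)) / 2) * (piltz k m : ℝ) - (piltz k m : ℝ) * Real.log m) /
          m : ℝ)‖ ≤ twistError k N C h T := by
  set L := Real.log T with hL_def
  set lam := Real.log (t₀ / (2 * Real.pi)) / 2 with hlam
  set u := t₀ - h * L with hu_def
  set v := t₀ + h * L with hv_def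
  set d : ℕ → ℝ := fun m => (piltz k m : ℝ) with hd
  set b : ℕ → ℝ := fun m => k * lam * (piltz k m : ℝ) - (piltz k m : ℝ) * Real.log m with hb
  set A2 := ∑' n : ℕ, (piltz k n : ℝ) / (n : ℝ) ^ 2 with hA2
  have hA2' : 0 ≤ A2 := tsum_nonneg fun n => by positivity
  have hh0 : 0 < h := by linarith
  have hR : 0 ≤ h * L := by positivity
  have huv : u ≤ v := by linarith
  have hu0 : 0 < u := by linarith
  have hpi := Real.pi_gt_three
  have hpi4 := Real.pi_lt_d2
  have hlam0 : 0 ≤ lam := by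
    refine div_nonneg (Real.log_nonneg ?_) (by norm_num)
    rw [le_div_iff₀ (by positivity)]
    linarith
  have hlamL : lam ≤ L := by
    have : Real.log (t₀ / (2 * Real.pi)) ≤ L := by
      apply Real.log_le_log (div_pos (by linarith) (by positivity))
      rw [div_le_iff₀ (by positivity)]
      nlinarith
    linarith
  have hb2 := sum_abs_piltz_combination_le k N hlam0 hlamL
  have hv1 : |v - t₀| = h * L := by rw [hv_def, add_sub_cancel_left, abs_of_nonneg hR]
  have hu1 : |u - t₀| = h * L := by
    rw [hu_def, sub_sub_cancel_left, abs_neg, abs_of_nonneg hR]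
  have hibp := integral_deriv_hardyZ_pow_mul_twistWeight k N h t₀ d hu0 huv
  have hB1 := norm_zeta_pow_mul_dirPoly_gaussW_le k N hC hC0 hh hT h1 h2 hv1
  have hB2 := norm_zeta_pow_mul_dirPoly_gaussW_le k N hC hC0 hh hT h1 h2 hu1
  have hshift := norm_integral_twistKernel_sub_le k N h t₀ d hu0 huv
    (fun x hx => norm_twistKernel_le_of_abs_sub_eq k N hC hC0 hh hT hL h1 h2 hx hu1)
    (fun x hx => norm_twistKernel_le_of_abs_sub_eq k N hC hC0 hh hT hL h1 h2 hx hv1)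
  set f : ℝ → ℂ := fun t => riemannZeta (2 + I * t) ^ k * dirPoly N b (2 + I * t) *
    gaussW h t₀ (2 + I * t) with hf
  have hline : Continuous fun t : ℝ => (2 + I * t : ℂ) := by fun_prop
  have hζc : Continuous fun t : ℝ => riemannZeta (2 + I * t) := by
    rw [continuous_iff_continuousAt]
    intro t
    refine ContinuousAt.comp_of_eq (y := (2 + I * t : ℂ))
      (differentiableAt_riemannZeta fun h => ?_).continuousAt hline.continuousAt rfl
    have := congrArg re h
    norm_num at this
  have hfc : Continuous f := by
    have c1 := continuous_dirPoly_line N b 2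
    have c2 := continuous_gaussW_line h t₀ 2
    push_cast at c1 c2
    exact ((hζc.pow k).mul c1).mul c2
  have hfb : ∀ t, ‖f t‖ ≤ A2 * ((k * L + 1) * (N : ℝ) ^ (k + 4)) * Real.exp 3 *
      Real.exp (-((t - t₀) / h) ^ 2) := by
    intro t
    have e1 := norm_riemannZeta_two_add_pow_le k t
    have e2 : ‖dirPoly N b (2 + I * t)‖ ≤ (k * L + 1) * (N : ℝ) ^ (k + 4) :=
      (norm_dirPoly_le N _ (by simp)).trans ((sum_mul_le_sum_mul_sq N _).trans hb2)
    have e3 : ‖gaussW h t₀ (2 + I * t)‖ ≤ Real.exp 3 * Real.exp (-((t - t₀) / h) ^ 2) := by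
      have := norm_gaussW_eq h t₀ 2 t
      push_cast at this
      rw [this]
      gcongr
      have h6 : 1 ≤ h ^ 2 := one_le_pow₀ hh
      rw [div_le_iff₀ (by positivity)]
      nlinarith
    simp only [hf]
    rw [norm_mul, norm_mul, mul_assoc (A2 * _)]
    gcongr
  have hfint : MeasureTheory.Integrable f :=
    ((integrable_exp_neg_sq hh0 t₀).const_mul _).mono' hfc.aestronglyMeasurable
      (MeasureTheory.ae_of_all _ hfb)
  have htail := norm_integral_sub_intervalIntegral_le hh0 (by linarith : 0 ≤ L) hfint hfb
  have hmain := norm_integral_dirichlet_sub_diagonal_le hh0 t₀ 2 hN (a := fun n => (piltz k n : ℝ))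
    (fun n => by positivity) (by simp) b (summable_piltz_rpow_neg_two k) (summable_piltz_div_sq k)
    (D := fun s => riemannZeta s ^ k) (fun t => by
      have := hasSum_piltz k (s := ((2 : ℝ) : ℂ) + I * t) (by simp)
      simpa using this)
  simp only [ofReal_ofNat] at hmain
  have hmain' : ‖(∫ t, f t) - (√Real.pi * h * ∑ m ∈ Finset.Icc 1 N, (piltz k m : ℝ) * b m / m : ℝ)‖
      ≤ √Real.pi * h * (Real.exp (-(h ^ 2 / (32 * N ^ 2))) *
        (A2 * ((k * L + 1) * (N : ℝ) ^ (k + 4)))) := hmain.trans (by gcongr)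
  have hker : ContinuousOn (fun t : ℝ => twistKernel k N h t₀ d (2 + I * t)) (Set.uIcc u v) := by
    intro t ht
    rw [Set.uIcc_of_le huv] at ht
    exact (ContinuousAt.comp_of_eq (y := (2 + I * t : ℂ))
      (differentiableAt_twistKernel k N h t₀ d (by
        simpa using (hu0.trans_le ht.1).ne')).continuousAt hline.continuousAt rfl).continuousWithinAt
  have hrepl : ‖(∫ t in u..v, twistKernel k N h t₀ d (2 + I * t)) - ∫ t in u..v, f t‖ ≤
      A2 * ((N : ℝ) ^ (k + 4) * (k * ((6 + h * L) / T) + 2 * (2 + h * L) / h ^ 2)) * Real.exp 3 *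
        (2 * (h * L)) := by
    rw [← intervalIntegral.integral_sub hker.intervalIntegrable (hfc.intervalIntegrable _ _)]
    have hlen : |v - u| = 2 * (h * L) := by
      rw [abs_of_nonneg (by linarith), hu_def, hv_def]; ring
    rw [← hlen]
    refine intervalIntegral.norm_integral_le_of_norm_le_const fun t ht => ?_
    rw [Set.uIoc_of_le huv] at ht
    exact norm_twistKernel_two_sub_le k N hh hT hL h1
      (abs_le.mpr ⟨by linarith [ht.1], by linarith [ht.2]⟩)
  rw [hibp]
  set Mn : ℂ := ((√Real.pi * h * ∑ m ∈ Finset.Icc 1 N, (piltz k m : ℝ) * b m / m : ℝ) : ℂ)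
  set X := ∫ t in u..v, twistKernel k N h t₀ d (1 / 2 + I * t)
  set Y := ∫ t in u..v, twistKernel k N h t₀ d (2 + I * t)
  set V := ∫ t in u..v, f t
  set U := ∫ t, f t
  set b1 := riemannZeta (1 / 2 + I * v) ^ k *
        (dirPoly N d (1 / 2 + I * v) * gaussW h t₀ (1 / 2 + I * v))
  set b2 := riemannZeta (1 / 2 + I * u) ^ k *
        (dirPoly N d (1 / 2 + I * u) * gaussW h t₀ (1 / 2 + I * u))
  -- X, Y, V, U, Mn are the successive stages: critical line, line Re s = 2, frozen integrand, whole
  -- line, diagonal.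
  have hdec : b1 - b2 + I * X - I * Mn = (b1 - b2) + I * ((X - Y) + (Y - V) - (U - V) + (U - Mn)) := by
    ring
  rw [hdec]
  refine (norm_add_le _ _).trans ?_
  rw [norm_mul, norm_I, one_mul]
  have n1 := norm_sub_le b1 b2
  have n2 := norm_add_le ((X - Y) + (Y - V) - (U - V)) (U - Mn)
  have n3 := norm_sub_le ((X - Y) + (Y - V)) (U - V)
  have n4 := norm_add_le (X - Y) (Y - V)
  unfold twistError
  linarith

/-! ### The second moment of the polynomial and the local lower bound -/

/-- Gaussian second moment of a Dirichlet polynomial on the critical line. -/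
theorem integral_normSq_dirPoly_le (k N : ℕ) {h t₀ u v : ℝ} (hh : 0 < h) (hN : 32 * N ≤ h ^ 2)
    (huv : u ≤ v) :
    ∫ t in u..v, ‖dirPoly N (fun m => (piltz k m : ℝ)) (1 / 2 + I * t)‖ ^ 2 *
        Real.exp (-((t - t₀) / h) ^ 2) ≤
      √Real.pi * h * ((∑ m ∈ Finset.Icc 1 N, (piltz k m : ℝ) ^ 2 / m) +
        Real.exp (-(h ^ 2 / (32 * N ^ 2))) *
          ((∑' n : ℕ, (piltz k n : ℝ) / (n : ℝ) ^ 2) * (N : ℝ) ^ (k + 4))) := by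
  classical
  set d : ℕ → ℝ := fun m => (piltz k m : ℝ) with hd
  set a : ℕ → ℝ := fun n => if n ∈ Finset.Icc 1 N then d n else 0 with ha
  have hcont : Continuous fun t : ℝ => dirPoly N d (1 / 2 + I * t) := by
    have := continuous_dirPoly_line N d (1 / 2)
    push_cast at this
    exact this
  set g : ℝ → ℝ := fun t => ‖dirPoly N d (1 / 2 + I * t)‖ ^ 2 * Real.exp (-((t - t₀) / h) ^ 2)
    with hg
  have hbound : ∀ t : ℝ, ‖dirPoly N d (1 / 2 + I * t)‖ ^ 2 ≤
      (∑ m ∈ Finset.Icc 1 N, |d m| * m) ^ 2 := fun t => by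
    gcongr
    exact norm_dirPoly_le N d (by norm_num)
  have hgint : MeasureTheory.Integrable g := by
    refine (integrable_exp_neg_sq hh t₀).bdd_mul (hcont.norm.pow 2).aestronglyMeasurable
      (c := (∑ m ∈ Finset.Icc 1 N, |d m| * m) ^ 2) (MeasureTheory.ae_of_all _ fun t => ?_)
    rw [Real.norm_of_nonneg (by positivity)]
    exact hbound t
  have hle : ∫ t in u..v, g t ≤ ∫ t, g t := by
    rw [intervalIntegral.integral_of_le huv]
    exact MeasureTheory.setIntegral_le_integral hgint
      (MeasureTheory.ae_of_all _ fun t => by simp only [hg, Pi.zero_apply]; positivity)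
  refine hle.trans ?_
  set D : ℂ → ℂ := fun s => ∑ n ∈ Finset.Icc 1 N, (a n : ℂ) * (n : ℂ) ^ (-s) with hD
  have hzero : ∀ n ∉ Finset.Icc 1 N, a n = 0 := fun n hn => if_neg hn
  have hDs : ∀ t : ℝ, HasSum (fun n : ℕ => (a n : ℂ) * (n : ℂ) ^ (-(((1 / 2 : ℝ) : ℂ) + I * t)))
      (D (((1 / 2 : ℝ) : ℂ) + I * t)) := fun t =>
    hasSum_sum_of_ne_finset_zero fun n hn => by simp [hzero n hn]
  have hmain := norm_integral_dirichlet_sub_diagonal_le hh t₀ (1 / 2) hN (a := a)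
    (fun n => by simp only [ha]; split_ifs <;> simp [hd]) (by simp [ha]) d
    (summable_of_ne_finset_zero (s := Finset.Icc 1 N) fun n hn => by simp [hzero n hn])
    (summable_of_ne_finset_zero (s := Finset.Icc 1 N) fun n hn => by simp [hzero n hn]) hDs
  -- On the critical line the conjugate of m^(s-1) is m^(-s). So |A|^2 is a finite Dirichlet series
  -- times a Dirichlet polynomial, and the diagonal principle applies with σ = 1/2.
  have hDA : ∀ t : ℝ, D (((1 / 2 : ℝ) : ℂ) + I * t) * dirPoly N d (((1 / 2 : ℝ) : ℂ) + I * t) *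
      gaussW h t₀ (((1 / 2 : ℝ) : ℂ) + I * t) = ((g t : ℝ) : ℂ) := by
    intro t
    have e1 : D (((1 / 2 : ℝ) : ℂ) + I * t) = conj (dirPoly N d (1 / 2 + I * t)) := by
      simp only [hD, dirPoly, map_sum, map_mul, conj_ofReal]
      refine Finset.sum_congr rfl fun n hn => ?_
      have hn0 : n ≠ 0 := by have := (Finset.mem_Icc.mp hn).1; omega
      rw [natCast_cpow_eq_exp hn0, natCast_cpow_eq_exp hn0, ← exp_conj, map_mul, conj_ofReal]
      simp only [ha, if_pos hn]
      congr 3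
      apply Complex.ext <;> norm_num
    rw [e1, show ((1 / 2 : ℝ) : ℂ) = 1 / 2 by push_cast; rfl, conj_mul', gaussW_half]
    simp only [hg]
    push_cast
    rfl
  simp only [hDA, integral_complex_ofReal] at hmain
  rw [← ofReal_sub, norm_real, Real.norm_eq_abs] at hmain
  have h1 := (abs_le.mp hmain).2
  have h2 : ∑ m ∈ Finset.Icc 1 N, a m * d m / m = ∑ m ∈ Finset.Icc 1 N, (piltz k m : ℝ) ^ 2 / m := by
    refine Finset.sum_congr rfl fun m hm => ?_
    simp only [ha, if_pos hm, hd]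
    ring
  rw [h2] at h1
  have h3 : ∑' n : ℕ, a n / (n : ℝ) ^ 2 ≤ ∑' n : ℕ, (piltz k n : ℝ) / (n : ℝ) ^ 2 := by
    refine Summable.tsum_le_tsum (fun n => ?_)
      (summable_of_ne_finset_zero (s := Finset.Icc 1 N) fun n hn => by simp [hzero n hn])
      (summable_piltz_div_sq k)
    gcongr
    simp only [ha]
    split_ifs <;> simp [hd]
  have h4 := sum_abs_piltz_mul_sq_le k N
  have h5 : 0 ≤ ∑' n : ℕ, (piltz k n : ℝ) / (n : ℝ) ^ 2 := tsum_nonneg fun n => by positivity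
  have h6 : √Real.pi * h * (Real.exp (-(h ^ 2 / (32 * N ^ 2))) *
      ((∑' n : ℕ, a n / (n : ℝ) ^ 2) * ∑ m ∈ Finset.Icc 1 N, |d m| * (m : ℝ) ^ 2)) ≤
      √Real.pi * h * (Real.exp (-(h ^ 2 / (32 * N ^ 2))) *
          ((∑' n : ℕ, (piltz k n : ℝ) / (n : ℝ) ^ 2) * (N : ℝ) ^ (k + 4))) := by gcongr
  rw [mul_add]
  linarith

/-- Cauchy–Schwarz between E = (Z^k)' and the weight: the twisted integral J is at least QL/8, while
the weight has second moment at most 2Q. -/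
theorem window_lower_bound {k N : ℕ} (hk : 1 ≤ k) {C h t₀ T : ℝ}
    (hC : ∀ s : ℂ, 1 / 2 ≤ s.re → 1 ≤ s.im → ‖riemannZeta s‖ ≤ C * ‖s‖) (hC0 : 0 < C)
    (hh : 1 ≤ h) (hT : 8 ≤ T) (hL : 8 ≤ Real.log T)
    (h1 : T ≤ t₀ - h * Real.log T) (h2 : t₀ + h * Real.log T ≤ 2 * T) (hN : 32 * N ≤ h ^ 2)
    (hN1 : 1 ≤ N) (hNL : Real.log N ≤ Real.log T / 32) (herr : twistError k N C h T ≤ h)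
    (herr' : Real.exp (-(h ^ 2 / (32 * N ^ 2))) *
      ((∑' n : ℕ, (piltz k n : ℝ) / (n : ℝ) ^ 2) * (N : ℝ) ^ (k + 4)) ≤ 1) :
    Real.log T ^ 2 / 128 * (√Real.pi * h * ∑ m ∈ Finset.Icc 1 N, (piltz k m : ℝ) ^ 2 / m) ≤
      ∫ t in (t₀ - h * Real.log T)..(t₀ + h * Real.log T),
        (k * hardyZ t ^ (k - 1) * deriv hardyZ t) ^ 2 * Real.exp (-((t - t₀) / h) ^ 2) := by
  set L := Real.log T with hL_def
  set S := ∑ m ∈ Finset.Icc 1 N, (piltz k m : ℝ) ^ 2 / m with hS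
  set d : ℕ → ℝ := fun m => (piltz k m : ℝ) with hd
  set lam := Real.log (t₀ / (2 * Real.pi)) / 2 with hlam
  set u := t₀ - h * L with hu_def
  set v := t₀ + h * L with hv_def
  set E : ℝ → ℝ := fun t => k * hardyZ t ^ (k - 1) * deriv hardyZ t with hE
  set G : ℝ → ℝ := fun t => Real.exp (-((t - t₀) / h) ^ 2) with hG
  set A : ℝ → ℝ := fun t => ‖dirPoly N d (1 / 2 + I * t)‖ with hA
  have hh0 : 0 < h := by linarith
  have hR : 0 ≤ h * L := by positivity
  have huv : u ≤ v := by linarith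
  have hu0 : 0 < u := by linarith
  have hpi := Real.pi_gt_three
  have hpi4 := Real.pi_lt_d2
  have hspi : 1 ≤ √Real.pi := Real.one_le_sqrt.mpr (by linarith)
  have hS1 : 1 ≤ S := by
    have : (piltz k 1 : ℝ) ^ 2 / (1 : ℕ) ≤ S := by
      rw [hS]
      exact Finset.single_le_sum (f := fun m : ℕ => (piltz k m : ℝ) ^ 2 / m)
        (fun m _ => by positivity) (Finset.mem_Icc.mpr ⟨le_rfl, hN1⟩)
    simpa [piltz_one_apply] using this
  have hmain := norm_twisted_integral_sub_main_le k N hC hC0 hh hT (by linarith) h1 h2 hN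
  have hsecond := integral_normSq_dirPoly_le k N (t₀ := t₀) hh0 hN huv
  have hlamL : L / 2 - 1 ≤ lam := by
    have e1 : Real.log (t₀ / (2 * Real.pi)) = Real.log t₀ - Real.log (2 * Real.pi) :=
      Real.log_div (by linarith) (by positivity)
    have e2 : L ≤ Real.log t₀ := Real.log_le_log (by linarith) (by linarith)
    have e3 : Real.log (2 * Real.pi) ≤ 2 := by
      rw [Real.log_le_iff_le_exp (by positivity)]
      have : Real.exp 2 = Real.exp 1 * Real.exp 1 := by rw [← Real.exp_add]; norm_num
      have := Real.exp_one_gt_d9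
      nlinarith
    rw [hlam, e1]
    linarith
  have hk1 : (1 : ℝ) ≤ k := by exact_mod_cast hk
  set Mn := √Real.pi * h * ∑ m ∈ Finset.Icc 1 N, (piltz k m : ℝ) *
        (k * lam * (piltz k m : ℝ) - (piltz k m : ℝ) * Real.log m) / m with hMn
  -- For k ≥ 1, λ ≥ L/2 - 1 and log m ≤ L/32, the factor kλ - log m is at least L/4 once L ≥ 8.
  have hMn_ge : √Real.pi * h * S * (L / 4) ≤ Mn := by
    rw [hMn, mul_assoc (√Real.pi * h), hS, Finset.sum_mul]
    gcongr with m hm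
    obtain ⟨hm1, hmN⟩ := Finset.mem_Icc.mp hm
    have hm0 : (0 : ℝ) < m := by exact_mod_cast hm1
    have e1 : Real.log m ≤ Real.log N := Real.log_le_log hm0 (by exact_mod_cast hmN)
    have e2 : L / 4 ≤ k * lam - Real.log m := by nlinarith
    calc (piltz k m : ℝ) ^ 2 / m * (L / 4) ≤ (piltz k m : ℝ) ^ 2 / m * (k * lam - Real.log m) := by
          gcongr
      _ = _ := by ring
  set Q := √Real.pi * h * S with hQ
  have hQh : h ≤ Q := by
    rw [hQ]
    have : 1 ≤ √Real.pi * S := one_le_mul_of_one_le_of_one_le hspi hS1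
    nlinarith
  set J : ℂ := ∫ t in u..v, ((E t : ℝ) : ℂ) * twistWeight k N h t₀ d t with hJ
  -- The main term is at least QL/4, and the error is at most h ≤ Q ≤ QL/8.
  have hJ_ge : Q * L / 8 ≤ ‖J‖ := by
    have e1 : ‖I * (Mn : ℂ)‖ = Mn := by
      have : 0 ≤ Q * (L / 4) := by positivity
      rw [norm_mul, norm_I, one_mul, norm_real, Real.norm_of_nonneg (this.trans hMn_ge)]
    have e2 := norm_sub_norm_le (I * (Mn : ℂ)) J
    rw [norm_sub_rev, e1] at e2
    have e3 : ‖J - I * (Mn : ℂ)‖ ≤ h := hmain.trans herr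
    nlinarith
  have hEc : Continuous E :=
    (continuous_const.mul (differentiable_hardyZ.continuous.pow _)).mul continuous_deriv_hardyZ
  have hGc : Continuous G := by simp only [hG]; fun_prop
  have hAc : Continuous A := by
    have := continuous_dirPoly_line N d (1 / 2)
    push_cast at this
    exact this.norm
  have hX : IntervalIntegrable (fun t => E t ^ 2 * G t) MeasureTheory.volume u v :=
    ((hEc.pow 2).mul hGc).intervalIntegrable _ _
  have hY : IntervalIntegrable (fun t => A t ^ 2 * G t) MeasureTheory.volume u v :=
    ((hAc.pow 2).mul hGc).intervalIntegrable _ _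
  have hL0 : 0 < L := by linarith
  -- Cauchy–Schwarz in weighted AM–GM form. The weights are chosen so that the second moment
  -- contributes at most (L/32)(2Q) = QL/16, half of the lower bound for |J|.
  have hJ_le : ‖J‖ ≤ 8 / L * (∫ t in u..v, E t ^ 2 * G t) + L / 32 * ∫ t in u..v, A t ^ 2 * G t := by
    rw [← intervalIntegral.integral_const_mul, ← intervalIntegral.integral_const_mul,
      ← intervalIntegral.integral_add (hX.const_mul _) (hY.const_mul _)]
    refine intervalIntegral.norm_integral_le_of_norm_le huv
      (MeasureTheory.ae_of_all _ fun t _ => ?_) ((hX.const_mul _).add (hY.const_mul _))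
    have hw : ‖twistWeight k N h t₀ d t‖ = A t * G t := by
      rw [twistWeight, norm_mul, norm_pow, norm_inv, norm_chiInvSqrt, inv_one, one_pow, one_mul,
        norm_mul, gaussW_half, norm_real, Real.norm_of_nonneg (Real.exp_pos _).le]
    rw [norm_mul, hw, norm_real, Real.norm_eq_abs, ← sq_abs (E t)]
    have hG0 : 0 ≤ G t := (Real.exp_pos _).le
    have hamgm : |E t| * A t ≤ 8 / L * |E t| ^ 2 + L / 32 * A t ^ 2 := by
      have : 8 / L * |E t| ^ 2 + L / 32 * A t ^ 2 - |E t| * A t =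
          8 / L * (|E t| - L / 16 * A t) ^ 2 := by
        field_simp
        ring
      have h0 : 0 ≤ 8 / L * (|E t| - L / 16 * A t) ^ 2 := by positivity
      linarith
    calc |E t| * (A t * G t) = |E t| * A t * G t := by ring
      _ ≤ (8 / L * |E t| ^ 2 + L / 32 * A t ^ 2) * G t := by gcongr
      _ = _ := by ring
  have hY_le : ∫ t in u..v, A t ^ 2 * G t ≤ 2 * Q := by
    refine hsecond.trans ?_
    have e1 : √Real.pi * h * (S + 1) ≤ √Real.pi * h * (S + S) := by gcongr
    have e2 : √Real.pi * h * (S + S) = 2 * Q := by rw [hQ]; ring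
    refine le_trans ?_ (e1.trans e2.le)
    gcongr
  have hfin : Q * L / 16 ≤ 8 / L * ∫ t in u..v, E t ^ 2 * G t := by
    have : L / 32 * ∫ t in u..v, A t ^ 2 * G t ≤ L / 32 * (2 * Q) := by gcongr
    have e1 : L / 32 * (2 * Q) = Q * L / 16 := by ring
    linarith
  calc L ^ 2 / 128 * Q = L / 8 * (Q * L / 16) := by ring
    _ ≤ L / 8 * (8 / L * ∫ t in u..v, E t ^ 2 * G t) := by gcongr
    _ = _ := by
      have e1 : L / 8 * (8 / L) = 1 := by field_simp
      rw [← mul_assoc, e1, one_mul]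

/-! ### Choice of parameters and smallness of the errors -/

open Filter Topology in
theorem eventually_mul_pow_mul_exp_neg_log_sq_le (K : ℝ) (n : ℕ) :
    ∀ᶠ T : ℝ in atTop, K * T ^ n * Real.exp (-Real.log T ^ 2 / 2) ≤ 1 / 8 := by
  filter_upwards [Real.tendsto_log_atTop.eventually_ge_atTop (2 * (n + 1) : ℝ),
    eventually_ge_atTop (8 * |K|), eventually_gt_atTop 0] with T h1 h2 h3
  have e1 : T ^ n * Real.exp (-Real.log T ^ 2 / 2) ≤ 1 / T := by
    have : T ^ n = Real.exp (n * Real.log T) := by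
      rw [mul_comm, Real.exp_mul, Real.exp_log h3, Real.rpow_natCast]
    rw [this, ← Real.exp_add, one_div, ← Real.exp_log h3, ← Real.exp_neg, Real.log_exp]
    apply Real.exp_le_exp.mpr
    nlinarith [n.cast_nonneg (α := ℝ)]
  calc K * T ^ n * Real.exp (-Real.log T ^ 2 / 2)
      ≤ |K| * (T ^ n * Real.exp (-Real.log T ^ 2 / 2)) := by
        rw [mul_assoc]
        gcongr
        exact le_abs_self K
    _ ≤ |K| * (1 / T) := by gcongr
    _ ≤ 1 / 8 := by
        rw [mul_one_div, div_le_div_iff₀ h3 (by norm_num)]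
        linarith

open Filter Topology in
theorem eventually_const_mul_log_le_rpow (K : ℝ) {β : ℝ} (hβ : 0 < β) :
    ∀ᶠ T : ℝ in atTop, K * Real.log T ≤ T ^ β := by
  have h := (isLittleO_log_rpow_atTop hβ).def (c := 1 / (|K| + 1)) (by positivity)
  filter_upwards [h, eventually_ge_atTop 1] with T h1 h2
  have hl := Real.log_nonneg h2
  rw [Real.norm_of_nonneg hl, Real.norm_of_nonneg (by positivity), div_mul_eq_mul_div, one_mul,
    le_div_iff₀ (by positivity)] at h1
  nlinarith [le_abs_self K]

open Filter Topology in
theorem eventually_mul_sq_mul_exp_neg_rpow_le (K : ℝ) {β : ℝ} (hβ : 0 < β) :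
    ∀ᶠ T : ℝ in atTop, K * T ^ 2 * Real.exp (-(T ^ β / 32)) ≤ 1 / 8 := by
  filter_upwards [eventually_const_mul_log_le_rpow 96 hβ,
    eventually_ge_atTop (8 * |K|), eventually_gt_atTop 0] with T h1 h2 h3
  have e1 : T ^ 2 * Real.exp (-(T ^ β / 32)) ≤ 1 / T := by
    have : T ^ 2 = Real.exp (2 * Real.log T) := by
      rw [mul_comm, Real.exp_mul, Real.exp_log h3]
      norm_num
    rw [this, ← Real.exp_add]
    calc _ ≤ Real.exp (-Real.log T) := by
          apply Real.exp_le_exp.mpr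
          linarith
      _ = 1 / T := by rw [Real.exp_neg, Real.exp_log h3, one_div]
  calc K * T ^ 2 * Real.exp (-(T ^ β / 32))
      ≤ |K| * (T ^ 2 * Real.exp (-(T ^ β / 32))) := by
        rw [mul_assoc]
        gcongr
        exact le_abs_self K
    _ ≤ |K| * (1 / T) := by gcongr
    _ ≤ 1 / 8 := by
        rw [mul_one_div, div_le_div_iff₀ h3 (by norm_num)]
        linarith

open Filter Topology in
theorem eventually_mul_log_sq_mul_rpow_le (K : ℝ) {β : ℝ} (hβ : 0 < β) :
    ∀ᶠ T : ℝ in atTop, K * Real.log T ^ 2 * T ^ (β / 4) ≤ T ^ β / 8 := by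
  filter_upwards [eventually_const_mul_log_le_rpow 1 (by positivity : 0 < β / 4),
    (tendsto_rpow_atTop (by positivity : 0 < β / 4)).eventually_ge_atTop (8 * |K|),
    eventually_ge_atTop 1] with T h1 h2 h3
  have hl := Real.log_nonneg h3
  rw [one_mul] at h1
  have e1 : T ^ β = (T ^ (β / 4)) ^ 4 := by
    rw [← Real.rpow_natCast, ← Real.rpow_mul (by linarith)]
    congr 1
    push_cast
    ring
  rw [e1]
  set y := T ^ (β / 4)
  have hy : 0 ≤ y := hl.trans h1
  calc K * Real.log T ^ 2 * y ≤ |K| * y ^ 2 * y := by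
        gcongr
        exact le_abs_self K
    _ ≤ y ^ 4 / 8 := by
        have : 0 ≤ y ^ 3 := by positivity
        nlinarith

-- The parameters are h = T^β and N = ⌊T^γ⌋. Each of the five errors is eventually at most h/8. All
-- but the third carry an exponentially small factor. The third is of size N^(k+4) L^2 and decides
-- how small γ must be.
set_option maxHeartbeats 1000000 in
open Filter Topology in
theorem exists_window_lower_bound {k : ℕ} (hk : 1 ≤ k) {β : ℝ} (hβ : 0 < β) (hβ2 : β ≤ 1 / 2) :
    ∃ c : ℝ, 0 < c ∧ ∀ᶠ T : ℝ in atTop, ∀ t₀ : ℝ, T ≤ t₀ - T ^ β * Real.log T →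
      t₀ + T ^ β * Real.log T ≤ 2 * T →
      c * (T ^ β * Real.log T ^ (k ^ 2 + 2)) ≤
        ∫ t in (t₀ - T ^ β * Real.log T)..(t₀ + T ^ β * Real.log T),
          (k * hardyZ t ^ (k - 1) * deriv hardyZ t) ^ 2 *
            Real.exp (-((t - t₀) / T ^ β) ^ 2) := by
  obtain ⟨C, hC0, hC⟩ := exists_norm_riemannZeta_le
  obtain ⟨c₀, hc₀, hS⟩ := exists_mul_log_pow_le_sum_piltz_sq k (by omega)
  set A2 := ∑' n : ℕ, (piltz k n : ℝ) / (n : ℝ) ^ 2 with hA2_def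
  have hA2 : 0 ≤ A2 := tsum_nonneg fun n => by positivity
  -- This choice makes N^(k+4) ≤ T^(β/4), so the third error is at most a constant times L^2
  -- T^(β/4), well below h. It also gives γ ≤ 1/32, hence log N ≤ L/32.
  set γ : ℝ := β / (4 * (k + 4)) with hγ_def
  have hk4 : (0 : ℝ) < 4 * (k + 4) := by positivity
  have hγ : 0 < γ := by positivity
  have hγk : γ * (k + 4) = β / 4 := by rw [hγ_def]; field_simp
  have hγ32 : γ ≤ 1 / 32 := by
    have : (0 : ℝ) ≤ k := k.cast_nonneg
    nlinarith
  have hγβ : γ ≤ β := by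
    have : (0 : ℝ) ≤ k := k.cast_nonneg
    nlinarith
  -- The power of γ/2 comes from log N ≥ (γ/2) log T, and 128 from `window_lower_bound`.
  refine ⟨c₀ * (γ / 2) ^ (k ^ 2) / 128, by positivity, ?_⟩
  filter_upwards [Real.tendsto_log_atTop.eventually_ge_atTop 8, eventually_ge_atTop 8,
    (tendsto_rpow_atTop hβ).eventually_ge_atTop 32,
    (tendsto_rpow_atTop (by positivity : 0 < γ / 2)).eventually_ge_atTop 2,
    eventually_mul_pow_mul_exp_neg_log_sq_le (2 * (4 * C) ^ k) (k + 1),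
    eventually_mul_pow_mul_exp_neg_log_sq_le (3 * (4 * C) ^ k * (k + 5) * Real.exp 3) (k + 2),
    eventually_mul_pow_mul_exp_neg_log_sq_le (A2 * (k + 1) * Real.exp 3 * (√Real.pi * √2)) 2,
    eventually_mul_sq_mul_exp_neg_rpow_le (√Real.pi * (A2 * (k + 1))) hβ,
    eventually_mul_sq_mul_exp_neg_rpow_le (8 * A2) hβ,
    eventually_mul_log_sq_mul_rpow_le (A2 * Real.exp 3 * (4 * k + 8)) hβ] with
    T hL hT hh32 hy e1 e2 e4 e5 e6 e3 t₀ h1 h2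
  set L := Real.log T with hL_def
  set h := T ^ β with hh_def
  set N := ⌊T ^ γ⌋₊ with hN_def
  set P := (N : ℝ) ^ (k + 4) with hP_def
  have hT0 : 0 < T := by linarith
  have hT1 : 1 ≤ T := by linarith
  have hL0 : 0 < L := by linarith
  have hk0 : (0 : ℝ) ≤ k := k.cast_nonneg
  have hh1 : 1 ≤ h := by linarith
  have hLT : L ≤ T := (Real.log_le_sub_one_of_pos hT0).trans (by linarith)
  have hNle : (N : ℝ) ≤ T ^ γ := Nat.floor_le (by positivity)
  -- With y = T^(γ/2) ≥ 2, the floor of y^2 exceeds y^2 - 1 ≥ y.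
  have hNge : T ^ (γ / 2) ≤ N := by
    have e : T ^ γ = T ^ (γ / 2) * T ^ (γ / 2) := by
      rw [← Real.rpow_add hT0]; congr 1; ring
    have := Nat.lt_floor_add_one (T ^ γ)
    rw [← hN_def, e] at this
    nlinarith
  have hN1' : (1 : ℝ) ≤ N := by linarith
  have hN1 : 1 ≤ N := by exact_mod_cast hN1'
  have hlogN : Real.log N ≤ L / 32 := by
    calc Real.log N ≤ Real.log (T ^ γ) := Real.log_le_log (by linarith) hNle
      _ = γ * L := Real.log_rpow hT0 γ
      _ ≤ L / 32 := by nlinarith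
  have hlogN' : γ / 2 * L ≤ Real.log N := by
    rw [hL_def, ← Real.log_rpow hT0]
    exact Real.log_le_log (by positivity) hNge
  have hPle : P ≤ T ^ (β / 4) := by
    calc P ≤ (T ^ γ) ^ (k + 4) := by rw [hP_def]; gcongr
      _ = T ^ (β / 4) := by
        rw [← Real.rpow_natCast, ← Real.rpow_mul hT0.le, ← hγk]
        push_cast; rfl
  have hPT : P ≤ T := hPle.trans (by
    calc T ^ (β / 4) ≤ T ^ (1 : ℝ) := Real.rpow_le_rpow_of_exponent_le hT1 (by linarith)
      _ = T := Real.rpow_one T)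
  have hP0 : 0 ≤ P := by positivity
  have hhh : h ^ 2 ≤ T := by
    rw [hh_def, ← Real.rpow_natCast, ← Real.rpow_mul hT0.le]
    calc T ^ (β * (2 : ℕ)) ≤ T ^ (1 : ℝ) :=
          Real.rpow_le_rpow_of_exponent_le hT1 (by push_cast; linarith)
      _ = T := Real.rpow_one T
  have hTγ : T ^ γ ≤ h := Real.rpow_le_rpow_of_exponent_le hT1 hγβ
  have hN : 32 * N ≤ h ^ 2 := by
    calc 32 * (N : ℝ) ≤ h * h := mul_le_mul hh32 (hNle.trans hTγ) (by positivity) (by positivity)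
      _ = h ^ 2 := (sq h).symm
  have hexpN : Real.exp (-(h ^ 2 / (32 * N ^ 2))) ≤ Real.exp (-(h / 32)) := by
    apply Real.exp_le_exp.mpr
    rw [neg_le_neg_iff, div_le_div_iff₀ (by norm_num) (by positivity)]
    have hN2 : (N : ℝ) ^ 2 ≤ h := by
      calc (N : ℝ) ^ 2 ≤ P := pow_le_pow_right₀ hN1' (by omega)
        _ ≤ T ^ (β / 4) := hPle
        _ ≤ h := Real.rpow_le_rpow_of_exponent_le hT1 (by linarith)
    calc h * (32 * (N : ℝ) ^ 2) ≤ h * (32 * h) := by gcongr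
      _ = h ^ 2 * 32 := by ring
  have hkL' : k * L ≤ k * T := mul_le_mul_of_nonneg_left hLT hk0
  have hkL : k * L + 1 ≤ (k + 1) * T := by linarith
  have hqq : Real.exp (-L ^ 2) ≤ Real.exp (-L ^ 2 / 2) := by
    apply Real.exp_le_exp.mpr
    linarith [sq_nonneg L]
  have hCT : (4 * C * T) ^ k = (4 * C) ^ k * T ^ k := mul_pow _ _ _
  have f1 : 2 * ((4 * C * T) ^ k * P * Real.exp (-L ^ 2)) ≤ h / 8 := by
    calc _ ≤ 2 * ((4 * C * T) ^ k * T * Real.exp (-L ^ 2 / 2)) := by gcongr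
      _ = 2 * (4 * C) ^ k * T ^ (k + 1) * Real.exp (-L ^ 2 / 2) := by rw [hCT]; ring
      _ ≤ 1 / 8 := e1
      _ ≤ h / 8 := by linarith
  have f2 : 3 * ((4 * C * T) ^ k * (P * (k * L + 1 + 4 * T)) * (Real.exp 3 * Real.exp (-L ^ 2))) ≤
      h / 8 := by
    have : k * L + 1 + 4 * T ≤ (k + 5) * T := by linarith
    calc _ ≤ 3 * ((4 * C * T) ^ k * (T * ((k + 5) * T)) *
          (Real.exp 3 * Real.exp (-L ^ 2 / 2))) := by gcongr
      _ = 3 * (4 * C) ^ k * (k + 5) * Real.exp 3 * T ^ (k + 2) * Real.exp (-L ^ 2 / 2) := by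
          rw [hCT]; ring
      _ ≤ 1 / 8 := e2
      _ ≤ h / 8 := by linarith
  have f3 : A2 * (P * (k * ((6 + h * L) / T) + 2 * (2 + h * L) / h ^ 2)) * Real.exp 3 *
      (2 * (h * L)) ≤ h / 8 := by
    have g0 : 8 ≤ h * L := hL.trans (le_mul_of_one_le_left hL0.le hh1)
    -- This is where β ≤ 1/2 enters, through h^2 ≤ T.
    have g1 : (6 + h * L) / T ≤ 2 * L / h := by
      rw [div_le_div_iff₀ hT0 (by linarith)]
      calc (6 + h * L) * h ≤ (2 * (h * L)) * h := by gcongr; linarith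
        _ = 2 * L * h ^ 2 := by ring
        _ ≤ 2 * L * T := by gcongr
    have g2 : 2 * (2 + h * L) / h ^ 2 ≤ 4 * L / h := by
      rw [div_le_div_iff₀ (by positivity) (by linarith)]
      calc 2 * (2 + h * L) * h ≤ 2 * (2 * (h * L)) * h := by gcongr; linarith
        _ = 4 * L * h ^ 2 := by ring
    calc _ ≤ A2 * (T ^ (β / 4) * (k * (2 * L / h) + 4 * L / h)) * Real.exp 3 * (2 * (h * L)) := by
          gcongr
      _ = A2 * Real.exp 3 * (4 * k + 8) * L ^ 2 * T ^ (β / 4) := by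
          field_simp
          ring
      _ ≤ h / 8 := e3
  have f4 : A2 * ((k * L + 1) * P) * Real.exp 3 * Real.exp (-L ^ 2 / 2) * (√Real.pi * (√2 * h)) ≤
      h / 8 := by
    calc _ ≤ A2 * ((k + 1) * T * T) * Real.exp 3 * Real.exp (-L ^ 2 / 2) *
          (√Real.pi * (√2 * h)) := by gcongr
      _ = (A2 * (k + 1) * Real.exp 3 * (√Real.pi * √2) * T ^ 2 * Real.exp (-L ^ 2 / 2)) * h := by
          ring
      _ ≤ 1 / 8 * h := by gcongr
      _ = h / 8 := by ring
  have f5 : √Real.pi * h * (Real.exp (-(h ^ 2 / (32 * N ^ 2))) * (A2 * ((k * L + 1) * P))) ≤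
      h / 8 := by
    calc _ ≤ √Real.pi * h * (Real.exp (-(h / 32)) * (A2 * ((k + 1) * T * T))) := by gcongr
      _ = (√Real.pi * (A2 * (k + 1)) * T ^ 2 * Real.exp (-(h / 32))) * h := by ring
      _ ≤ 1 / 8 * h := by gcongr
      _ = h / 8 := by ring
  have herr : twistError k N C h T ≤ h := by
    unfold twistError
    linarith
  have herr' : Real.exp (-(h ^ 2 / (32 * N ^ 2))) * (A2 * P) ≤ 1 := by
    calc _ ≤ Real.exp (-(h / 32)) * (A2 * T ^ 2) := by
          gcongr
          exact hPT.trans (le_self_pow₀ hT1 two_ne_zero)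
      _ = (8 * A2 * T ^ 2 * Real.exp (-(h / 32))) / 8 := by ring
      _ ≤ 1 := by linarith
  refine le_trans ?_
    (window_lower_bound hk hC hC0 hh1 hT hL h1 h2 hN hN1 hlogN herr herr')
  have hspi : 1 ≤ √Real.pi := Real.one_le_sqrt.mpr (by linarith [Real.pi_gt_three])
  have hSN := hS N hN1
  calc c₀ * (γ / 2) ^ (k ^ 2) / 128 * (h * L ^ (k ^ 2 + 2))
      = L ^ 2 / 128 * (1 * h * (c₀ * (γ / 2 * L) ^ (k ^ 2))) := by rw [mul_pow]; ring
    _ ≤ L ^ 2 / 128 * (√Real.pi * h * (c₀ * Real.log N ^ (k ^ 2))) := by gcongr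
    _ ≤ _ := by gcongr

/-! ### Averaging over the centre and conclusion -/

/-- Averaging local Gaussian lower bounds over the centre of the Gaussian. -/
theorem mul_le_integral_of_window_le {F : ℝ → ℝ} (hF : Continuous F) (hF0 : ∀ t, 0 ≤ F t)
    {h R B u v : ℝ} (hh : 0 < h) (hR : 0 ≤ R) (huv : u + R ≤ v - R)
    (hB : ∀ t₀ ∈ Set.Icc (u + R) (v - R),
      B ≤ ∫ t in (t₀ - R)..(t₀ + R), F t * Real.exp (-((t - t₀) / h) ^ 2)) :
    (v - u - 2 * R) * B ≤ √Real.pi * h * ∫ t in u..v, F t := by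
  have huv' : u ≤ v := by linarith
  set g : ℝ → ℝ → ℝ := fun t₀ t => F t * Real.exp (-((t - t₀) / h) ^ 2) with hg
  have hgc : Continuous (Function.uncurry g) := by
    simp only [hg, Function.uncurry_def]
    fun_prop
  have hg1 : ∀ t₀, Continuous (g t₀) := fun t₀ => by simp only [hg]; fun_prop
  have hg0 : ∀ t₀ t, 0 ≤ g t₀ t := fun t₀ t => mul_nonneg (hF0 t) (Real.exp_pos _).le
  have hinner : Continuous fun t₀ => ∫ t in u..v, g t₀ t :=
    intervalIntegral.continuous_parametric_intervalIntegral_of_continuous' hgc u v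
  have hlow : (v - u - 2 * R) * B ≤ ∫ t₀ in (u + R)..(v - R), ∫ t in u..v, g t₀ t := by
    have e1 : ∫ _ in (u + R)..(v - R), B = (v - u - 2 * R) * B := by
      rw [intervalIntegral.integral_const, smul_eq_mul]; ring
    rw [← e1]
    refine intervalIntegral.integral_mono_on huv (by simp) (hinner.intervalIntegrable _ _)
      fun t₀ ht₀ => (hB t₀ ht₀).trans ?_
    exact intervalIntegral.integral_mono_interval (by linarith [ht₀.1]) (by linarith)
      (by linarith [ht₀.2]) (MeasureTheory.ae_of_all _ fun t => hg0 t₀ t)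
      ((hg1 t₀).intervalIntegrable _ _)
  -- After the exchange each F(t) is weighted by the integral of the Gaussian over its centre, which
  -- is at most √π h.
  have hswap : ∫ t₀ in (u + R)..(v - R), ∫ t in u..v, g t₀ t =
      ∫ t in u..v, ∫ t₀ in (u + R)..(v - R), g t₀ t :=
    MeasureTheory.intervalIntegral_intervalIntegral_swap
      ((hgc.continuousOn.integrableOn_compact (isCompact_uIcc.prod isCompact_uIcc)).mono_set
        (Set.prod_mono Set.uIoc_subset_uIcc Set.uIoc_subset_uIcc))
  refine hlow.trans (hswap.le.trans ?_)
  rw [← intervalIntegral.integral_const_mul]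
  refine intervalIntegral.integral_mono_on huv' ?_
    ((hF.intervalIntegrable _ _).const_mul _) fun t _ => ?_
  · have : Continuous (Function.uncurry fun t t₀ => g t₀ t) := by
      simp only [hg, Function.uncurry_def]
      fun_prop
    exact (intervalIntegral.continuous_parametric_intervalIntegral_of_continuous' this
      _ _).intervalIntegrable _ _
  · simp only [hg]
    rw [intervalIntegral.integral_const_mul, mul_comm]
    have hsymm : ∀ t₀, Real.exp (-((t - t₀) / h) ^ 2) = Real.exp (-((t₀ - t) / h) ^ 2) := fun t₀ => by
      rw [← neg_sub t₀ t, neg_div, neg_sq]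
    simp only [hsymm]
    refine mul_le_mul_of_nonneg_right ?_ (hF0 t)
    rw [← integral_exp_neg_sq hh t, intervalIntegral.integral_of_le huv]
    exact MeasureTheory.setIntegral_le_integral (integrable_exp_neg_sq hh t)
      (MeasureTheory.ae_of_all _ fun _ => (Real.exp_pos _).le)

theorem theorem1 (hRH : RiemannHypothesis) (k : ℕ) (hk : 2 ≤ k)
    (α : ℝ) (hα : 0 < α) (hα1 : α ≤ 1) :
    ∃ c : ℝ, 0 < c ∧ ∃ T₀ : ℝ, ∀ T : ℝ, T₀ ≤ T → ∀ H : ℝ, T ^ α ≤ H → H ≤ T →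
      c * (H * Real.log T ^ (k ^ 2 + 2)) ≤
        ∫ t in T..(T + H), (deriv hardyZ t) ^ 2 * hardyZ t ^ (2 * k - 2) := by
  -- The exponent β = α/2 makes the half-width T^(α/2) log T of a window at most H/4, so the
  -- admissible centres fill at least half of [T, T+H]. The hypothesis α ≤ 1 gives β ≤ 1/2.
  obtain ⟨c, hc, hev⟩ := exists_window_lower_bound (k := k) (by omega)
    (by positivity : 0 < α / 2) (by linarith)
  obtain ⟨T₀, hT₀⟩ := Filter.eventually_atTop.mp (hev.and
    ((eventually_const_mul_log_le_rpow 4 (by positivity : 0 < α / 2)).and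
      (Filter.eventually_ge_atTop 1)))
  have hk0 : (0 : ℝ) < k := by positivity
  refine ⟨c / (2 * √Real.pi * k ^ 2), by positivity, T₀, fun T hT H hH1 hH2 => ?_⟩
  obtain ⟨hwin, hlog, hT1⟩ := hT₀ T hT
  set h := T ^ (α / 2) with hh_def
  set L := Real.log T with hL_def
  have hT0 : 0 < T := by linarith
  have hh : 0 < h := by positivity
  have hL : 0 ≤ L := Real.log_nonneg hT1
  have hhH : h * h ≤ H := by
    rw [hh_def, ← Real.rpow_add hT0, add_halves]
    exact hH1
  have hRH4 : 4 * (h * L) ≤ H := by nlinarith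
  have hR : 0 ≤ h * L := by positivity
  set F : ℝ → ℝ := fun t => (k * hardyZ t ^ (k - 1) * deriv hardyZ t) ^ 2 with hF
  have hFc : Continuous F :=
    ((continuous_const.mul (differentiable_hardyZ.continuous.pow _)).mul
      continuous_deriv_hardyZ).pow 2
  have havg := mul_le_integral_of_window_le hFc (fun t => sq_nonneg _) (u := T) (v := T + H)
    (R := h * L) hh hR (by linarith) fun t₀ ht₀ =>
      hwin t₀ (by linarith [ht₀.1]) (by linarith [ht₀.2])
  have hFint : ∫ t in T..(T + H), F t =
      k ^ 2 * ∫ t in T..(T + H), (deriv hardyZ t) ^ 2 * hardyZ t ^ (2 * k - 2) := by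
    rw [← intervalIntegral.integral_const_mul]
    congr 1
    funext t
    simp only [hF]
    rw [show 2 * k - 2 = (k - 1) * 2 by omega, pow_mul]
    ring
  rw [hFint] at havg
  set V := ∫ t in T..(T + H), (deriv hardyZ t) ^ 2 * hardyZ t ^ (2 * k - 2)
  set Lk := L ^ (k ^ 2 + 2)
  have hLk : 0 ≤ Lk := by positivity
  -- The windows bring a factor h on the left and averaging brings √π h on the right. The two
  -- cancel, leaving a bound linear in H.
  have h1 : H / 2 * (c * (h * Lk)) ≤ √Real.pi * h * (k ^ 2 * V) := by
    refine le_trans ?_ havg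
    gcongr
    linarith
  have h2 : c * (H * Lk) ≤ V * (2 * √Real.pi * k ^ 2) := by
    have e1 : h * (c * (H * Lk)) ≤ h * (V * (2 * √Real.pi * k ^ 2)) := by nlinarith
    exact le_of_mul_le_mul_left e1 hh
  rw [div_mul_eq_mul_div, div_le_iff₀ (by positivity)]
  exact h2
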